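/- Let $d\ge 1$. For observations $x_1,x_2,\dots\in\mathbb R^d$ put $s_n=\sum_{i\le n}x_ix_i^\top$ and let $$L_n(\mathcal H)=\frac{|\mathcal H|^{n/2}}{\pi^{nd/2}}\exp\{-\mathrm{tr}(\mathcal H s_n)\}$$ be the likelihood of the half-precision $\mathcal H=\frac12\Sigma^{-1}$ of a zero-mean Gaussian. Consider three models for $\mathcal H$, with mutually unrelated hyperparameters. - Model $A$: $\mathcal H$ is an arbitrary positive definite matrix, with Wishart prior density $\frac{|B|^{\alpha_A}}{\Gamma_d(\alpha_A)}|\mathcal H|^{\alpha_A-\frac{d+1}{2}}e^{-\mathrm{tr}(B\mathcal H)}$ with respect to Lebesgue measure on the entries on and above the diagonal, where $\alpha_A>\frac{d+1}2$, $B$ is positive definite and $\Gamma_d(\alpha)=\pi^{d(d-1)/4}\prod_{j=1}^d\Gamma(\alpha+\frac{1-j}2)$. - Model $D$: $\mathcal H=\mathrm{diag}(\eta_1,\dots,\eta_d)$ with $\eta_j>0$, with independent priors $\eta_j\sim\mathrm{Gamma}(\alpha_D,\beta_j)$ (shape, rate), where $\alpha_D>1$ and $\beta_j>0$. - Model $C$: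 $\mathcal H=\eta I_d$ with $\eta>0$, with prior $\eta\sim\mathrm{Gamma}(\alpha_C,\beta_C)$, where $\alpha_C>1$ and $\beta_C>0$. Let $E_A^{(n)},E_D^{(n)},E_C^{(n)}$ be the evidences, i.e. the integrals of $L_n$ times the prior density over the parameter space of the model, evaluated at the first $n$ of the observations $X_1,X_2,\dots$. In what follows $\overset{p}{\to}$ is convergence in probability as $n\to\infty$. 1. If the $X_i$ are i.i.d. zero-mean Gaussian with half-precision $\eta I_d$, $\eta>0$ ($C$ is true), then $$\frac{1}{\log n}\log\frac{E_A^{(n)}}{E_C^{(n)}}\overset{p}{\to}-\frac{\frac{d(d+1)}2-1}{2},\qquad \frac{1}{\log n}\log\frac{E_D^{(n)}}{E_C^{(n)}}\overset{p}{\to}-\frac{d-1}{2}.$$ 2. If the $X_i$ are i.i.d. zero-mean Gaussian with half-precision $\mathrm{diag}(\eta_1,\dots,\eta_d)$, all $\eta_j>0$ ($D$ is true), then $$\frac{1}{\log n}\log\frac{E_A^{(n)}}{E_D^{(n)}}\overset{p}{\to}-\frac{\frac{d(d+1)}2-d}{2};$$ moreover $\mathbb E[X_iX_i^\top]=\mathrm{diag}(v_1,\dots,v_d)$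 with $v_j=\frac1{2\eta_j}$, and $$\frac1n\log\frac{E_D^{(n)}}{E_C^{(n)}}\overset{p}{\to}\frac d2\log\frac{\frac1d\sum_{j}v_j}{(\prod_{j}v_j)^{1/d}},$$ where the limit is positive unless all the $\eta_j$ are equal. 3. If the $X_i$ are i.i.d. zero-mean Gaussian with positive definite half-precision $\mathcal H_0$ ($A$ is true), then $\mathcal V:=\mathbb E[X_iX_i^\top]=\frac12\mathcal H_0^{-1}$ and $$\frac1n\log\frac{E_A^{(n)}}{E_D^{(n)}}\overset{p}{\to}\frac12\log\frac{\prod_{j}\mathcal V_{jj}}{|\mathcal V|},\qquad \frac1n\log\frac{E_A^{(n)}}{E_C^{(n)}}\overset{p}{\to}\frac d2\log\frac{\mathrm{tr}(\mathcal V)/d}{|\mathcal V|^{1/d}};$$ the first limit is positive unless $\mathcal H_0$ is diagonal, the second unless $\mathcal H_0$ is a multiple of $I_d$. 4. The linear limit in 2 also holds if the $X_i$ are independent draws from the marginal law of one observation under model $D$ (the law with density $x\mapsto E_D^{(1)}(x)$), now with $\mathbb E[X_iX_i^\top]=\mathrm{diag}(v_1,\dots,v_d)$, $v_j=\frac{\beta_j}{2\alpha_D-2}$;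 it is positive unless all the $\beta_j$ are equal. Likewise both limits in 3 hold if the $X_i$ are independent draws from the marginal law of one observation under model $A$ (density $x\mapsto E_A^{(1)}(x)$), now with $\mathcal V=\mathbb E[X_iX_i^\top]=\frac{1}{2\alpha_A-(d+1)}B$; the first is positive unless $B$ is diagonal, the second unless $B$ is a multiple of $I_d$. -/

import Mathlib

open MeasureTheory ProbabilityTheory Filter
open scoped Matrix

noncomputable section

namespace CovSelection

/-- The scatter matrix `s_n = ∑_{i < n} x_i x_iᵀ` of the first `n` observations. -/
def scatter {d : ℕ} (n : ℕ) (x : ℕ → EuclideanSpace ℝ (Fin d)) : Matrix (Fin d) (Fin d) ℝ :=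
  Matrix.of fun j k => ∑ i ∈ Finset.range n, x i j * x i k

/-- The likelihood of the half-precision `H = (2Σ)⁻¹` given `n` observations from a zero-mean
Gaussian: `|H|^{n/2} π^{-nd/2} exp(-tr(H s_n))`. -/
def likelihood {d : ℕ} (H : Matrix (Fin d) (Fin d) ℝ) (n : ℕ)
    (x : ℕ → EuclideanSpace ℝ (Fin d)) : ℝ :=
  H.det ^ ((n : ℝ) / 2) / Real.pi ^ ((n : ℝ) * d / 2) *
    Real.exp (-(H * scatter n x).trace)

/-- The multivariate gamma function
`Γ_d(α) = π^{d(d-1)/4} ∏_{j=1}^d Γ(α + (1-j)/2)`; here `j` runs from `0` to `d-1`. -/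
def multivariateGamma (d : ℕ) (α : ℝ) : ℝ :=
  Real.pi ^ ((d : ℝ) * ((d : ℝ) - 1) / 4) * ∏ j : Fin d, Real.Gamma (α - (j : ℝ) / 2)

/-- The density at a positive definite `H` of the Wishart distribution with shape `α` and rate
matrix `B`, with respect to Lebesgue measure on the entries on and above the diagonal. -/
def wishartDensity {d : ℕ} (α : ℝ) (B H : Matrix (Fin d) (Fin d) ℝ) : ℝ :=
  B.det ^ α / multivariateGamma d α * H.det ^ (α - ((d : ℝ) + 1) / 2) *
    Real.exp (-(B * H).trace)

/-- The symmetric matrix with entries `θ s(i, j)`. The unordered pairs `s(i, j)` label the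
`d(d+1)/2` positions on and above the diagonal, so `θ ↦ symMatrix θ` is the identification of
`ℝ^{d(d+1)/2}` with the symmetric `d × d` matrices. -/
def symMatrix {d : ℕ} (θ : Sym2 (Fin d) → ℝ) : Matrix (Fin d) (Fin d) ℝ :=
  Matrix.of fun i j => θ s(i, j)

/-- Evidence of model `A` (arbitrary positive definite half-precision, Wishart prior). -/
def evidenceA {d : ℕ} (α : ℝ) (B : Matrix (Fin d) (Fin d) ℝ) (n : ℕ)
    (x : ℕ → EuclideanSpace ℝ (Fin d)) : ℝ :=
  ∫ θ in {θ : Sym2 (Fin d) → ℝ | (symMatrix θ).PosDef},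
    likelihood (symMatrix θ) n x * wishartDensity α B (symMatrix θ)

/-- Evidence of model `D` (diagonal half-precision, independent gamma priors with common shape
`α` and rates `β j`). -/
def evidenceD {d : ℕ} (α : ℝ) (β : Fin d → ℝ) (n : ℕ)
    (x : ℕ → EuclideanSpace ℝ (Fin d)) : ℝ :=
  ∫ η in {η : Fin d → ℝ | ∀ j, 0 < η j},
    likelihood (Matrix.diagonal η) n x * ∏ j, gammaPDFReal α (β j) (η j)

/-- Evidence of model `C` (half-precision a positive multiple of the identity, gamma prior with
shape `α` and rate `β`). -/
def evidenceC {d : ℕ} (α β : ℝ) (n : ℕ) (x : ℕ → EuclideanSpace ℝ (Fin d)) : ℝ :=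
  ∫ η in Set.Ioi (0 : ℝ),
    likelihood (η • (1 : Matrix (Fin d) (Fin d) ℝ)) n x * gammaPDFReal α β η

/-- The zero-mean Gaussian law with half-precision `H`, i.e. with covariance matrix `(2H)⁻¹`. -/
def gaussianLaw {d : ℕ} (H : Matrix (Fin d) (Fin d) ℝ) : Measure (EuclideanSpace ℝ (Fin d)) :=
  multivariateGaussian 0 ((2 : ℝ) • H)⁻¹

/-- The marginal law of one observation under model `A`: its density is the Gaussian density
integrated against the Wishart prior, i.e. the evidence of that one observation. -/
def marginalLawA {d : ℕ} (α : ℝ) (B : Matrix (Fin d) (Fin d) ℝ) :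
    Measure (EuclideanSpace ℝ (Fin d)) :=
  volume.withDensity fun x => ENNReal.ofReal (evidenceA α B 1 fun _ => x)

/-- The marginal law of one observation under model `D`. -/
def marginalLawD {d : ℕ} (α : ℝ) (β : Fin d → ℝ) : Measure (EuclideanSpace ℝ (Fin d)) :=
  volume.withDensity fun x => ENNReal.ofReal (evidenceD α β 1 fun _ => x)

/-- `X 0, X 1, …` are independent with common law `ν`. -/
structure IsIID {d : ℕ} {Ω : Type*} [MeasurableSpace Ω] (P : Measure Ω)
    (X : ℕ → Ω → EuclideanSpace ℝ (Fin d)) (ν : Measure (EuclideanSpace ℝ (Fin d))) : Prop where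
  indep : iIndepFun X P
  law : ∀ i, HasLaw (X i) ν P

/-- The random vector `Y` is square integrable and `V = E[Y Yᵀ]`. -/
def HasSecondMoment {d : ℕ} {Ω : Type*} [MeasurableSpace Ω] (P : Measure Ω)
    (Y : Ω → EuclideanSpace ℝ (Fin d)) (V : Matrix (Fin d) (Fin d) ℝ) : Prop :=
  MemLp Y 2 P ∧ ∀ j k, ∫ ω, Y ω j * Y ω k ∂P = V j k

/-- One half of the logarithm of the Hadamard ratio `∏ V_jj / |V|`. -/
def halfLogHadamard {d : ℕ} (V : Matrix (Fin d) (Fin d) ℝ) : ℝ :=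
  1 / 2 * Real.log ((∏ j, V j j) / V.det)

/-- `d/2` times the logarithm of `(tr V / d) / |V|^{1/d}`, the ratio of the arithmetic to the
geometric mean of the eigenvalues of `V`. -/
def logMeanRatio {d : ℕ} (V : Matrix (Fin d) (Fin d) ℝ) : ℝ :=
  (d : ℝ) / 2 * Real.log ((V.trace / d) / V.det ^ (1 / (d : ℝ)))

end CovSelection

end

/-! ### Symmetric matrices in coordinates. -/

namespace CovSelection

open Topology

/-! All three priors are conjugate, so each evidence has a closed form: a ratio of gamma functions
times a power of `det (B + s_n)`, of `∏ (β_j + (s_n)_jj)`, or of `β + tr s_n`. For model `A` this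
rests on the Wishart normalising constant (`lintegral_wishartKernel`), obtained by induction on the
dimension: split off the first row and column, integrate the diagonal entry as a gamma integral and
the rest of the row as a Gaussian integral, and recognise a Wishart integral one dimension lower.

Let `V_n` be the matrix of empirical second moments. Stirling's formula with bounded error turns the
closed forms into `log E_n = -c n - (p/2) log n - (n/2) L(V_n) + O(1)`, where `c` is common to the
models, `p` is the number of parameters and `L` is `log det V`, `∑ log V_jj` or `d log (tr V / d)`.
This is `HasLaplaceExpansion`; it is deterministic and holds for every sequence of observations
whose `V_n` converges to a positive definite limit. The prior replaces `V_n` by `V_n + b/n`, which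
costs only `O(1)`.

In an evidence ratio `c` cancels. By the law of large numbers the ratio has linear rate half the
difference of the two criteria at `V`. This difference is nonnegative by Hadamard's inequality or by
the inequality of arithmetic and geometric means, both of which come from `log det M ≤ tr M - d`;
their equality cases give the positivity statements.

If the smaller model is true, the two criteria agree at the limit. Their difference has a local
minimum there, so it is quadratically small in `V_n - V`. Since the fourth moments are finite, `n
‖V_n - V‖²` is bounded in mean, hence `o(log n)` in probability, and only the term in `log n`
survives, with coefficient minus half the difference of the parameter counts.

For observations from a marginal law, the linear rates need only second moments. These are found by
writing the law as a mixture of normal laws with independent coordinates, for model `A` after the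
linear change of variables `x = R y` with `B = R Rᵀ`. -/

theorem isHermitian_symMatrix {d : ℕ} (θ : Sym2 (Fin d) → ℝ) : (symMatrix θ).IsHermitian := by
  ext i j
  simp [symMatrix, Sym2.eq_swap]

theorem continuous_symMatrix {d : ℕ} :
    Continuous (symMatrix : (Sym2 (Fin d) → ℝ) → Matrix (Fin d) (Fin d) ℝ) := by
  unfold symMatrix
  exact continuous_matrix fun i j => continuous_apply _

/-- Positive definiteness is an open condition on the entries on and above the diagonal. -/
theorem isOpen_posDef_symMatrix {d : ℕ} :
    IsOpen {θ : Sym2 (Fin d) → ℝ | (symMatrix θ).PosDef} := by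
  have hcont : Continuous fun p : (Sym2 (Fin d) → ℝ) × (Fin d → ℝ) =>
      star p.2 ⬝ᵥ symMatrix p.1 *ᵥ p.2 := by
    have := continuous_symMatrix (d := d)
    exact Continuous.dotProduct (by fun_prop)
      ((this.comp continuous_fst).matrix_mulVec continuous_snd)
  rw [isOpen_iff_eventually]
  intro θ hθ
  -- Compactness of the unit sphere makes one neighbourhood of `θ` work for all unit vectors;
  -- homogeneity then reaches all nonzero vectors.
  have key := (isCompact_sphere (0 : Fin d → ℝ) 1).eventually_forall_of_forall_eventually
    (x₀ := θ) (P := fun θ x => 0 < star x ⬝ᵥ symMatrix θ *ᵥ x) (by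
      intro x hx
      have hx0 : x ≠ 0 := by
        rintro rfl
        simp at hx
      exact hcont.continuousAt.eventually_const_lt
        (Matrix.PosDef.dotProduct_mulVec_pos hθ hx0))
  filter_upwards [key] with η hη
  refine Matrix.PosDef.of_dotProduct_mulVec_pos (isHermitian_symMatrix η) fun x hx => ?_
  have hn : 0 < ‖x‖ := norm_pos_iff.2 hx
  have h := hη (‖x‖⁻¹ • x) (by simp [norm_smul, hn.ne'])
  rw [star_smul, Matrix.mulVec_smul, smul_dotProduct, dotProduct_smul] at h
  simp only [smul_eq_mul, star_trivial] at h
  have h2 : 0 < ‖x‖⁻¹ := by positivity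
  simpa using pos_of_mul_pos_right (pos_of_mul_pos_right h h2.le) h2.le

theorem symMatrix_of_isHermitian {d : ℕ} {V : Matrix (Fin d) (Fin d) ℝ} (hV : V.IsHermitian) :
    ∃ θ : Sym2 (Fin d) → ℝ, symMatrix θ = V := by
  refine ⟨Sym2.lift ⟨fun i j => V i j, fun i j => ?_⟩, ?_⟩
  · simpa using (hV.apply i j).symm
  · ext i j
    simp [symMatrix]

/-! ### Determinant inequalities: `log det M ≤ tr M - d`, Hadamard, arithmetic and geometric mean.
-/

section LogDet

variable {ι : Type*} [Fintype ι] [DecidableEq ι]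

theorem log_det_eq_sum_log_eigenvalues {M : Matrix ι ι ℝ} (hM : M.PosDef) :
    Real.log M.det = ∑ i, Real.log (hM.isHermitian.eigenvalues i) := by
  rw [hM.isHermitian.det_eq_prod_eigenvalues]
  simp only [RCLike.ofReal_real_eq_id, id]
  exact Real.log_prod fun i _ => (hM.eigenvalues_pos i).ne'

/-- Sum `log x ≤ x - 1` over the eigenvalues. Normalising `M` to have trace `d` makes the right side
vanish: scaling to unit diagonal gives Hadamard's inequality, scaling by the mean eigenvalue gives
the inequality of arithmetic and geometric means. -/
theorem log_det_le_trace_sub_card {M : Matrix ι ι ℝ} (hM : M.PosDef) :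
    Real.log M.det ≤ M.trace - Fintype.card ι := by
  rw [log_det_eq_sum_log_eigenvalues hM, hM.isHermitian.trace_eq_sum_eigenvalues]
  have h : ∑ i, Real.log (hM.isHermitian.eigenvalues i) ≤
      ∑ i, (hM.isHermitian.eigenvalues i - 1) :=
    Finset.sum_le_sum fun i _ => Real.log_le_sub_one_of_pos (hM.eigenvalues_pos i)
  simpa using h

/-- Equality in `log x ≤ x - 1` forces `x = 1`, and a symmetric matrix with all eigenvalues `1` is
the identity by the spectral theorem. -/
theorem log_det_lt_trace_sub_card {M : Matrix ι ι ℝ} (hM : M.PosDef) (h1 : M ≠ 1) :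
    Real.log M.det < M.trace - Fintype.card ι := by
  have hne : ∃ i, hM.isHermitian.eigenvalues i ≠ 1 := by
    by_contra! hall
    apply h1
    rw [hM.isHermitian.spectral_theorem]
    have : (RCLike.ofReal ∘ hM.isHermitian.eigenvalues : ι → ℝ) = 1 := by
      ext i
      simp [hall i]
    rw [this]
    simp
  obtain ⟨i, hi⟩ := hne
  rw [log_det_eq_sum_log_eigenvalues hM, hM.isHermitian.trace_eq_sum_eigenvalues]
  have h : ∑ i, Real.log (hM.isHermitian.eigenvalues i) <
      ∑ i, (hM.isHermitian.eigenvalues i - 1) :=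
    Finset.sum_lt_sum (fun i _ => Real.log_le_sub_one_of_pos (hM.eigenvalues_pos i))
      ⟨i, Finset.mem_univ i, Real.log_lt_sub_one_of_pos (hM.eigenvalues_pos i) hi⟩
  simpa using h

end LogDet

/-- The correlation matrix of `V`. -/
noncomputable def correlation {d : ℕ} (V : Matrix (Fin d) (Fin d) ℝ) : Matrix (Fin d) (Fin d) ℝ :=
  Matrix.diagonal (fun j => (√(V j j))⁻¹) * V * Matrix.diagonal (fun j => (√(V j j))⁻¹)

theorem correlation_apply {d : ℕ} (V : Matrix (Fin d) (Fin d) ℝ) (i j : Fin d) :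
    correlation V i j = (√(V i i))⁻¹ * V i j * (√(V j j))⁻¹ := by
  simp [correlation]

theorem posDef_correlation {d : ℕ} {V : Matrix (Fin d) (Fin d) ℝ} (hV : V.PosDef) :
    (correlation V).PosDef := by
  have hU : IsUnit (Matrix.diagonal (fun j => (√(V j j))⁻¹)) := by
    rw [Matrix.isUnit_diagonal, Pi.isUnit_iff]
    intro j
    have : 0 < √(V j j) := Real.sqrt_pos.2 hV.diag_pos
    exact (inv_ne_zero this.ne').isUnit
  have h := (Matrix.IsUnit.posDef_star_left_conjugate_iff (x := V) hU).2 hV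
  simpa [correlation, Matrix.star_eq_conjTranspose, Matrix.diagonal_conjTranspose] using h

theorem trace_correlation {d : ℕ} {V : Matrix (Fin d) (Fin d) ℝ} (hV : V.PosDef) :
    (correlation V).trace = d := by
  have h (j : Fin d) : correlation V j j = 1 := by
    have h0 : 0 < V j j := hV.diag_pos
    have : 0 < √(V j j) := Real.sqrt_pos.2 h0
    rw [correlation_apply]
    field_simp
    rw [Real.sq_sqrt h0.le]
  simp [Matrix.trace, h]

theorem log_det_correlation {d : ℕ} {V : Matrix (Fin d) (Fin d) ℝ} (hV : V.PosDef) :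
    Real.log (correlation V).det = Real.log V.det - ∑ j, Real.log (V j j) := by
  have h0 (j : Fin d) : 0 < V j j := hV.diag_pos
  have h1 (j : Fin d) : (√(V j j))⁻¹ ≠ 0 := (inv_pos.2 (Real.sqrt_pos.2 (h0 j))).ne'
  have h2 : ∏ j, (√(V j j))⁻¹ ≠ 0 := Finset.prod_ne_zero_iff.2 fun j _ => h1 j
  rw [correlation, Matrix.det_mul, Matrix.det_mul, Matrix.det_diagonal,
    Real.log_mul (mul_ne_zero h2 hV.det_pos.ne') h2, Real.log_mul h2 hV.det_pos.ne',
    Real.log_prod fun j _ => h1 j]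
  simp only [Real.log_inv, Real.log_sqrt (h0 _).le, Finset.sum_neg_distrib, ← Finset.sum_div]
  ring

theorem log_hadamard_eq {d : ℕ} {V : Matrix (Fin d) (Fin d) ℝ} (hV : V.PosDef) :
    Real.log ((∏ j, V j j) / V.det) = ∑ j, Real.log (V j j) - Real.log V.det := by
  have h0 (j : Fin d) : V j j ≠ 0 := hV.diag_pos.ne'
  rw [Real.log_div (Finset.prod_ne_zero_iff.2 fun j _ => h0 j) hV.det_pos.ne',
    Real.log_prod fun j _ => h0 j]

/-- **Hadamard's inequality**, in logarithmic form. -/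
theorem log_det_le_sum_log_diag {d : ℕ} {V : Matrix (Fin d) (Fin d) ℝ} (hV : V.PosDef) :
    Real.log V.det ≤ ∑ j, Real.log (V j j) := by
  have h := log_det_le_trace_sub_card (posDef_correlation hV)
  rw [trace_correlation hV, log_det_correlation hV, Fintype.card_fin] at h
  linarith

/-- The correlation matrix is the identity only if every off-diagonal entry of `V` vanishes. -/
theorem log_det_lt_sum_log_diag {d : ℕ} {V : Matrix (Fin d) (Fin d) ℝ} (hV : V.PosDef)
    (hd : ¬ V.IsDiag) : Real.log V.det < ∑ j, Real.log (V j j) := by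
  have hne : correlation V ≠ 1 := by
    intro h
    apply hd
    intro i j hij
    have h1 := congrFun (congrFun h i) j
    rw [correlation_apply, Matrix.one_apply_ne hij] at h1
    have hi : √(V i i) ≠ 0 := (Real.sqrt_pos.2 hV.diag_pos).ne'
    have hj : √(V j j) ≠ 0 := (Real.sqrt_pos.2 hV.diag_pos).ne'
    simpa [hi, hj] using h1
  have h := log_det_lt_trace_sub_card (posDef_correlation hV) hne
  rw [trace_correlation hV, log_det_correlation hV, Fintype.card_fin] at h
  linarith

theorem log_det_smul {d : ℕ} {V : Matrix (Fin d) (Fin d) ℝ} (hV : V.PosDef) {c : ℝ}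
    (hc : 0 < c) : Real.log (c • V).det = d * Real.log c + Real.log V.det := by
  rw [Matrix.det_smul, Real.log_mul (by positivity) hV.det_pos.ne', Real.log_pow,
    Fintype.card_fin]

/-- Apply the trace bound to `V` divided by its mean eigenvalue `tr V / d`, which has trace `d`. -/
theorem log_det_le_mul_log_mean {d : ℕ} (hd : 1 ≤ d) {V : Matrix (Fin d) (Fin d) ℝ}
    (hV : V.PosDef) : Real.log V.det ≤ d * Real.log (V.trace / d) := by
  have : Nonempty (Fin d) := ⟨⟨0, hd⟩⟩
  have ht : 0 < V.trace := hV.trace_pos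
  have hd0 : (0 : ℝ) < d := by exact_mod_cast hd
  have h := log_det_le_trace_sub_card (hV.smul (inv_pos.2 (div_pos ht hd0)))
  rw [log_det_smul hV (by positivity), Matrix.trace_smul, Real.log_inv, Fintype.card_fin,
    smul_eq_mul] at h
  field_simp at h
  rw [sub_self] at h
  linarith

theorem log_det_lt_mul_log_mean {d : ℕ} (hd : 1 ≤ d) {V : Matrix (Fin d) (Fin d) ℝ}
    (hV : V.PosDef) (h1 : ¬ ∃ c : ℝ, V = c • (1 : Matrix (Fin d) (Fin d) ℝ)) :
    Real.log V.det < d * Real.log (V.trace / d) := by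
  have : Nonempty (Fin d) := ⟨⟨0, hd⟩⟩
  have ht : 0 < V.trace := hV.trace_pos
  have hd0 : (0 : ℝ) < d := by exact_mod_cast hd
  have h := log_det_lt_trace_sub_card (hV.smul (inv_pos.2 (div_pos ht hd0))) (by
    intro h
    exact h1 ⟨V.trace / d, by
      rw [← h, smul_smul, mul_inv_cancel₀ (div_pos ht hd0).ne', one_smul]⟩)
  rw [log_det_smul hV (by positivity), Matrix.trace_smul, Real.log_inv, Fintype.card_fin,
    smul_eq_mul] at h
  field_simp at h
  rw [sub_self] at h
  linarith

theorem halfLogHadamard_eq {d : ℕ} {V : Matrix (Fin d) (Fin d) ℝ} (hV : V.PosDef) :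
    halfLogHadamard V = 1 / 2 * (∑ j, Real.log (V j j) - Real.log V.det) := by
  rw [halfLogHadamard, log_hadamard_eq hV]

theorem halfLogHadamard_pos {d : ℕ} {V : Matrix (Fin d) (Fin d) ℝ} (hV : V.PosDef)
    (hd : ¬ V.IsDiag) : 0 < halfLogHadamard V := by
  have := log_det_lt_sum_log_diag hV hd
  rw [halfLogHadamard_eq hV]
  linarith

theorem logMeanRatio_eq {d : ℕ} (hd : 1 ≤ d) {V : Matrix (Fin d) (Fin d) ℝ} (hV : V.PosDef) :
    logMeanRatio V = 1 / 2 * (d * Real.log (V.trace / d) - Real.log V.det) := by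
  have : Nonempty (Fin d) := ⟨⟨0, hd⟩⟩
  have ht : 0 < V.trace := hV.trace_pos
  have hd0 : (0 : ℝ) < d := by exact_mod_cast hd
  have hdet := hV.det_pos
  rw [logMeanRatio, Real.log_div (by positivity) (by positivity), Real.log_rpow hdet]
  field_simp

theorem logMeanRatio_pos {d : ℕ} (hd : 1 ≤ d) {V : Matrix (Fin d) (Fin d) ℝ} (hV : V.PosDef)
    (h1 : ¬ ∃ c : ℝ, V = c • (1 : Matrix (Fin d) (Fin d) ℝ)) : 0 < logMeanRatio V := by
  have := log_det_lt_mul_log_mean hd hV h1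
  rw [logMeanRatio_eq hd hV]
  linarith

end CovSelection

namespace CovSelection

/-! ### Gamma and Gaussian integrals. -/

section GammaGaussian

theorem integral_Ioi_rpow_mul_exp_neg {a b : ℝ} (ha : 0 < a) (hb : 0 < b) :
    ∫ s in Set.Ioi (0 : ℝ), s ^ (a - 1) * Real.exp (-(b * s)) = Real.Gamma a * b ^ (-a) := by
  rw [Real.integral_rpow_mul_exp_neg_mul_Ioi ha hb, one_div, Real.inv_rpow hb.le,
    Real.rpow_neg hb.le, mul_comm]

theorem integrableOn_Ioi_rpow_mul_exp_neg {a b : ℝ} (ha : 0 < a) (hb : 0 < b) :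
    IntegrableOn (fun s : ℝ => s ^ (a - 1) * Real.exp (-(b * s))) (Set.Ioi 0) := by
  -- A non-integrable function has Bochner integral `0` by convention, so a nonzero value of the
  -- integral already proves integrability.
  refine Integrable.of_integral_ne_zero ?_
  rw [integral_Ioi_rpow_mul_exp_neg ha hb]
  have := Real.Gamma_pos_of_pos ha
  positivity

theorem lintegral_Ioi_rpow_mul_exp_neg {a b : ℝ} (ha : 0 < a) (hb : 0 < b) :
    ∫⁻ s in Set.Ioi (0 : ℝ), ENNReal.ofReal (s ^ (a - 1) * Real.exp (-(b * s))) =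
      ENNReal.ofReal (Real.Gamma a * b ^ (-a)) := by
  rw [← integral_Ioi_rpow_mul_exp_neg ha hb,
    ofReal_integral_eq_lintegral_ofReal (integrableOn_Ioi_rpow_mul_exp_neg ha hb)]
  refine ae_restrict_of_forall_mem measurableSet_Ioi fun s hs => ?_
  have : (0 : ℝ) < s := hs
  simp only [Pi.zero_apply]
  positivity

theorem integral_exp_neg_sq_sub_linear {b : ℝ} (hb : 0 < b) (c : ℝ) :
    ∫ w : ℝ, Real.exp (-(b * w ^ 2) - 2 * (c * w)) =
      √(Real.pi / b) * Real.exp (c ^ 2 / b) := by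
  have h (w : ℝ) : Real.exp (-(b * w ^ 2) - 2 * (c * w)) =
      Real.exp (c ^ 2 / b) * Real.exp (-b * (w + c / b) ^ 2) := by
    rw [← Real.exp_add]
    congr 1
    field_simp
    ring
  simp_rw [h]
  rw [integral_const_mul, integral_add_right_eq_self (fun w => Real.exp (-b * w ^ 2)),
    integral_gaussian, mul_comm]

theorem integral_pi_exp_neg_sq_sub_linear {d : ℕ} {b : ℝ} (hb : 0 < b) (c : Fin d → ℝ) :
    ∫ w : Fin d → ℝ, Real.exp (-(b * (w ⬝ᵥ w)) - 2 * (c ⬝ᵥ w)) =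
      (Real.pi / b) ^ ((d : ℝ) / 2) * Real.exp ((c ⬝ᵥ c) / b) := by
  have h (w : Fin d → ℝ) : Real.exp (-(b * (w ⬝ᵥ w)) - 2 * (c ⬝ᵥ w)) =
      ∏ j, Real.exp (-(b * w j ^ 2) - 2 * (c j * w j)) := by
    rw [← Real.exp_sum]
    simp only [dotProduct, Finset.mul_sum, Finset.sum_sub_distrib, Finset.sum_neg_distrib, sq]
  simp_rw [h]
  rw [integral_fintype_prod_volume_eq_prod
    (f := fun j w => Real.exp (-(b * w ^ 2) - 2 * (c j * w)))]
  simp_rw [integral_exp_neg_sq_sub_linear hb]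
  rw [Finset.prod_mul_distrib, ← Real.exp_sum, Finset.prod_const, Finset.card_univ,
    Fintype.card_fin, Real.sqrt_eq_rpow, ← Real.rpow_natCast, ← Real.rpow_mul (by positivity)]
  congr 2
  · ring
  · simp [dotProduct, Finset.sum_div, sq]

theorem exists_eq_mul_transpose {d : ℕ} {K : Matrix (Fin d) (Fin d) ℝ} (hK : K.PosDef) :
    ∃ R : Matrix (Fin d) (Fin d) ℝ, K = R * Rᵀ := by
  open scoped MatrixOrder in
  obtain ⟨R, hR⟩ := CStarAlgebra.nonneg_iff_eq_star_mul_self.1 hK.posSemidef.nonneg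
  exact ⟨Rᵀ, by simpa [Matrix.star_eq_conjTranspose] using hR⟩

/-- A multivariate Gaussian integral with a linear term. -/
theorem integral_exp_neg_quadratic_sub_linear {d : ℕ} {K : Matrix (Fin d) (Fin d) ℝ}
    (hK : K.PosDef) {b : ℝ} (hb : 0 < b) (c : Fin d → ℝ) :
    ∫ u : Fin d → ℝ, Real.exp (-(b * (u ⬝ᵥ K⁻¹ *ᵥ u)) - 2 * (c ⬝ᵥ u)) =
      (Real.pi / b) ^ ((d : ℝ) / 2) * K.det ^ (1 / 2 : ℝ) *
        Real.exp ((c ⬝ᵥ K *ᵥ c) / b) := by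
  -- The substitution `u = R w` turns `uᵀ K⁻¹ u` into `wᵀ w` and `c` into `Rᵀ c`; its Jacobian `|det
  -- R|` is the factor `(det K)^{1/2}`.
  obtain ⟨R, hR⟩ := exists_eq_mul_transpose hK
  have hdet : K.det = R.det ^ 2 := by rw [hR, Matrix.det_mul, Matrix.det_transpose, sq]
  have hR0 : R.det ≠ 0 := by
    intro h
    have := hK.det_pos
    simp [hdet, h] at this
  have hRu : IsUnit R.det := hR0.isUnit
  have hmap := Real.map_matrix_volume_pi_eq_smul_volume_pi hR0
  have hmeas : Measurable (Matrix.toLin' R) :=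
    (LinearMap.continuous_of_finiteDimensional _).measurable
  have hcont : Continuous fun u : Fin d → ℝ =>
      Real.exp (-(b * (u ⬝ᵥ K⁻¹ *ᵥ u)) - 2 * (c ⬝ᵥ u)) := by
    have : Continuous fun u : Fin d → ℝ => u ⬝ᵥ K⁻¹ *ᵥ u :=
      Continuous.dotProduct continuous_id (continuous_const.matrix_mulVec continuous_id)
    have : Continuous fun u : Fin d → ℝ => c ⬝ᵥ u :=
      Continuous.dotProduct continuous_const continuous_id
    fun_prop
  have h1 := integral_map (μ := volume) hmeas.aemeasurable
    (f := fun u : Fin d → ℝ => Real.exp (-(b * (u ⬝ᵥ K⁻¹ *ᵥ u)) - 2 * (c ⬝ᵥ u)))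
    hcont.aestronglyMeasurable
  rw [hmap, integral_smul_measure] at h1
  have h2 (w : Fin d → ℝ) : Real.exp (-(b * (Matrix.toLin' R w ⬝ᵥ K⁻¹ *ᵥ Matrix.toLin' R w)) -
      2 * (c ⬝ᵥ Matrix.toLin' R w)) =
      Real.exp (-(b * (w ⬝ᵥ w)) - 2 * ((Rᵀ *ᵥ c) ⬝ᵥ w)) := by
    have e1 : R *ᵥ w ⬝ᵥ K⁻¹ *ᵥ (R *ᵥ w) = w ⬝ᵥ w := by
      have : Rᵀ * (K⁻¹ * R) = 1 := by
        rw [hR, Matrix.mul_inv_rev, Matrix.mul_assoc, Matrix.nonsing_inv_mul _ hRu,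
          Matrix.mul_one, Matrix.mul_nonsing_inv _ (by rwa [Matrix.det_transpose])]
      rw [← Matrix.vecMul_transpose R w, ← Matrix.dotProduct_mulVec, Matrix.vecMul_transpose,
        Matrix.mulVec_mulVec, Matrix.mulVec_mulVec, Matrix.mul_assoc, this, Matrix.one_mulVec]
    have e2 : c ⬝ᵥ R *ᵥ w = (Rᵀ *ᵥ c) ⬝ᵥ w := by
      rw [Matrix.dotProduct_mulVec, Matrix.mulVec_transpose]
    rw [Matrix.toLin'_apply, e1, e2]
  simp_rw [h2] at h1
  rw [integral_pi_exp_neg_sq_sub_linear hb] at h1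
  have e3 : (Rᵀ *ᵥ c) ⬝ᵥ (Rᵀ *ᵥ c) = c ⬝ᵥ K *ᵥ c := by
    rw [hR, ← Matrix.mulVec_mulVec, Matrix.dotProduct_mulVec c, Matrix.mulVec_transpose]
  have e4 : K.det ^ (1 / 2 : ℝ) = |R.det| := by
    rw [hdet, ← Real.sqrt_eq_rpow, Real.sqrt_sq_eq_abs]
  rw [e3, abs_inv, ENNReal.toReal_ofReal (by positivity), smul_eq_mul,
    inv_mul_eq_iff_eq_mul₀ (abs_ne_zero.2 hR0)] at h1
  rw [h1, e4]
  ring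

theorem lintegral_exp_neg_quadratic_sub_linear {d : ℕ} {K : Matrix (Fin d) (Fin d) ℝ}
    (hK : K.PosDef) {b : ℝ} (hb : 0 < b) (c : Fin d → ℝ) :
    ∫⁻ u : Fin d → ℝ, ENNReal.ofReal (Real.exp (-(b * (u ⬝ᵥ K⁻¹ *ᵥ u)) - 2 * (c ⬝ᵥ u))) =
      ENNReal.ofReal ((Real.pi / b) ^ ((d : ℝ) / 2) * K.det ^ (1 / 2 : ℝ) *
        Real.exp ((c ⬝ᵥ K *ᵥ c) / b)) := by
  have h := integral_exp_neg_quadratic_sub_linear hK hb c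
  rw [← h, ofReal_integral_eq_lintegral_ofReal]
  · refine Integrable.of_integral_ne_zero ?_
    rw [h]
    have := hK.det_pos
    positivity
  · exact Filter.Eventually.of_forall fun u => (Real.exp_pos _).le

end GammaGaussian

/-! ### Splitting a symmetric matrix into its first row and a smaller block; Schur complements. -/

section Coordinates

variable {d : ℕ}

/-- The unordered pairs from `{0, …, d}`: those avoiding `0`, then `{0, j + 1}`, then `{0, 0}`. -/
def sym2Block (d : ℕ) : Sym2 (Fin d) ⊕ (Fin d ⊕ Unit) → Sym2 (Fin (d + 1)) :=
  Sum.elim (Sym2.map Fin.succ) (Sum.elim (fun j => s(0, j.succ)) fun _ => s(0, 0))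

theorem sym2Block_bijective : Function.Bijective (sym2Block d) := by
  constructor
  · have hinj : Function.Injective (Sym2.map (Fin.succ (n := d))) :=
      Sym2.map.injective (Fin.succ_injective d)
    have hne (z : Sym2 (Fin d)) (k : Fin (d + 1)) : Sym2.map Fin.succ z ≠ s(0, k) := by
      induction z with
      | h i j => simp [Sym2.map_mk, Fin.succ_ne_zero]
    rintro (z | j | _) (z' | j' | _) h
    · exact congrArg _ (hinj h)
    · exact absurd h (hne _ _)
    · exact absurd h (hne _ _)
    · exact absurd h.symm (hne _ _)
    · simpa [sym2Block, Fin.succ_ne_zero] using h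
    · simp [sym2Block, Fin.succ_ne_zero] at h
    · exact absurd h.symm (hne _ _)
    · simp [sym2Block, (Fin.succ_ne_zero _).symm] at h
    · rfl
  · intro z
    induction z with
    | h i j =>
      induction i using Fin.cases with
      | zero =>
        induction j using Fin.cases with
        | zero => exact ⟨.inr (.inr ()), rfl⟩
        | succ j => exact ⟨.inr (.inl j), rfl⟩
      | succ i =>
        induction j using Fin.cases with
        | zero => exact ⟨.inr (.inl i), Sym2.eq_swap⟩
        | succ j => exact ⟨.inl s(i, j), rfl⟩

noncomputable def sym2BlockEquiv (d : ℕ) : Sym2 (Fin d) ⊕ (Fin d ⊕ Unit) ≃ Sym2 (Fin (d + 1)) :=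
  Equiv.ofBijective _ sym2Block_bijective

/-- Assemble a symmetric matrix of size `d + 1` from its lower right block, the rest of its first
row, and its first diagonal entry. -/
noncomputable def assemble (d : ℕ) (p : (Sym2 (Fin d) → ℝ) × (Fin d → ℝ) × ℝ) :
    Sym2 (Fin (d + 1)) → ℝ :=
  MeasurableEquiv.piCongrLeft (fun _ => ℝ) (sym2BlockEquiv d)
    ((MeasurableEquiv.sumPiEquivProdPi fun _ => ℝ).symm
      (p.1, (MeasurableEquiv.sumPiEquivProdPi fun _ => ℝ).symm (p.2.1,
        (MeasurableEquiv.funUnique Unit ℝ).symm p.2.2)))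

/-- Only coordinates are relabelled and regrouped, so Lebesgue measure is preserved. This is what
allows the Wishart integral to be iterated over the blocks. -/
theorem measurePreserving_assemble : MeasurePreserving (assemble d) volume volume := by
  have h1 : MeasurePreserving (fun p : (Fin d → ℝ) × ℝ =>
      (MeasurableEquiv.sumPiEquivProdPi fun _ => ℝ).symm (p.1,
        (MeasurableEquiv.funUnique Unit ℝ).symm p.2)) volume volume :=
    (volume_measurePreserving_sumPiEquivProdPi_symm fun _ : Fin d ⊕ Unit => ℝ).comp
      ((MeasurePreserving.id volume).prod (volume_preserving_funUnique Unit ℝ).symm)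
  exact (volume_measurePreserving_piCongrLeft (fun _ => ℝ) (sym2BlockEquiv d)).comp
    ((volume_measurePreserving_sumPiEquivProdPi_symm
      fun _ : Sym2 (Fin d) ⊕ (Fin d ⊕ Unit) => ℝ).comp ((MeasurePreserving.id volume).prod h1))

theorem assemble_sym2Block (p : (Sym2 (Fin d) → ℝ) × (Fin d → ℝ) × ℝ)
    (a : Sym2 (Fin d) ⊕ (Fin d ⊕ Unit)) :
    assemble d p (sym2Block d a) = Sum.elim p.1 (Sum.elim p.2.1 fun _ => p.2.2) a := by
  have h := Equiv.piCongrLeft_apply_apply (fun _ => ℝ) (sym2BlockEquiv d)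
    ((MeasurableEquiv.sumPiEquivProdPi fun _ => ℝ).symm
      (p.1, (MeasurableEquiv.sumPiEquivProdPi fun _ => ℝ).symm (p.2.1,
        (MeasurableEquiv.funUnique Unit ℝ).symm p.2.2))) a
  refine Eq.trans h ?_
  rcases a with z | j | u <;> rfl

/-- The first index becomes a `Unit` summand, so that the block-matrix lemmas apply. -/
def blockIndex (d : ℕ) : Unit ⊕ Fin d ≃ Fin (d + 1) where
  toFun := Sum.elim (fun _ => 0) Fin.succ
  invFun := Fin.cases (.inl ()) .inr
  left_inv := by rintro (_ | j) <;> rfl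
  right_inv := by
    intro i
    induction i using Fin.cases <;> rfl

/-- A square matrix with first diagonal entry `h`, first row and column `u`, and lower right
block `K`. -/
def bordered (h : ℝ) (u : Fin d → ℝ) (K : Matrix (Fin d) (Fin d) ℝ) :
    Matrix (Unit ⊕ Fin d) (Unit ⊕ Fin d) ℝ :=
  Matrix.fromBlocks (Matrix.of fun _ _ => h) (Matrix.replicateRow Unit u)
    (Matrix.replicateCol Unit u) K

theorem symMatrix_assemble (p : (Sym2 (Fin d) → ℝ) × (Fin d → ℝ) × ℝ) :
    (symMatrix (assemble d p)).submatrix (blockIndex d) (blockIndex d) =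
      bordered p.2.2 p.2.1 (symMatrix p.1) := by
  ext (_ | i) (_ | j)
  · exact assemble_sym2Block p (.inr (.inr ()))
  · exact assemble_sym2Block p (.inr (.inl j))
  · refine Eq.trans ?_ (assemble_sym2Block p (.inr (.inl i)))
    exact congrArg (assemble d p) (Sym2.eq_swap (a := i.succ) (b := 0))
  · exact assemble_sym2Block p (.inl s(i, j))

theorem exists_bordered {B : Matrix (Fin (d + 1)) (Fin (d + 1)) ℝ} (hB : B.IsHermitian) :
    ∃ (b : ℝ) (c : Fin d → ℝ) (B' : Matrix (Fin d) (Fin d) ℝ), B'.IsHermitian ∧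
      B.submatrix (blockIndex d) (blockIndex d) = bordered b c B' := by
  refine ⟨B 0 0, fun j => B 0 j.succ, B.submatrix Fin.succ Fin.succ, hB.submatrix _, ?_⟩
  ext (_ | i) (_ | j)
  · rfl
  · rfl
  · exact hB.apply (0 : Fin (d + 1)) i.succ
  · rfl

theorem det_bordered_of_posDef {K : Matrix (Fin d) (Fin d) ℝ} (hK : K.PosDef) (h : ℝ)
    (u : Fin d → ℝ) : (bordered h u K).det = K.det * (h - u ⬝ᵥ K⁻¹ *ᵥ u) := by
  let := hK.isUnit.invertible
  rw [bordered, Matrix.det_fromBlocks₂₂, Matrix.invOf_eq_nonsing_inv, Matrix.det_unique (n := Unit)]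
  congr 1
  simp [Matrix.mul_apply, dotProduct, Matrix.mulVec, Finset.sum_mul, Finset.mul_sum]
  rw [Finset.sum_comm]
  simp [mul_assoc]

/-- For fixed `K` and `u` the domain of the first diagonal entry is thus the half-line above `uᵀ K⁻¹
u`. -/
theorem posDef_bordered_iff {K : Matrix (Fin d) (Fin d) ℝ} (h : ℝ) (u : Fin d → ℝ) :
    (bordered h u K).PosDef ↔ K.PosDef ∧ 0 < h - u ⬝ᵥ K⁻¹ *ᵥ u := by
  constructor
  · intro hM
    have hK : K.PosDef := by
      have := hM.submatrix (e := Sum.inr) Sum.inr_injective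
      exact this
    refine ⟨hK, ?_⟩
    have := hM.det_pos
    rw [det_bordered_of_posDef hK] at this
    exact pos_of_mul_pos_right this hK.det_pos.le
  · rintro ⟨hK, hpos⟩
    let := hK.isUnit.invertible
    have hpsd : (bordered h u K).PosSemidef := by
      have hiff := Matrix.PosDef.fromBlocks₂₂ (Matrix.of fun _ _ : Unit => h)
        (Matrix.replicateRow Unit u) hK
      have ht : (Matrix.replicateRow Unit u)ᴴ = Matrix.replicateCol Unit u := by
        ext; simp
      rw [ht] at hiff
      refine hiff.2 ?_
      have : Matrix.of (fun _ _ : Unit => h) -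
          Matrix.replicateRow Unit u * K⁻¹ * Matrix.replicateCol Unit u =
          Matrix.diagonal fun _ => h - u ⬝ᵥ K⁻¹ *ᵥ u := by
        ext
        simp [Matrix.mul_apply, dotProduct, Matrix.mulVec, Finset.sum_mul, Finset.mul_sum]
        rw [Finset.sum_comm]
        simp [mul_assoc]
      rw [this]
      exact Matrix.PosSemidef.diagonal fun _ => hpos.le
    -- The Schur complement criterion gives semidefiniteness only; the nonzero determinant upgrades
    -- it.
    refine hpsd.posDef_iff_det_ne_zero.2 ?_
    rw [det_bordered_of_posDef hK]
    exact (mul_pos hK.det_pos hpos).ne'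

/-- The Schur complement of the first diagonal entry. -/
theorem posDef_schur_of_bordered {b : ℝ} {c : Fin d → ℝ} {B : Matrix (Fin d) (Fin d) ℝ}
    (hM : (bordered b c B).PosDef) :
    0 < b ∧ (B - b⁻¹ • Matrix.vecMulVec c c).PosDef ∧
      (bordered b c B).det = b * (B - b⁻¹ • Matrix.vecMulVec c c).det := by
  have hb : 0 < b := by simpa [bordered] using hM.diag_pos (i := Sum.inl ())
  have hbm : (Matrix.of fun _ _ : Unit => b) = Matrix.diagonal fun _ => b := by ext; simp
  have hA : (Matrix.of fun _ _ : Unit => b).PosDef := by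
    rw [hbm]
    exact Matrix.PosDef.diagonal fun _ => hb
  let := hA.isUnit.invertible
  have hinv : (Matrix.of fun _ _ : Unit => b)⁻¹ = Matrix.diagonal fun _ => b⁻¹ := by
    rw [hbm]
    refine Matrix.inv_eq_right_inv ?_
    rw [Matrix.diagonal_mul_diagonal]
    ext
    simp [hb.ne']
  have hS : Matrix.replicateCol Unit c * (Matrix.diagonal fun _ => b⁻¹ : Matrix Unit Unit ℝ) *
      Matrix.replicateRow Unit c = b⁻¹ • Matrix.vecMulVec c c := by
    ext i j
    simp [Matrix.mul_apply, Matrix.vecMulVec_apply]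
    ring
  have hdet : (bordered b c B).det = b * (B - b⁻¹ • Matrix.vecMulVec c c).det := by
    rw [bordered, Matrix.det_fromBlocks₁₁, Matrix.invOf_eq_nonsing_inv, hinv, hS,
      Matrix.det_unique (n := Unit)]
    rfl
  have ht : (Matrix.replicateRow Unit c)ᴴ = Matrix.replicateCol Unit c := by
    ext; simp
  have hiff := Matrix.PosDef.fromBlocks₁₁ (Matrix.replicateRow Unit c) B hA
  rw [ht, hinv, hS] at hiff
  have hpsd := hiff.1 hM.posSemidef
  refine ⟨hb, hpsd.posDef_iff_det_ne_zero.2 ?_, hdet⟩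
  intro h0
  have := hM.det_pos
  simp [hdet, h0] at this

theorem trace_bordered_mul (b h : ℝ) (c u : Fin d → ℝ) (B K : Matrix (Fin d) (Fin d) ℝ) :
    (bordered b c B * bordered h u K).trace = b * h + 2 * (c ⬝ᵥ u) + (B * K).trace := by
  rw [bordered, bordered, Matrix.fromBlocks_multiply]
  simp [Matrix.trace, Matrix.mul_apply, dotProduct, Finset.sum_add_distrib]
  ring

end Coordinates

end CovSelection

/-! ### The Wishart normalising constant, by induction on the dimension. -/

namespace CovSelection

variable {d : ℕ}

/-- The new factors are those produced by integrating out one row: `Γ(α - d/2)` from the diagonal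
entry and `π^{d/2}` from the other `d` entries. -/
theorem multivariateGamma_succ (d : ℕ) (α : ℝ) :
    multivariateGamma (d + 1) α =
      Real.pi ^ ((d : ℝ) / 2) * Real.Gamma (α - d / 2) * multivariateGamma d α := by
  have h : Real.pi ^ (((d + 1 : ℕ) : ℝ) * (((d + 1 : ℕ) : ℝ) - 1) / 4) =
      Real.pi ^ ((d : ℝ) / 2) * Real.pi ^ ((d : ℝ) * ((d : ℝ) - 1) / 4) := by
    rw [← Real.rpow_add Real.pi_pos]
    congr 1
    push_cast
    ring
  rw [multivariateGamma, multivariateGamma, Fin.prod_univ_castSucc, h]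
  simp only [Fin.val_castSucc, Fin.val_last]
  ring

theorem multivariateGamma_pos {α : ℝ} (hα : ((d : ℝ) - 1) / 2 < α) :
    0 < multivariateGamma d α := by
  refine mul_pos (Real.rpow_pos_of_pos Real.pi_pos _) (Finset.prod_pos fun j _ => ?_)
  refine Real.Gamma_pos_of_pos ?_
  have : (j : ℝ) + 1 ≤ d := by exact_mod_cast j.isLt
  linarith

/-- The unnormalised Wishart density as a function of the entries on and above the diagonal. -/
noncomputable def wishartKernel (α : ℝ) (B : Matrix (Fin d) (Fin d) ℝ)
    (θ : Sym2 (Fin d) → ℝ) : ℝ :=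
  (symMatrix θ).det ^ (α - ((d : ℝ) + 1) / 2) * Real.exp (-(B * symMatrix θ).trace)

theorem measurable_wishartKernel (α : ℝ) (B : Matrix (Fin d) (Fin d) ℝ) :
    Measurable (wishartKernel α B) := by
  have h := continuous_symMatrix (d := d)
  have h1 : Continuous fun θ : Sym2 (Fin d) → ℝ => (symMatrix θ).det := h.matrix_det
  have h2 : Continuous fun θ : Sym2 (Fin d) → ℝ => (B * symMatrix θ).trace :=
    (continuous_const.matrix_mul h).matrix_trace
  exact (h1.measurable.pow_const _).mul (Real.measurable_exp.comp h2.measurable.neg)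

theorem measurable_indicator_wishartKernel (α : ℝ) (B : Matrix (Fin d) (Fin d) ℝ) :
    Measurable ({θ : Sym2 (Fin d) → ℝ | (symMatrix θ).PosDef}.indicator
      fun θ => ENNReal.ofReal (wishartKernel α B θ)) :=
  (measurable_wishartKernel α B).ennreal_ofReal.indicator isOpen_posDef_symMatrix.measurableSet

theorem posDef_symMatrix_assemble_iff (p : (Sym2 (Fin d) → ℝ) × (Fin d → ℝ) × ℝ) :
    (symMatrix (assemble d p)).PosDef ↔
      (symMatrix p.1).PosDef ∧ 0 < p.2.2 - p.2.1 ⬝ᵥ (symMatrix p.1)⁻¹ *ᵥ p.2.1 := by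
  rw [← posDef_bordered_iff, ← symMatrix_assemble]
  refine ⟨fun h => h.submatrix (blockIndex d).injective, fun h => ?_⟩
  have := h.submatrix (blockIndex d).symm.injective
  simpa using this

theorem wishartKernel_assemble {α : ℝ} {B : Matrix (Fin (d + 1)) (Fin (d + 1)) ℝ} {b : ℝ}
    {c : Fin d → ℝ} {B' : Matrix (Fin d) (Fin d) ℝ}
    (hB : B.submatrix (blockIndex d) (blockIndex d) = bordered b c B')
    (K : Sym2 (Fin d) → ℝ) (hK : (symMatrix K).PosDef) (u : Fin d → ℝ) (h : ℝ) :
    wishartKernel α B (assemble d (K, u, h)) =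
      ((symMatrix K).det * (h - u ⬝ᵥ (symMatrix K)⁻¹ *ᵥ u)) ^ (α - d / 2 - 1) *
        Real.exp (-(b * h + 2 * (c ⬝ᵥ u) + (B' * symMatrix K).trace)) := by
  have h1 : (symMatrix (assemble d (K, u, h))).det =
      (symMatrix K).det * (h - u ⬝ᵥ (symMatrix K)⁻¹ *ᵥ u) := by
    rw [← det_bordered_of_posDef hK, ← symMatrix_assemble (K, u, h),
      Matrix.det_submatrix_equiv_self]
  have h2 : (B * symMatrix (assemble d (K, u, h))).trace =
      b * h + 2 * (c ⬝ᵥ u) + (B' * symMatrix K).trace := by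
    rw [← trace_bordered_mul, ← hB, ← symMatrix_assemble (K, u, h),
      Matrix.submatrix_mul_equiv]
    exact ((blockIndex d).sum_comp fun i => (B * symMatrix (assemble d (K, u, h))) i i).symm
  rw [wishartKernel, h1, h2]
  congr 2
  push_cast
  ring

/-- Translating by `uᵀ K⁻¹ u` makes the Schur complement `s` the variable of integration. It ranges
over `s > 0` with weight `s^{α - d/2 - 1} e^{-bs}`, a gamma integral, and the translation leaves
behind a Gaussian weight in `u`. -/
theorem lintegral_diag_entry {α : ℝ} {B : Matrix (Fin (d + 1)) (Fin (d + 1)) ℝ} {b : ℝ}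
    {c : Fin d → ℝ} {B' : Matrix (Fin d) (Fin d) ℝ}
    (hB : B.submatrix (blockIndex d) (blockIndex d) = bordered b c B') (hb : 0 < b)
    (hα : (d : ℝ) / 2 < α) {K : Sym2 (Fin d) → ℝ} (hK : (symMatrix K).PosDef) (u : Fin d → ℝ) :
    ∫⁻ h : ℝ, {θ : Sym2 (Fin (d + 1)) → ℝ | (symMatrix θ).PosDef}.indicator
        (fun θ => ENNReal.ofReal (wishartKernel α B θ)) (assemble d (K, u, h)) =
      ENNReal.ofReal ((symMatrix K).det ^ (α - d / 2 - 1) *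
        Real.exp (-(B' * symMatrix K).trace) *
          (Real.Gamma (α - d / 2) * b ^ (-(α - d / 2)))) *
      ENNReal.ofReal (Real.exp (-(b * (u ⬝ᵥ (symMatrix K)⁻¹ *ᵥ u)) - 2 * (c ⬝ᵥ u))) := by
  set q := u ⬝ᵥ (symMatrix K)⁻¹ *ᵥ u with hq
  set C := (symMatrix K).det ^ (α - d / 2 - 1) * Real.exp (-(B' * symMatrix K).trace) *
    Real.exp (-(b * q) - 2 * (c ⬝ᵥ u)) with hC
  have hdet := hK.det_pos
  have hC0 : 0 ≤ C := by positivity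
  have key (h : ℝ) : {θ : Sym2 (Fin (d + 1)) → ℝ | (symMatrix θ).PosDef}.indicator
      (fun θ => ENNReal.ofReal (wishartKernel α B θ)) (assemble d (K, u, h)) =
      (Set.Ioi (0 : ℝ)).indicator (fun s => ENNReal.ofReal C *
        ENNReal.ofReal (s ^ (α - d / 2 - 1) * Real.exp (-(b * s)))) (h - q) := by
    by_cases hs : 0 < h - q
    · rw [Set.indicator_of_mem (by exact (posDef_symMatrix_assemble_iff (K, u, h)).2 ⟨hK, hs⟩),
        Set.indicator_of_mem (by exact hs), ← ENNReal.ofReal_mul hC0,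
        wishartKernel_assemble hB K hK u h, ← hq, Real.mul_rpow hdet.le hs.le]
      congr 1
      have : Real.exp (-(b * h + 2 * (c ⬝ᵥ u) + (B' * symMatrix K).trace)) =
          Real.exp (-(B' * symMatrix K).trace) * Real.exp (-(b * q) - 2 * (c ⬝ᵥ u)) *
            Real.exp (-(b * (h - q))) := by
        rw [← Real.exp_add, ← Real.exp_add]
        congr 1
        ring
      rw [this, hC]
      ring
    · rw [Set.indicator_of_notMem, Set.indicator_of_notMem (by exact hs)]
      intro hmem
      exact hs ((posDef_symMatrix_assemble_iff (K, u, h)).1 hmem).2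
  simp_rw [key]
  rw [lintegral_sub_right_eq_self (μ := volume) (fun s => (Set.Ioi (0 : ℝ)).indicator (fun s =>
      ENNReal.ofReal C * ENNReal.ofReal (s ^ (α - d / 2 - 1) * Real.exp (-(b * s)))) s),
    lintegral_indicator measurableSet_Ioi, lintegral_const_mul' _ _ ENNReal.ofReal_ne_top,
    lintegral_Ioi_rpow_mul_exp_neg (by linarith) hb, ← ENNReal.ofReal_mul hC0,
    ← ENNReal.ofReal_mul]
  · congr 1
    rw [hC]
    ring
  · have := Real.Gamma_pos_of_pos (s := α - d / 2) (by linarith)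
    positivity

/-- The term `cᵀ K c / b` created by the Gaussian integral over the row is absorbed by passing from
the lower block of `B` to the Schur complement of `b`. -/
theorem trace_sub_vecMulVec_mul (B K : Matrix (Fin d) (Fin d) ℝ) (b : ℝ) (c : Fin d → ℝ) :
    ((B - b⁻¹ • Matrix.vecMulVec c c) * K).trace = (B * K).trace - (c ⬝ᵥ K *ᵥ c) / b := by
  rw [Matrix.sub_mul, Matrix.trace_sub, Matrix.smul_mul, Matrix.trace_smul,
    Matrix.vecMulVec_mul, Matrix.trace_vecMulVec, smul_eq_mul, Matrix.dotProduct_mulVec,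
    dotProduct_comm, div_eq_inv_mul]

/-- The Gaussian integral over `u` supplies `(det K)^{1/2}`, which raises the exponent of `det K` to
the one of a Wishart kernel of size `d` with the same `α`. The powers of `b` combine as `-(α - d/2)
- d/2 = -α`. -/
theorem lintegral_first_row {α : ℝ} {B : Matrix (Fin (d + 1)) (Fin (d + 1)) ℝ} {b : ℝ}
    {c : Fin d → ℝ} {B' : Matrix (Fin d) (Fin d) ℝ}
    (hB : B.submatrix (blockIndex d) (blockIndex d) = bordered b c B') (hb : 0 < b)
    (hα : (d : ℝ) / 2 < α) (K : Sym2 (Fin d) → ℝ) :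
    ∫⁻ u : Fin d → ℝ, ∫⁻ h : ℝ, {θ : Sym2 (Fin (d + 1)) → ℝ | (symMatrix θ).PosDef}.indicator
        (fun θ => ENNReal.ofReal (wishartKernel α B θ)) (assemble d (K, u, h)) =
      ENNReal.ofReal (Real.pi ^ ((d : ℝ) / 2) * Real.Gamma (α - d / 2) * b ^ (-α)) *
        {θ : Sym2 (Fin d) → ℝ | (symMatrix θ).PosDef}.indicator
        (fun θ => ENNReal.ofReal (wishartKernel α (B' - b⁻¹ • Matrix.vecMulVec c c) θ)) K := by
  have hΓ := Real.Gamma_pos_of_pos (s := α - d / 2) (by linarith)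
  by_cases hK : (symMatrix K).PosDef
  -- If `K` is positive definite, the two integrals are computed in turn; otherwise both sides
  -- vanish.
  · have hdet := hK.det_pos
    simp_rw [lintegral_diag_entry hB hb hα hK]
    rw [lintegral_const_mul' _ _ ENNReal.ofReal_ne_top,
      lintegral_exp_neg_quadratic_sub_linear hK hb, Set.indicator_of_mem (by exact hK),
      ← ENNReal.ofReal_mul (by positivity), ← ENNReal.ofReal_mul (by positivity)]
    congr 1
    have h0 : Real.exp (-((B' * symMatrix K).trace - (c ⬝ᵥ symMatrix K *ᵥ c) / b)) =
        Real.exp (-(B' * symMatrix K).trace) * Real.exp ((c ⬝ᵥ symMatrix K *ᵥ c) / b) := by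
      rw [← Real.exp_add]
      congr 1
      ring
    rw [wishartKernel, trace_sub_vecMulVec_mul, h0, Real.div_rpow Real.pi_pos.le hb.le]
    have h1 : (symMatrix K).det ^ (α - ((d : ℝ) + 1) / 2) =
        (symMatrix K).det ^ (α - d / 2 - 1) * (symMatrix K).det ^ (1 / 2 : ℝ) := by
      rw [← Real.rpow_add hdet]
      congr 1
      ring
    have h2 : b ^ (-(α - (d : ℝ) / 2)) = b ^ (-α) * b ^ ((d : ℝ) / 2) := by
      rw [← Real.rpow_add hb]
      congr 1
      ring
    rw [h1, h2]
    field_simp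
  · rw [Set.indicator_of_notMem (by exact hK), mul_zero]
    have h0 (u : Fin d → ℝ) (h : ℝ) : assemble d (K, u, h) ∉
        {θ : Sym2 (Fin (d + 1)) → ℝ | (symMatrix θ).PosDef} := fun hmem =>
      hK ((posDef_symMatrix_assemble_iff (K, u, h)).1 hmem).1
    simp only [Set.indicator_of_notMem (h0 _ _), lintegral_zero]

/-- Working with `ℝ≥0∞`-valued integrals lets Tonelli apply before integrability is known. The
factor `b^{-α}` from the row and the determinant of the Schur complement from the induction
hypothesis recombine to `(det B)^{-α}`. -/
theorem lintegral_wishartKernel (d : ℕ) : ∀ {α : ℝ} {B : Matrix (Fin d) (Fin d) ℝ},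
    ((d : ℝ) - 1) / 2 < α → B.PosDef →
    ∫⁻ θ in {θ : Sym2 (Fin d) → ℝ | (symMatrix θ).PosDef},
        ENNReal.ofReal (wishartKernel α B θ) =
      ENNReal.ofReal (multivariateGamma d α * B.det ^ (-α)) := by
  induction d with
  | zero =>
    intro α B _ _
    -- In dimension `0` the empty matrix is positive definite and Lebesgue measure is a point mass,
    -- so the integral is `1`.
    have hset : {θ : Sym2 (Fin 0) → ℝ | (symMatrix θ).PosDef} = Set.univ := by
      ext θ
      simp only [Set.mem_ofPred_eq, Set.mem_univ, iff_true]
      exact Matrix.PosDef.of_dotProduct_mulVec_pos (isHermitian_symMatrix θ)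
        fun x hx => absurd (Subsingleton.elim x 0) hx
    rw [hset, Measure.restrict_univ, Measure.volume_pi_eq_dirac]
    simp [wishartKernel, multivariateGamma]
  | succ d ih =>
    intro α B hα hB
    obtain ⟨b, c, B', -, hBb⟩ := exists_bordered hB.isHermitian
    have hM : (bordered b c B').PosDef := hBb ▸ hB.submatrix (blockIndex d).injective
    obtain ⟨hb, hS, hdet⟩ := posDef_schur_of_bordered hM
    have hα' : (d : ℝ) / 2 < α := by
      push_cast at hα
      linarith
    have hmeas := measurable_indicator_wishartKernel α B
    have hmeas' : Measurable fun p => {θ : Sym2 (Fin (d + 1)) → ℝ |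
        (symMatrix θ).PosDef}.indicator (fun θ => ENNReal.ofReal (wishartKernel α B θ))
          (assemble d p) := hmeas.comp measurePreserving_assemble.measurable
    rw [← lintegral_indicator isOpen_posDef_symMatrix.measurableSet,
      ← measurePreserving_assemble.lintegral_comp hmeas, Measure.volume_eq_prod,
      lintegral_prod _ hmeas'.aemeasurable]
    have hinner (K : Sym2 (Fin d) → ℝ) :
        ∫⁻ p : (Fin d → ℝ) × ℝ, {θ : Sym2 (Fin (d + 1)) → ℝ | (symMatrix θ).PosDef}.indicator
          (fun θ => ENNReal.ofReal (wishartKernel α B θ)) (assemble d (K, p)) =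
        ENNReal.ofReal (Real.pi ^ ((d : ℝ) / 2) * Real.Gamma (α - d / 2) * b ^ (-α)) *
        {θ : Sym2 (Fin d) → ℝ | (symMatrix θ).PosDef}.indicator
        (fun θ => ENNReal.ofReal
          (wishartKernel α (B' - b⁻¹ • Matrix.vecMulVec c c) θ)) K := by
      have hmeasK : Measurable fun p => {θ : Sym2 (Fin (d + 1)) → ℝ |
          (symMatrix θ).PosDef}.indicator (fun θ => ENNReal.ofReal (wishartKernel α B θ))
            (assemble d (K, p)) := hmeas'.comp measurable_prodMk_left
      rw [Measure.volume_eq_prod, lintegral_prod _ hmeasK.aemeasurable]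
      exact lintegral_first_row hBb hb hα' K
    simp_rw [hinner]
    rw [lintegral_const_mul' _ _ ENNReal.ofReal_ne_top,
      lintegral_indicator isOpen_posDef_symMatrix.measurableSet, ih (by linarith) hS]
    have hΓ := Real.Gamma_pos_of_pos (s := α - d / 2) (by linarith)
    rw [← ENNReal.ofReal_mul (by positivity), multivariateGamma_succ]
    have hBdet : B.det = b * (B' - b⁻¹ • Matrix.vecMulVec c c).det := by
      rw [← hdet, ← hBb, Matrix.det_submatrix_equiv_self]
    rw [hBdet, Real.mul_rpow hb.le hS.det_pos.le]
    congr 1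
    ring

/-- The normalisation of the Wishart distribution. -/
theorem integral_wishartKernel {α : ℝ} {B : Matrix (Fin d) (Fin d) ℝ}
    (hα : ((d : ℝ) - 1) / 2 < α) (hB : B.PosDef) :
    ∫ θ in {θ : Sym2 (Fin d) → ℝ | (symMatrix θ).PosDef}, wishartKernel α B θ =
      multivariateGamma d α * B.det ^ (-α) := by
  rw [integral_eq_lintegral_of_nonneg_ae, lintegral_wishartKernel d hα hB, ENNReal.toReal_ofReal]
  · have := multivariateGamma_pos hα
    have := hB.det_pos
    positivity
  · refine ae_restrict_of_forall_mem isOpen_posDef_symMatrix.measurableSet fun θ hθ => ?_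
    have := Matrix.PosDef.det_pos hθ
    simp only [Pi.zero_apply, wishartKernel]
    positivity
  · exact (measurable_wishartKernel α B).aestronglyMeasurable

end CovSelection

/-! ### Closed forms of the three evidences by conjugacy. -/

namespace CovSelection

variable {d : ℕ}

theorem posSemidef_scatter (n : ℕ) (x : ℕ → EuclideanSpace ℝ (Fin d)) :
    (scatter n x).PosSemidef := by
  have h : scatter n x = ∑ i ∈ Finset.range n,
      Matrix.vecMulVec (fun j => x i j) (star fun j => x i j) := by
    ext j k
    simp [scatter, Matrix.sum_apply, Matrix.vecMulVec_apply]
  rw [h]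
  exact Matrix.posSemidef_sum _ fun i _ => Matrix.posSemidef_vecMulVec_self_star _

/-- The evidence of the general model in closed form. -/
theorem evidenceA_eq {α : ℝ} {B : Matrix (Fin d) (Fin d) ℝ} (hα : ((d : ℝ) - 1) / 2 < α)
    (hB : B.PosDef) (n : ℕ) (x : ℕ → EuclideanSpace ℝ (Fin d)) :
    evidenceA α B n x = B.det ^ α / (multivariateGamma d α * Real.pi ^ ((n : ℝ) * d / 2)) *
      (multivariateGamma d (α + n / 2) * (B + scatter n x).det ^ (-(α + n / 2))) := by
  have hBs : (B + scatter n x).PosDef := hB.add_posSemidef (posSemidef_scatter n x)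
  have hn : (0 : ℝ) ≤ n / 2 := by positivity
  -- Likelihood times prior is a Wishart kernel again, with shape `α + n/2` and rate `B + s_n`.
  rw [← integral_wishartKernel (by linarith) hBs, ← integral_const_mul, evidenceA]
  refine setIntegral_congr_fun isOpen_posDef_symMatrix.measurableSet fun θ hθ => ?_
  have hdet := Matrix.PosDef.det_pos hθ
  have h1 : (symMatrix θ).det ^ (α + n / 2 - ((d : ℝ) + 1) / 2) =
      (symMatrix θ).det ^ ((n : ℝ) / 2) * (symMatrix θ).det ^ (α - ((d : ℝ) + 1) / 2) := by
    rw [← Real.rpow_add hdet]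
    congr 1
    ring
  have h2 : Real.exp (-((B + scatter n x) * symMatrix θ).trace) =
      Real.exp (-(symMatrix θ * scatter n x).trace) * Real.exp (-(B * symMatrix θ).trace) := by
    rw [← Real.exp_add, Matrix.add_mul, Matrix.trace_add,
      Matrix.trace_mul_comm (scatter n x)]
    congr 1
    ring
  simp only [likelihood, wishartDensity, wishartKernel, h1, h2]
  ring

/-- Gamma conjugacy with a free exponent `m`: it serves with `m = n/2` for one coordinate of model
`D`, `m = nd/2` for model `C`, `m = d/2` for a scale mixture of normals, and `m = 0` for the
normalisation of the prior. -/
theorem integral_likelihood_mul_gammaPDFReal {α β m s : ℝ} (hα : 0 < α) (hβ : 0 < β)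
    (hm : 0 ≤ m) (hs : 0 ≤ s) :
    ∫ η in Set.Ioi (0 : ℝ), η ^ m * Real.exp (-(η * s)) * gammaPDFReal α β η =
      β ^ α / Real.Gamma α * (Real.Gamma (α + m) * (β + s) ^ (-(α + m))) := by
  rw [← integral_Ioi_rpow_mul_exp_neg (by linarith) (by linarith), ← integral_const_mul]
  refine setIntegral_congr_fun measurableSet_Ioi fun η hη => ?_
  have hη' : (0 : ℝ) < η := hη
  have h1 : η ^ (α + m - 1) = η ^ m * η ^ (α - 1) := by
    rw [← Real.rpow_add hη']
    congr 1
    ring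
  have h2 : Real.exp (-((β + s) * η)) = Real.exp (-(η * s)) * Real.exp (-(β * η)) := by
    rw [← Real.exp_add]
    congr 1
    ring
  simp only [gammaPDFReal, if_pos hη'.le, h1, h2]
  ring

theorem scatter_diag_nonneg (n : ℕ) (x : ℕ → EuclideanSpace ℝ (Fin d)) (j : Fin d) :
    0 ≤ scatter n x j j := (posSemidef_scatter n x).diag_nonneg

/-- The evidence of the diagonal model in closed form. -/
theorem evidenceD_eq {α : ℝ} {β : Fin d → ℝ} (hα : 0 < α) (hβ : ∀ j, 0 < β j) (n : ℕ)
    (x : ℕ → EuclideanSpace ℝ (Fin d)) :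
    evidenceD α β n x = ∏ j, (β j ^ α / (Real.Gamma α * Real.pi ^ ((n : ℝ) / 2)) *
      (Real.Gamma (α + n / 2) * (β j + scatter n x j j) ^ (-(α + n / 2)))) := by
  have hset : {η : Fin d → ℝ | ∀ j, 0 < η j} = Set.univ.pi fun _ => Set.Ioi 0 := by
    ext
    simp
  have hfac (j : Fin d) : β j ^ α / (Real.Gamma α * Real.pi ^ ((n : ℝ) / 2)) *
      (Real.Gamma (α + n / 2) * (β j + scatter n x j j) ^ (-(α + n / 2))) =
      ∫ η in Set.Ioi (0 : ℝ), (Real.pi ^ ((n : ℝ) / 2))⁻¹ *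
        (η ^ ((n : ℝ) / 2) * Real.exp (-(η * scatter n x j j)) * gammaPDFReal α (β j) η) := by
    rw [integral_const_mul, integral_likelihood_mul_gammaPDFReal hα (hβ j) (by positivity)
      (scatter_diag_nonneg n x j)]
    field_simp
  simp_rw [hfac]
  rw [evidenceD, hset, volume_pi, Measure.restrict_pi_pi, ← integral_fintype_prod_eq_prod]
  rw [← Measure.restrict_pi_pi]
  refine setIntegral_congr_fun (MeasurableSet.univ_pi fun _ => measurableSet_Ioi) fun η hη => ?_
  have hη' : ∀ j, 0 < η j := by simpa using hη
  have h1 : (Matrix.diagonal η).det ^ ((n : ℝ) / 2) = ∏ j, η j ^ ((n : ℝ) / 2) := by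
    rw [Matrix.det_diagonal, Real.finsetProd_rpow _ _ fun j _ => (hη' j).le]
  have h2 : Real.exp (-(Matrix.diagonal η * scatter n x).trace) =
      ∏ j, Real.exp (-(η j * scatter n x j j)) := by
    rw [← Real.exp_sum, Finset.sum_neg_distrib]
    simp [Matrix.trace, Matrix.diagonal_mul]
  have h3 : Real.pi ^ ((n : ℝ) * d / 2) = ∏ _j : Fin d, Real.pi ^ ((n : ℝ) / 2) := by
    rw [Finset.prod_const, Finset.card_univ, Fintype.card_fin, ← Real.rpow_natCast,
      ← Real.rpow_mul Real.pi_pos.le]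
    congr 1
    ring
  simp only [likelihood, h1, h2, h3]
  rw [Finset.prod_mul_distrib, Finset.prod_mul_distrib, Finset.prod_mul_distrib,
    Finset.prod_inv_distrib]
  ring

/-- The evidence of the isotropic model in closed form. -/
theorem evidenceC_eq {α β : ℝ} (hα : 0 < α) (hβ : 0 < β) (n : ℕ)
    (x : ℕ → EuclideanSpace ℝ (Fin d)) :
    evidenceC α β n x = β ^ α / (Real.Gamma α * Real.pi ^ ((n : ℝ) * d / 2)) *
      (Real.Gamma (α + n * d / 2) *
        (β + (scatter n x).trace) ^ (-(α + (n : ℝ) * d / 2))) := by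
  have h : β ^ α / (Real.Gamma α * Real.pi ^ ((n : ℝ) * d / 2)) *
      (Real.Gamma (α + n * d / 2) * (β + (scatter n x).trace) ^ (-(α + (n : ℝ) * d / 2))) =
      ∫ η in Set.Ioi (0 : ℝ), (Real.pi ^ ((n : ℝ) * d / 2))⁻¹ *
        (η ^ ((n : ℝ) * d / 2) * Real.exp (-(η * (scatter n x).trace)) *
          gammaPDFReal α β η) := by
    rw [integral_const_mul, integral_likelihood_mul_gammaPDFReal hα hβ (by positivity)
      (posSemidef_scatter n x).trace_nonneg]
    field_simp
  rw [h, evidenceC]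
  refine setIntegral_congr_fun measurableSet_Ioi fun η hη => ?_
  have hη' : (0 : ℝ) < η := hη
  have h1 : (η • (1 : Matrix (Fin d) (Fin d) ℝ)).det ^ ((n : ℝ) / 2) =
      η ^ ((n : ℝ) * d / 2) := by
    rw [Matrix.det_smul, Matrix.det_one, mul_one, Fintype.card_fin, ← Real.rpow_natCast,
      ← Real.rpow_mul hη'.le]
    congr 1
    ring
  simp only [likelihood, h1, Matrix.smul_mul, Matrix.one_mul, Matrix.trace_smul, smul_eq_mul]
  ring

end CovSelection

namespace CovSelection

open Asymptotics Topology

/-! ### Stirling's formula with bounded error. -/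

section Stirling

/-- The error in the approximation `(x - 1/2) log x - x` to `log Γ(x)`. -/
noncomputable def stirlingError (x : ℝ) : ℝ :=
  Real.log (Real.Gamma x) - ((x - 1 / 2) * Real.log x - x)

theorem stirlingError_add_one {x : ℝ} (hx : 0 < x) :
    stirlingError (x + 1) = stirlingError x - ((x + 1 / 2) * Real.log ((x + 1) / x) - 1) := by
  have hΓ := Real.Gamma_pos_of_pos hx
  rw [stirlingError, stirlingError, Real.Gamma_add_one hx.ne', Real.log_mul hx.ne' hΓ.ne',
    Real.log_div (by positivity) hx.ne']
  ring

/-- This is the bound `log (1 + t) ≥ 2t / (t + 2)` at `t = 1/x`. -/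
theorem stirlingError_add_one_le {x : ℝ} (hx : 0 < x) :
    stirlingError (x + 1) ≤ stirlingError x := by
  have h := Real.le_log_one_add_of_nonneg (x := 1 / x) (by positivity)
  have h1 : 1 + 1 / x = (x + 1) / x := by field_simp
  have h2 : 2 * (1 / x) / (1 / x + 2) = (x + 1 / 2)⁻¹ := by
    field_simp
    ring
  rw [h1, h2, inv_le_iff_one_le_mul₀ (by positivity)] at h
  rw [stirlingError_add_one hx]
  linarith

/-- With `y = (x + 1)/x`, the bound `log y ≤ sinh (log y) = (y - 1/y)/2` limits the decrease in one
step to `1/(4x(x + 1))`, which telescopes. -/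
theorem le_stirlingError_add_one {x : ℝ} (hx : 0 < x) :
    stirlingError x - 1 / (4 * x) ≤ stirlingError (x + 1) - 1 / (4 * (x + 1)) := by
  have hy : 0 < (x + 1) / x := by positivity
  have hy1 : 1 ≤ (x + 1) / x := by
    rw [le_div_iff₀ hx]
    linarith
  have h := Real.self_le_sinh_iff.2 (Real.log_nonneg hy1)
  rw [Real.sinh_log hy] at h
  have h2 : (x + 1 / 2) * Real.log ((x + 1) / x) ≤
      (x + 1 / 2) * (((x + 1) / x - ((x + 1) / x)⁻¹) / 2) :=
    mul_le_mul_of_nonneg_left h (by positivity)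
  have h3 : (x + 1 / 2) * (((x + 1) / x - ((x + 1) / x)⁻¹) / 2) - 1 =
      1 / (4 * x) - 1 / (4 * (x + 1)) := by
    field_simp
    ring
  rw [stirlingError_add_one hx]
  linarith

theorem stirlingError_add_natCast {x : ℝ} (hx : 1 ≤ x) (k : ℕ) :
    stirlingError x - 1 / 4 ≤ stirlingError (x + k) ∧
      stirlingError (x + k) ≤ stirlingError x := by
  have hx0 : 0 < x := by linarith
  have h : stirlingError x - 1 / (4 * x) ≤ stirlingError (x + k) - 1 / (4 * (x + k)) ∧
      stirlingError (x + k) ≤ stirlingError x := by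
    induction k with
    | zero => simp
    | succ k ih =>
      have hk : 0 < x + k := by positivity
      have h1 := le_stirlingError_add_one hk
      have h2 := stirlingError_add_one_le hk
      rw [add_assoc] at h1 h2
      push_cast
      exact ⟨ih.1.trans (by simpa [add_assoc] using h1), h2.trans ih.2⟩
  have h1 : 1 / (4 * x) ≤ 1 / 4 := by
    gcongr
    linarith
  have h2 : 0 < 1 / (4 * (x + k)) := by positivity
  exact ⟨by linarith [h.1], h.2⟩

theorem stirlingError_isBigO_one :
    stirlingError =O[atTop] (fun _ => (1 : ℝ)) := by
  have hcont : ContinuousOn stirlingError (Set.Icc 1 2) := by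
    intro x hx
    have hx0 : 0 < x := by linarith [hx.1]
    have hΓ : ContinuousAt Real.Gamma x :=
      (Real.differentiableAt_Gamma fun m => by
        have : (0 : ℝ) ≤ m := by positivity
        -- `Γ` is differentiable away from the nonpositive integers, and here `x ≥ 1`.
        linarith).continuousAt
    exact ((hΓ.log (Real.Gamma_pos_of_pos hx0).ne').sub
      (((continuousAt_id.sub continuousAt_const).mul
        (Real.continuousAt_log hx0.ne')).sub continuousAt_id)).continuousWithinAt
  obtain ⟨M, hM⟩ := isCompact_Icc.exists_bound_of_continuousOn hcont
  refine IsBigO.of_bound (M + 1 / 4) ?_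
  filter_upwards [eventually_ge_atTop (1 : ℝ)] with x hx
  -- Integer steps change the error by at most `1/4`, so its bound on the compact interval `[1, 2]`
  -- extends to all `x ≥ 1`.
  obtain ⟨y, k, hy1, hy2, hxy⟩ : ∃ (y : ℝ) (k : ℕ), 1 ≤ y ∧ y ≤ 2 ∧ x = y + k := by
    refine ⟨x - ⌊x - 1⌋₊, ⌊x - 1⌋₊, ?_, ?_, by ring⟩
    · linarith [Nat.floor_le (show 0 ≤ x - 1 by linarith)]
    · linarith [Nat.lt_floor_add_one (x - 1)]
  have h := stirlingError_add_natCast hy1 k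
  have hMy := abs_le.1 (hM y ⟨hy1, hy2⟩)
  rw [hxy, norm_one, mul_one, Real.norm_eq_abs, abs_le]
  exact ⟨by linarith [h.1, hMy.1], by linarith [h.2, hMy.2]⟩

/-- Stirling's formula along an arithmetic progression, up to a bounded error. -/
theorem log_Gamma_add_mul_isBigO (a : ℝ) {c : ℝ} (hc : 0 < c) :
    (fun n : ℕ => Real.log (Real.Gamma (a + c * n)) -
      (c * n * Real.log (c * n) - c * n + (a - 1 / 2) * Real.log n)) =O[atTop]
      (fun _ => (1 : ℝ)) := by
  have hcn : Tendsto (fun n : ℕ => c * (n : ℝ)) atTop atTop :=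
    tendsto_natCast_atTop_atTop.const_mul_atTop hc
  have h1 : (fun n : ℕ => stirlingError (a + c * n)) =O[atTop] (fun _ => (1 : ℝ)) :=
    stirlingError_isBigO_one.comp_tendsto (tendsto_atTop_add_const_left _ a hcn)
  -- The factor `log (a + cn)` is split in two ways: as `log (cn) + log (1 + a/(cn))` where it is
  -- multiplied by `cn`, and as `log n + log (c + a/n)` where it is multiplied by `a - 1/2`.
  have h2 : (fun n : ℕ => c * (n : ℝ) * Real.log (1 + a / (c * n))) =O[atTop]
      (fun _ => (1 : ℝ)) :=
    ((Real.tendsto_mul_log_one_add_div_atTop a).comp hcn).isBigO_one ℝ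
  have h3 : (fun n : ℕ => Real.log (c + a / (n : ℝ))) =O[atTop] (fun _ => (1 : ℝ)) := by
    have : Tendsto (fun n : ℕ => c + a / (n : ℝ)) atTop (𝓝 c) := by
      simpa using (tendsto_const_div_atTop_nhds_zero_nat a).const_add c
    exact (this.log hc.ne').isBigO_one ℝ
  have h4 : (fun _ : ℕ => a) =O[atTop] (fun _ => (1 : ℝ)) := isBigO_const_const _ one_ne_zero _
  refine (((h1.add h2).add (h3.const_mul_left (a - 1 / 2))).sub h4).congr' ?_ EventuallyEq.rfl
  have hpos : ∀ᶠ n : ℕ in atTop, 0 < a + c * n :=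
    (tendsto_atTop_add_const_left _ a hcn).eventually_gt_atTop 0
  filter_upwards [hpos, eventually_gt_atTop 0] with n hn hn0
  have hn0' : (0 : ℝ) < n := by exact_mod_cast hn0
  have e1 : 1 + a / (c * n) = (a + c * n) / (c * n) := by
    field_simp
    ring
  have e2 : c + a / (n : ℝ) = (a + c * n) / n := by
    field_simp
    ring
  rw [e1, e2, Real.log_div hn.ne' (by positivity), Real.log_div hn.ne' hn0'.ne', stirlingError]
  ring

end Stirling

/-! ### Two estimates for smooth functions. -/

section Calculus

variable {E : Type*} [NormedAddCommGroup E] [NormedSpace ℝ E]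

/-- A `C²` function differs from its value at a local minimum by a quadratically small amount. -/
theorem isBigO_norm_sub_sq_of_isLocalMin {f : E → ℝ} {x₀ : E} (hf : ContDiffAt ℝ 2 f x₀)
    (hmin : IsLocalMin f x₀) :
    (fun x => f x - f x₀) =O[𝓝 x₀] fun x => ‖x - x₀‖ ^ 2 := by
  have h0 : fderiv ℝ f x₀ = 0 := hmin.fderiv_eq_zero
  have hd : ContDiffAt ℝ 1 (fderiv ℝ f) x₀ := hf.fderiv_right (by norm_num)
  -- The derivative vanishes at `x₀` and is differentiable there, so it is `O(‖x - x₀‖)`; the mean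
  -- value inequality on the ball of radius `‖x - x₀‖` gives the second factor.
  have hO := (hd.differentiableAt one_ne_zero).hasFDerivAt.isBigO_sub
  rw [h0] at hO
  simp only [sub_zero] at hO
  obtain ⟨C, hC⟩ := hO.bound
  have hdiff : ∀ᶠ x in 𝓝 x₀, DifferentiableAt ℝ f x := by
    filter_upwards [hf.eventually (by simp)] with x hx
    exact hx.differentiableAt (by norm_num)
  obtain ⟨r, hr, hball⟩ := Metric.eventually_nhds_iff_ball.1 (hC.and hdiff)
  refine IsBigO.of_bound C ?_
  filter_upwards [Metric.ball_mem_nhds x₀ hr] with x hx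
  have hx' : ‖x - x₀‖ < r := by simpa [dist_eq_norm] using hx
  have hsub : Metric.closedBall x₀ ‖x - x₀‖ ⊆ Metric.ball x₀ r :=
    Metric.closedBall_subset_ball hx'
  have hC0 : x ≠ x₀ → 0 ≤ C := fun hne => by
    have h := (norm_nonneg _).trans (hball x hx).1
    exact nonneg_of_mul_nonneg_left h (norm_pos_iff.2 (sub_ne_zero.2 hne))
  by_cases hne : x = x₀
  · simp [hne]
  have h := (convex_closedBall x₀ ‖x - x₀‖).norm_image_sub_le_of_norm_fderiv_le
    (𝕜 := ℝ) (f := f) (C := C * ‖x - x₀‖) (fun y hy => (hball y (hsub hy)).2)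
    (fun y hy => (hball y (hsub hy)).1.trans
      (mul_le_mul_of_nonneg_left (by simpa [dist_eq_norm] using hy) (hC0 hne)))
    (Metric.mem_closedBall_self (norm_nonneg _))
    (show x ∈ Metric.closedBall x₀ ‖x - x₀‖ by simp [dist_eq_norm])
  rw [norm_pow, norm_norm]
  calc ‖f x - f x₀‖ ≤ _ := h
    _ = C * ‖x - x₀‖ ^ 2 := by ring

theorem tendsto_add_inv_smul {x₀ : E} {u : ℕ → E} (hu : Tendsto u atTop (𝓝 x₀)) (b : E) :
    Tendsto (fun n : ℕ => u n + (n : ℝ)⁻¹ • b) atTop (𝓝 x₀) := by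
  simpa using hu.add ((tendsto_inv_atTop_nhds_zero_nat (𝕜 := ℝ)).smul_const b)

/-- Perturbing the argument of a differentiable function by `O(1/n)` changes it by `O(1/n)`. -/
theorem isBigO_natCast_mul_sub {f : E → ℝ} {x₀ : E} (hf : ContDiffAt ℝ 1 f x₀) {u : ℕ → E}
    (hu : Tendsto u atTop (𝓝 x₀)) (b : E) :
    (fun n : ℕ => (n : ℝ) * (f (u n + (n : ℝ)⁻¹ • b) - f (u n))) =O[atTop]
      (fun _ => (1 : ℝ)) := by
  have hs := tendsto_add_inv_smul hu b
  have h := (hf.hasStrictFDerivAt one_ne_zero).isBigO_sub.comp_tendsto (hs.prodMk_nhds hu)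
  have h2 := (isBigO_refl (fun n : ℕ => (n : ℝ)) atTop).mul h.norm_right
  refine h2.trans (IsBigO.of_bound ‖b‖ (Eventually.of_forall fun n => ?_))
  simp only [Function.comp_apply, add_sub_cancel_left, norm_smul, norm_mul, norm_norm, norm_inv,
    Real.norm_natCast, norm_one, mul_one]
  by_cases hn : (n : ℝ) = 0
  · simp [hn]
  · rw [mul_inv_cancel_left₀ hn]

end Calculus

end CovSelection

namespace CovSelection

open Asymptotics Topology

variable {d : ℕ}

/-! ### The fit criteria of the models and their quadratic contact under a smaller model. -/

section Criteria

/-- Twice the minimised negative log-likelihood per observation of the general model, up to an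
additive constant, as a function of the second moments. -/
noncomputable def critA (θ : Sym2 (Fin d) → ℝ) : ℝ := Real.log (symMatrix θ).det

/-- The same for the diagonal model. -/
noncomputable def critD (θ : Sym2 (Fin d) → ℝ) : ℝ := ∑ j, Real.log (θ s(j, j))

/-- The same for the isotropic model. -/
noncomputable def critC (θ : Sym2 (Fin d) → ℝ) : ℝ := d * Real.log ((∑ j, θ s(j, j)) / d)

theorem symMatrix_apply (θ : Sym2 (Fin d) → ℝ) (i j : Fin d) : symMatrix θ i j = θ s(i, j) := rfl

theorem trace_symMatrix (θ : Sym2 (Fin d) → ℝ) : (symMatrix θ).trace = ∑ j, θ s(j, j) := rfl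

theorem symMatrix_add (θ η : Sym2 (Fin d) → ℝ) :
    symMatrix (θ + η) = symMatrix θ + symMatrix η := rfl

theorem symMatrix_smul (c : ℝ) (θ : Sym2 (Fin d) → ℝ) :
    symMatrix (c • θ) = c • symMatrix θ := rfl

theorem contDiffAt_critA {θ : Sym2 (Fin d) → ℝ} (hθ : (symMatrix θ).PosDef) {m : WithTop ℕ∞} :
    ContDiffAt ℝ m critA θ := by
  have h : ContDiff ℝ m fun θ : Sym2 (Fin d) → ℝ => (symMatrix θ).det := by
    simp only [Matrix.det_apply, symMatrix_apply]
    exact ContDiff.sum fun σ _ =>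
      (contDiff_prod fun i _ => contDiff_apply ℝ ℝ _).const_smul _
  exact h.contDiffAt.log hθ.det_pos.ne'

theorem contDiffAt_critD {θ : Sym2 (Fin d) → ℝ} (hθ : (symMatrix θ).PosDef) {m : WithTop ℕ∞} :
    ContDiffAt ℝ m critD θ := by
  refine ContDiffAt.sum fun j _ => ?_
  have h : 0 < θ s(j, j) := hθ.diag_pos (i := j)
  exact (contDiff_apply ℝ ℝ s(j, j)).contDiffAt.log h.ne'

theorem contDiffAt_critC (hd : 1 ≤ d) {θ : Sym2 (Fin d) → ℝ} (hθ : (symMatrix θ).PosDef)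
    {m : WithTop ℕ∞} : ContDiffAt ℝ m critC θ := by
  have : Nonempty (Fin d) := ⟨⟨0, hd⟩⟩
  have hd0 : (0 : ℝ) < d := by exact_mod_cast hd
  have h : 0 < (∑ j, θ s(j, j)) / d := div_pos hθ.trace_pos hd0
  have h1 : ContDiff ℝ m fun θ : Sym2 (Fin d) → ℝ => (∑ j, θ s(j, j)) / d :=
    (ContDiff.sum fun j _ => contDiff_apply ℝ ℝ s(j, j)).div_const _
  exact contDiffAt_const.mul (h1.contDiffAt.log h.ne')

/-- Where the off-diagonal second moments vanish, the criterion of the diagonal model exceeds that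
of the general model by a quadratically small amount. -/
theorem critD_sub_critA_isBigO {θ₀ : Sym2 (Fin d) → ℝ} (hθ : (symMatrix θ₀).PosDef)
    (hdiag : (symMatrix θ₀).IsDiag) :
    (fun θ => critD θ - critA θ) =O[𝓝 θ₀] fun θ => ‖θ - θ₀‖ ^ 2 := by
  have h0 : critD θ₀ - critA θ₀ = 0 := by
    have hdet : (symMatrix θ₀).det = ∏ j, θ₀ s(j, j) := by
      rw [← hdiag.diagonal_diag, Matrix.det_diagonal]
      rfl
    rw [critD, critA, hdet, Real.log_prod fun j _ => ?_, sub_self]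
    exact (hθ.diag_pos (i := j)).ne'
  -- Hadamard's inequality, with equality at the diagonal matrix, makes `θ₀` a minimum, so no
  -- derivative has to be computed.
  have hmin : IsLocalMin (fun θ => critD θ - critA θ) θ₀ := by
    filter_upwards [isOpen_posDef_symMatrix.mem_nhds hθ] with θ hθ'
    rw [h0]
    exact sub_nonneg.2 (log_det_le_sum_log_diag hθ')
  have h := isBigO_norm_sub_sq_of_isLocalMin
    ((contDiffAt_critD hθ).sub (contDiffAt_critA hθ)) hmin
  simpa only [h0, sub_zero] using h

/-- Neither criterion sees the off-diagonal entries, so the mean inequality is applied to the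
diagonal part alone. -/
theorem critD_le_critC (hd : 1 ≤ d) {θ : Sym2 (Fin d) → ℝ} (hθ : (symMatrix θ).PosDef) :
    critD θ ≤ critC θ := by
  have hpos (j : Fin d) : 0 < θ s(j, j) := hθ.diag_pos (i := j)
  have h := log_det_le_mul_log_mean hd (Matrix.PosDef.diagonal hpos)
  rw [Matrix.det_diagonal, Matrix.trace_diagonal,
    Real.log_prod fun j _ => (hpos j).ne'] at h
  exact h

/-- At a multiple of the identity, the criterion of the isotropic model exceeds that of the
diagonal model by a quadratically small amount. -/
theorem critC_sub_critD_isBigO (hd : 1 ≤ d) {θ₀ : Sym2 (Fin d) → ℝ}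
    (hθ : (symMatrix θ₀).PosDef) {v : ℝ} (hv : ∀ j, θ₀ s(j, j) = v) :
    (fun θ => critC θ - critD θ) =O[𝓝 θ₀] fun θ => ‖θ - θ₀‖ ^ 2 := by
  have hd0 : (d : ℝ) ≠ 0 := by exact_mod_cast (by omega : d ≠ 0)
  have h0 : critC θ₀ - critD θ₀ = 0 := by
    simp [critC, critD, hv, hd0]
  have hmin : IsLocalMin (fun θ => critC θ - critD θ) θ₀ := by
    filter_upwards [isOpen_posDef_symMatrix.mem_nhds hθ] with θ hθ'
    rw [h0]
    exact sub_nonneg.2 (critD_le_critC hd hθ')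
  have h := isBigO_norm_sub_sq_of_isLocalMin
    ((contDiffAt_critC hd hθ).sub (contDiffAt_critD hθ)) hmin
  simpa only [h0, sub_zero] using h

end Criteria

/-! ### Expansion of the log evidences up to bounded error. -/

section Expansion

/-- The second moments of the first `n` observations, as a point of `ℝ^{d(d+1)/2}`. -/
noncomputable def empirical (n : ℕ) (x : ℕ → EuclideanSpace ℝ (Fin d)) : Sym2 (Fin d) → ℝ :=
  Sym2.lift ⟨fun j k => (∑ i ∈ Finset.range n, x i j * x i k) / n, fun j k => by
    simp only [mul_comm]⟩

theorem empirical_mk (n : ℕ) (x : ℕ → EuclideanSpace ℝ (Fin d)) (j k : Fin d) :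
    empirical n x s(j, k) = (∑ i ∈ Finset.range n, x i j * x i k) / n := rfl

theorem smul_symMatrix_empirical {n : ℕ} (hn : n ≠ 0) (x : ℕ → EuclideanSpace ℝ (Fin d)) :
    (n : ℝ) • symMatrix (empirical n x) = scatter n x := by
  ext j k
  have : (n : ℝ) ≠ 0 := by exact_mod_cast hn
  simp only [Matrix.smul_apply, symMatrix_apply, empirical_mk, scatter, Matrix.of_apply,
    smul_eq_mul]
  field_simp

theorem add_scatter_eq {n : ℕ} (hn : n ≠ 0) (x : ℕ → EuclideanSpace ℝ (Fin d))
    (b : Sym2 (Fin d) → ℝ) :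
    symMatrix b + scatter n x = (n : ℝ) • symMatrix (empirical n x + (n : ℝ)⁻¹ • b) := by
  have : (n : ℝ) ≠ 0 := by exact_mod_cast hn
  rw [symMatrix_add, smul_add, smul_symMatrix_empirical hn, symMatrix_smul, smul_smul,
    mul_inv_cancel₀ this, one_smul, add_comm]

/-- The coefficient of `-n` in the expansion of the log evidence; it is common to all models. -/
noncomputable def entropyRate (d : ℕ) : ℝ := d / 2 * (Real.log Real.pi + Real.log 2 + 1)

/-- A sequence of evidences whose logarithm is, up to a bounded error, that of a regular model with
`p` parameters and criterion values `L n`. -/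
def HasLaplaceExpansion (d : ℕ) (p : ℝ) (E L : ℕ → ℝ) : Prop :=
  (fun n : ℕ => Real.log (E n) + entropyRate d * n + p / 2 * Real.log n + n / 2 * L n) =O[atTop]
    (fun _ => (1 : ℝ))

/-- The exact log evidence contains `-(a + n/2) f(V_n + b/n)`, with `b` the prior rate. Replacing it
by `-(n/2) f(V_n)` leaves precisely these terms, where `k` collects the constants of the prior. -/
theorem isBigO_crit_terms {f : (Sym2 (Fin d) → ℝ) → ℝ} {θ₀ : Sym2 (Fin d) → ℝ}
    (hf : ContDiffAt ℝ 1 f θ₀) {u : ℕ → Sym2 (Fin d) → ℝ} (hu : Tendsto u atTop (𝓝 θ₀))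
    (b : Sym2 (Fin d) → ℝ) (a k : ℝ) :
    (fun n : ℕ => k - a * f (u n + (n : ℝ)⁻¹ • b) -
      1 / 2 * ((n : ℝ) * (f (u n + (n : ℝ)⁻¹ • b) - f (u n)))) =O[atTop] (fun _ => (1 : ℝ)) := by
  have h1 : (fun _ : ℕ => k) =O[atTop] (fun _ => (1 : ℝ)) := isBigO_const_const _ one_ne_zero _
  have h2 : (fun n : ℕ => f (u n + (n : ℝ)⁻¹ • b)) =O[atTop] (fun _ => (1 : ℝ)) :=
    (hf.continuousAt.tendsto.comp (tendsto_add_inv_smul hu b)).isBigO_one ℝ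
  exact (h1.sub (h2.const_mul_left a)).sub
    ((isBigO_natCast_mul_sub hf hu b).const_mul_left (1 / 2))

theorem evidenceA_pos {α : ℝ} {B : Matrix (Fin d) (Fin d) ℝ} (hα : ((d : ℝ) - 1) / 2 < α)
    (hB : B.PosDef) (n : ℕ) (x : ℕ → EuclideanSpace ℝ (Fin d)) : 0 < evidenceA α B n x := by
  have h1 := multivariateGamma_pos hα
  have hn : (0 : ℝ) ≤ n / 2 := by positivity
  have h2 : 0 < multivariateGamma d (α + n / 2) := multivariateGamma_pos (by linarith)
  have h3 := hB.det_pos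
  have h4 := (hB.add_posSemidef (posSemidef_scatter n x)).det_pos
  rw [evidenceA_eq hα hB]
  positivity

theorem evidenceD_pos {α : ℝ} {β : Fin d → ℝ} (hα : 0 < α) (hβ : ∀ j, 0 < β j) (n : ℕ)
    (x : ℕ → EuclideanSpace ℝ (Fin d)) : 0 < evidenceD α β n x := by
  rw [evidenceD_eq hα hβ]
  refine Finset.prod_pos fun j _ => ?_
  have h1 := Real.Gamma_pos_of_pos hα
  have h2 : 0 < Real.Gamma (α + n / 2) := Real.Gamma_pos_of_pos (by positivity)
  have h3 := hβ j
  have h4 : 0 < β j + scatter n x j j := add_pos_of_pos_of_nonneg h3 (scatter_diag_nonneg n x j)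
  positivity

theorem evidenceC_pos {α β : ℝ} (hα : 0 < α) (hβ : 0 < β) (n : ℕ)
    (x : ℕ → EuclideanSpace ℝ (Fin d)) : 0 < evidenceC α β n x := by
  rw [evidenceC_eq hα hβ]
  have h1 := Real.Gamma_pos_of_pos hα
  have h2 : 0 < Real.Gamma (α + n * d / 2) := Real.Gamma_pos_of_pos (by positivity)
  have h4 : 0 < β + (scatter n x).trace :=
    add_pos_of_pos_of_nonneg hβ (posSemidef_scatter n x).trace_nonneg
  positivity

/-- The powers of `π` inside the two multivariate gamma functions are equal and cancel. -/
theorem log_evidenceA {α : ℝ} {B : Matrix (Fin d) (Fin d) ℝ} (hα : ((d : ℝ) - 1) / 2 < α)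
    (hB : B.PosDef) (n : ℕ) (x : ℕ → EuclideanSpace ℝ (Fin d)) :
    Real.log (evidenceA α B n x) =
      α * Real.log B.det - ∑ j : Fin d, Real.log (Real.Gamma (α - j / 2)) -
        n * d / 2 * Real.log Real.pi +
        ∑ j : Fin d, Real.log (Real.Gamma (α - j / 2 + 1 / 2 * n)) -
        (α + n / 2) * Real.log (B + scatter n x).det := by
  have hn : (0 : ℝ) ≤ n := by positivity
  have hΓ (m : ℝ) (hm : 0 ≤ m) (j : Fin d) : 0 < Real.Gamma (α - j / 2 + m) := by
    refine Real.Gamma_pos_of_pos ?_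
    have : (j : ℝ) + 1 ≤ d := by exact_mod_cast j.isLt
    linarith
  have hΓ0 (j : Fin d) : 0 < Real.Gamma (α - j / 2) := by simpa using hΓ 0 le_rfl j
  have hlog (a : ℝ) (h : ∀ j : Fin d, 0 < Real.Gamma (a - j / 2)) :
      Real.log (multivariateGamma d a) = (d : ℝ) * ((d : ℝ) - 1) / 4 * Real.log Real.pi +
        ∑ j : Fin d, Real.log (Real.Gamma (a - j / 2)) := by
    rw [multivariateGamma, Real.log_mul (by positivity)
      (Finset.prod_ne_zero_iff.2 fun j _ => (h j).ne'), Real.log_rpow Real.pi_pos,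
      Real.log_prod fun j _ => (h j).ne']
  have h1 := multivariateGamma_pos hα
  have h2 : 0 < multivariateGamma d (α + n / 2) := multivariateGamma_pos (by linarith)
  have h3 := hB.det_pos
  have h4 := (hB.add_posSemidef (posSemidef_scatter n x)).det_pos
  have hrw (j : Fin d) : α + (n : ℝ) / 2 - j / 2 = α - j / 2 + 1 / 2 * n := by ring
  rw [evidenceA_eq hα hB, Real.log_mul (by positivity) (by positivity),
    Real.log_div (by positivity) (by positivity), Real.log_mul h1.ne' (by positivity),
    Real.log_mul h2.ne' (by positivity), Real.log_rpow h3, Real.log_rpow h4,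
    Real.log_rpow Real.pi_pos, hlog α hΓ0, hlog (α + n / 2) fun j => by
      rw [hrw]
      exact hΓ _ (by positivity) j]
  simp only [hrw]
  ring

theorem sum_fin_natCast (d : ℕ) : ∑ j : Fin d, (j : ℝ) = (d : ℝ) * ((d : ℝ) - 1) / 2 := by
  induction d with
  | zero => simp
  | succ d ih =>
    rw [Fin.sum_univ_castSucc]
    simp only [Fin.val_castSucc, Fin.val_last, ih]
    push_cast
    ring

/-- The `d` gamma functions contribute `∑_j (α - j/2 - 1/2) log n`, and `log det (B + s_n) = d log n
+ log det (V_n + B/n)` removes `dα log n`. What remains is `-d(d-1)/4 - d/2 = -d(d+1)/4`, minus half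
the number of parameters. The terms in `n log n` cancel. -/
theorem hasLaplaceExpansion_evidenceA {α : ℝ} {B : Matrix (Fin d) (Fin d) ℝ}
    (hα : ((d : ℝ) - 1) / 2 < α) (hB : B.PosDef) {x : ℕ → EuclideanSpace ℝ (Fin d)}
    {θ₀ : Sym2 (Fin d) → ℝ} (hθ : (symMatrix θ₀).PosDef)
    (hx : Tendsto (fun n => empirical n x) atTop (𝓝 θ₀)) :
    HasLaplaceExpansion d (d * (d + 1) / 2) (fun n => evidenceA α B n x)
      fun n => critA (empirical n x) := by
  obtain ⟨b, rfl⟩ := symMatrix_of_isHermitian hB.isHermitian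
  have hΓ : (fun n : ℕ => ∑ j : Fin d, (Real.log (Real.Gamma (α - j / 2 + 1 / 2 * n)) -
      (1 / 2 * n * Real.log (1 / 2 * n) - 1 / 2 * n +
        (α - j / 2 - 1 / 2) * Real.log n))) =O[atTop] (fun _ => (1 : ℝ)) :=
    IsBigO.fun_sum fun j _ => log_Gamma_add_mul_isBigO (α - (j : ℝ) / 2) (c := 1 / 2) (by norm_num)
  have hsum : ∑ j : Fin d, (α - (j : ℝ) / 2 - 1 / 2) =
      d * α - (d : ℝ) * ((d : ℝ) - 1) / 2 / 2 - d / 2 := by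
    rw [Finset.sum_sub_distrib, Finset.sum_sub_distrib, ← Finset.sum_div, sum_fin_natCast]
    simp only [Finset.sum_const, Finset.card_univ, Fintype.card_fin, nsmul_eq_mul]
    ring
  refine (hΓ.add (isBigO_crit_terms (contDiffAt_critA hθ) hx b α (α * Real.log (symMatrix b).det -
    ∑ j : Fin d, Real.log (Real.Gamma (α - j / 2))))).congr' ?_ EventuallyEq.rfl
  filter_upwards [eventually_gt_atTop 0] with n hn
  have hn' : (0 : ℝ) < n := by exact_mod_cast hn
  have hdet : Real.log (symMatrix b + scatter n x).det =
      d * Real.log n + critA (empirical n x + (n : ℝ)⁻¹ • b) := by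
    have hpd : (symMatrix b + scatter n x).PosDef := hB.add_posSemidef (posSemidef_scatter n x)
    rw [add_scatter_eq hn.ne'] at hpd ⊢
    have hpd' : (symMatrix (empirical n x + (n : ℝ)⁻¹ • b)).PosDef := by
      have := hpd.smul (inv_pos.2 hn')
      rwa [smul_smul, inv_mul_cancel₀ hn'.ne', one_smul] at this
    rw [log_det_smul hpd' hn', critA]
  rw [log_evidenceA hα hB, hdet, Finset.sum_sub_distrib, Finset.sum_add_distrib,
    ← Finset.sum_mul, hsum, Finset.sum_sub_distrib, one_div_mul_eq_div, Real.log_div hn'.ne' two_ne_zero]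
  simp only [Finset.sum_const, Finset.card_univ, Fintype.card_fin, nsmul_eq_mul, entropyRate]
  ring

theorem log_evidenceD {α : ℝ} {β : Fin d → ℝ} (hα : 0 < α) (hβ : ∀ j, 0 < β j) (n : ℕ)
    (x : ℕ → EuclideanSpace ℝ (Fin d)) :
    Real.log (evidenceD α β n x) = α * (∑ j, Real.log (β j)) - d * Real.log (Real.Gamma α) -
      n * d / 2 * Real.log Real.pi + d * Real.log (Real.Gamma (α + 1 / 2 * n)) -
        (α + n / 2) * ∑ j, Real.log (β j + scatter n x j j) := by
  have h1 := Real.Gamma_pos_of_pos hα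
  have h2 : 0 < Real.Gamma (α + n / 2) := Real.Gamma_pos_of_pos (by positivity)
  have h4 (j : Fin d) : 0 < β j + scatter n x j j :=
    add_pos_of_pos_of_nonneg (hβ j) (scatter_diag_nonneg n x j)
  have hterm (j : Fin d) : 0 < β j ^ α / (Real.Gamma α * Real.pi ^ ((n : ℝ) / 2)) *
      (Real.Gamma (α + n / 2) * (β j + scatter n x j j) ^ (-(α + n / 2))) := by
    have := hβ j
    have := h4 j
    positivity
  rw [evidenceD_eq hα hβ, Real.log_prod fun j _ => (hterm j).ne']
  have hlog (j : Fin d) : Real.log (β j ^ α / (Real.Gamma α * Real.pi ^ ((n : ℝ) / 2)) *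
      (Real.Gamma (α + n / 2) * (β j + scatter n x j j) ^ (-(α + n / 2)))) =
      α * Real.log (β j) - Real.log (Real.Gamma α) - n / 2 * Real.log Real.pi +
        Real.log (Real.Gamma (α + 1 / 2 * n)) -
        (α + n / 2) * Real.log (β j + scatter n x j j) := by
    have h3 := hβ j
    have h5 := h4 j
    rw [Real.log_mul (by positivity) (by positivity),
      Real.log_div (by positivity) (by positivity), Real.log_mul h1.ne' (by positivity),
      Real.log_mul h2.ne' (by positivity), Real.log_rpow h3, Real.log_rpow h5,
      Real.log_rpow Real.pi_pos, one_div_mul_eq_div]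
    ring
  simp only [hlog, Finset.sum_sub_distrib, Finset.sum_add_distrib, ← Finset.mul_sum,
    Finset.sum_const, Finset.card_univ, Fintype.card_fin, nsmul_eq_mul]
  ring

/-- Here the coefficient of `log n` is `d(α - 1/2) - dα = -d/2`. -/
theorem hasLaplaceExpansion_evidenceD {α : ℝ} {β : Fin d → ℝ} (hα : 0 < α) (hβ : ∀ j, 0 < β j)
    {x : ℕ → EuclideanSpace ℝ (Fin d)} {θ₀ : Sym2 (Fin d) → ℝ} (hθ : (symMatrix θ₀).PosDef)
    (hx : Tendsto (fun n => empirical n x) atTop (𝓝 θ₀)) :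
    HasLaplaceExpansion d d (fun n => evidenceD α β n x) fun n => critD (empirical n x) := by
  obtain ⟨b, hb⟩ := symMatrix_of_isHermitian (Matrix.PosDef.diagonal hβ).isHermitian
  have hΓ := (log_Gamma_add_mul_isBigO α (c := 1 / 2) (by norm_num)).const_mul_left (d : ℝ)
  refine (hΓ.add (isBigO_crit_terms (contDiffAt_critD hθ) hx b α (α * (∑ j, Real.log (β j)) -
    d * Real.log (Real.Gamma α)))).congr' ?_ EventuallyEq.rfl
  filter_upwards [eventually_gt_atTop 0] with n hn
  have hn' : (0 : ℝ) < n := by exact_mod_cast hn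
  have hsum : ∑ j, Real.log (β j + scatter n x j j) =
      d * Real.log n + critD (empirical n x + (n : ℝ)⁻¹ • b) := by
    have hterm (j : Fin d) : Real.log (β j + scatter n x j j) =
        Real.log n + Real.log ((empirical n x + (n : ℝ)⁻¹ • b) s(j, j)) := by
      have h1 : β j + scatter n x j j = n * (empirical n x + (n : ℝ)⁻¹ • b) s(j, j) := by
        have := congrFun (congrFun (add_scatter_eq hn.ne' x b) j) j
        rw [hb] at this
        simpa [symMatrix_apply] using this
      have hpos : 0 < β j + scatter n x j j :=
        add_pos_of_pos_of_nonneg (hβ j) (scatter_diag_nonneg n x j)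
      rw [h1] at hpos ⊢
      exact Real.log_mul hn'.ne' (pos_of_mul_pos_right hpos hn'.le).ne'
    simp only [hterm, critD, Finset.sum_add_distrib, Finset.sum_const, Finset.card_univ,
      Fintype.card_fin, nsmul_eq_mul]
  rw [log_evidenceD hα hβ, hsum, one_div_mul_eq_div, Real.log_div hn'.ne' two_ne_zero]
  simp only [entropyRate]
  ring

theorem log_evidenceC {α β : ℝ} (hα : 0 < α) (hβ : 0 < β) (n : ℕ)
    (x : ℕ → EuclideanSpace ℝ (Fin d)) :
    Real.log (evidenceC α β n x) = α * Real.log β - Real.log (Real.Gamma α) -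
      n * d / 2 * Real.log Real.pi + Real.log (Real.Gamma (α + d / 2 * n)) -
        (α + n * d / 2) * Real.log (β + (scatter n x).trace) := by
  have h1 := Real.Gamma_pos_of_pos hα
  have h2 : 0 < Real.Gamma (α + n * d / 2) := Real.Gamma_pos_of_pos (by positivity)
  have h4 : 0 < β + (scatter n x).trace :=
    add_pos_of_pos_of_nonneg hβ (posSemidef_scatter n x).trace_nonneg
  have hrw : α + (n : ℝ) * d / 2 = α + d / 2 * n := by ring
  rw [evidenceC_eq hα hβ, Real.log_mul (by positivity) (by positivity),
    Real.log_div (by positivity) (by positivity), Real.log_mul h1.ne' (by positivity),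
    Real.log_mul h2.ne' (by positivity), Real.log_rpow hβ, Real.log_rpow h4,
    Real.log_rpow Real.pi_pos, hrw]
  ring

/-- A single gamma function gives `(α - 1/2) - α = -1/2`. The terms `(nd/2) log d` from `Γ(α +
nd/2)` and from the trace, which is `d` times a mean, cancel. -/
theorem hasLaplaceExpansion_evidenceC (hd : 1 ≤ d) {α β : ℝ} (hα : 0 < α) (hβ : 0 < β)
    {x : ℕ → EuclideanSpace ℝ (Fin d)} {θ₀ : Sym2 (Fin d) → ℝ} (hθ : (symMatrix θ₀).PosDef)
    (hx : Tendsto (fun n => empirical n x) atTop (𝓝 θ₀)) :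
    HasLaplaceExpansion d 1 (fun n => evidenceC α β n x) fun n => critC (empirical n x) := by
  have hd0 : (0 : ℝ) < d := by exact_mod_cast hd
  -- The diagonal matrix with entries `β/d` has trace `β`, so the scalar rate acts as a shift of
  -- `s_n`.
  obtain ⟨b, hb⟩ := symMatrix_of_isHermitian
    (Matrix.isHermitian_diagonal fun _ : Fin d => β / d)
  have hΓ := log_Gamma_add_mul_isBigO α (c := d / 2) (by positivity)
  -- The coefficient is `α/d` because `critC` already carries the factor `d`.
  refine (hΓ.add (isBigO_crit_terms (contDiffAt_critC hd hθ) hx b (α / d) (α * Real.log β -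
    Real.log (Real.Gamma α) - α * Real.log d))).congr' ?_ EventuallyEq.rfl
  filter_upwards [eventually_gt_atTop 0] with n hn
  have hn' : (0 : ℝ) < n := by exact_mod_cast hn
  have hlog : Real.log (β + (scatter n x).trace) =
      Real.log n + Real.log d + critC (empirical n x + (n : ℝ)⁻¹ • b) / d := by
    have h1 : β + (scatter n x).trace =
        n * (d * ((∑ j, (empirical n x + (n : ℝ)⁻¹ • b) s(j, j)) / d)) := by
      have := congrArg Matrix.trace (add_scatter_eq hn.ne' x b)
      rw [hb, Matrix.trace_add, Matrix.trace_diagonal, Matrix.trace_smul, trace_symMatrix] at this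
      simp only [Finset.sum_const, Finset.card_univ, Fintype.card_fin, nsmul_eq_mul,
        smul_eq_mul] at this
      rw [mul_div_cancel₀ _ hd0.ne'] at this
      rw [mul_div_cancel₀ _ hd0.ne', this]
    have hpos : 0 < β + (scatter n x).trace :=
      add_pos_of_pos_of_nonneg hβ (posSemidef_scatter n x).trace_nonneg
    rw [h1] at hpos ⊢
    have h2 := pos_of_mul_pos_right hpos hn'.le
    have h3 := pos_of_mul_pos_right h2 hd0.le
    rw [Real.log_mul hn'.ne' h2.ne', Real.log_mul hd0.ne' h3.ne', critC,
      mul_div_cancel_left₀ _ hd0.ne', add_assoc]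
  have hdn : Real.log (d / 2 * n) = Real.log d - Real.log 2 + Real.log n := by
    rw [Real.log_mul (by positivity) hn'.ne', Real.log_div hd0.ne' two_ne_zero]
  rw [log_evidenceC hα hβ, hlog, hdn]
  simp only [entropyRate]
  field_simp
  ring

end Expansion

/-! ### Limits of evidence ratios along a fixed sequence of observations. -/

section Ratio

variable {p p' : ℝ} {E E' L L' : ℕ → ℝ}

theorem HasLaplaceExpansion.log_div (h : HasLaplaceExpansion d p E L)
    (h' : HasLaplaceExpansion d p' E' L') (hE : ∀ n, 0 < E n) (hE' : ∀ n, 0 < E' n) :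
    (fun n : ℕ => Real.log (E n / E' n) - (-((p - p') / 2) * Real.log n +
      n / 2 * (L' n - L n))) =O[atTop] (fun _ => (1 : ℝ)) := by
  refine (h.sub h').congr_left fun n => ?_
  rw [Real.log_div (hE n).ne' (hE' n).ne']
  ring

/-- After division by `n` both the bounded error and the term in `log n` vanish. -/
theorem HasLaplaceExpansion.tendsto_linear (h : HasLaplaceExpansion d p E L)
    (h' : HasLaplaceExpansion d p' E' L') (hE : ∀ n, 0 < E n) (hE' : ∀ n, 0 < E' n) {l l' : ℝ}
    (hL : Tendsto L atTop (𝓝 l)) (hL' : Tendsto L' atTop (𝓝 l')) :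
    Tendsto (fun n : ℕ => (n : ℝ)⁻¹ * Real.log (E n / E' n)) atTop (𝓝 (1 / 2 * (l' - l))) := by
  have hinv : (fun n : ℕ => (n : ℝ)⁻¹) =o[atTop] (fun _ => (1 : ℝ)) :=
    (isLittleO_one_iff ℝ).2 tendsto_inv_atTop_nhds_zero_nat
  have h1 := (isLittleO_one_iff ℝ).1
    (by simpa using hinv.mul_isBigO (h.log_div h' hE hE') :
      (fun n : ℕ => (n : ℝ)⁻¹ * (Real.log (E n / E' n) - (-((p - p') / 2) * Real.log n +
        n / 2 * (L' n - L n)))) =o[atTop] (fun _ => (1 : ℝ)))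
  have h2 : Tendsto (fun n : ℕ => -((p - p') / 2) * (Real.log n / n)) atTop (𝓝 0) := by
    have := (Real.isLittleO_log_id_atTop.tendsto_div_nhds_zero).comp tendsto_natCast_atTop_atTop
    simpa using this.const_mul (-((p - p') / 2))
  have h3 := (hL'.sub hL).const_mul (1 / 2)
  have h4 := (h1.add h2).add h3
  rw [zero_add, zero_add] at h4
  refine h4.congr' ?_
  filter_upwards [eventually_gt_atTop 0] with n hn
  have hn' : (0 : ℝ) < n := by exact_mod_cast hn
  field_simp
  ring

/-- If the two criteria differ by `o(log n / n)` along a subsequence, then the logarithm of the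
evidence ratio grows like `log n` along it. -/
theorem HasLaplaceExpansion.tendsto_log (h : HasLaplaceExpansion d p E L)
    (h' : HasLaplaceExpansion d p' E' L') (hE : ∀ n, 0 < E n) (hE' : ∀ n, 0 < E' n)
    {ns : ℕ → ℕ} (hns : Tendsto ns atTop atTop)
    (hL : Tendsto (fun i => (Real.log (ns i))⁻¹ * (ns i * (L' (ns i) - L (ns i)))) atTop (𝓝 0)) :
    Tendsto (fun i => (Real.log (ns i))⁻¹ * Real.log (E (ns i) / E' (ns i))) atTop
      (𝓝 (-((p - p') / 2))) := by
  have hlog : Tendsto (fun n : ℕ => Real.log n) atTop atTop :=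
    Real.tendsto_log_atTop.comp tendsto_natCast_atTop_atTop
  have hinv : (fun n : ℕ => (Real.log n)⁻¹) =o[atTop] (fun _ => (1 : ℝ)) :=
    (isLittleO_one_iff ℝ).2 hlog.inv_tendsto_atTop
  have h1 := ((isLittleO_one_iff ℝ).1
    (by simpa using hinv.mul_isBigO (h.log_div h' hE hE') :
      (fun n : ℕ => (Real.log n)⁻¹ * (Real.log (E n / E' n) - (-((p - p') / 2) * Real.log n +
        n / 2 * (L' n - L n)))) =o[atTop] (fun _ => (1 : ℝ)))).comp hns
  have h2 : Tendsto (fun _ : ℕ => -((p - p') / 2)) atTop (𝓝 (-((p - p') / 2))) :=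
    tendsto_const_nhds
  have h4 := (h1.add h2).add (hL.const_mul (1 / 2))
  rw [mul_zero, zero_add, add_zero] at h4
  refine h4.congr' ?_
  filter_upwards [hns.eventually (hlog.eventually_gt_atTop 0)] with i hi
  simp only [Function.comp_apply]
  field_simp
  ring

end Ratio

end CovSelection

namespace CovSelection

open Asymptotics Topology

variable {d : ℕ} {Ω : Type*} [MeasurableSpace Ω] {P : Measure Ω}
  {X : ℕ → Ω → EuclideanSpace ℝ (Fin d)} {ν : Measure (EuclideanSpace ℝ (Fin d))}
  {θ₀ : Sym2 (Fin d) → ℝ}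

/-! ### Measurability of the evidences in the sample, read off from the closed forms. -/

section Measurability

theorem measurable_coord_mul (j k : Fin d) :
    Measurable fun x : EuclideanSpace ℝ (Fin d) => x j * x k := by
  fun_prop

theorem aemeasurable_scatter (hX : ∀ i, AEMeasurable (X i) P) (n : ℕ) (j k : Fin d) :
    AEMeasurable (fun ω => scatter n (fun i => X i ω) j k) P := by
  simp only [scatter, Matrix.of_apply]
  exact Finset.aemeasurable_fun_sum _ fun i _ =>
    (measurable_coord_mul j k).comp_aemeasurable (hX i)

theorem aemeasurable_evidenceA (hX : ∀ i, AEMeasurable (X i) P) {α : ℝ}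
    {B : Matrix (Fin d) (Fin d) ℝ} (hα : ((d : ℝ) - 1) / 2 < α) (hB : B.PosDef) (n : ℕ) :
    AEMeasurable (fun ω => evidenceA α B n fun i => X i ω) P := by
  have hdet : AEMeasurable (fun ω => (B + scatter n fun i => X i ω).det) P := by
    simp only [Matrix.det_apply', Matrix.add_apply]
    exact Finset.aemeasurable_fun_sum _ fun σ _ => (Finset.aemeasurable_fun_prod _ fun i _ =>
      (aemeasurable_scatter hX n _ _).const_add _).const_mul _
  simp only [evidenceA_eq hα hB]
  exact ((hdet.pow_const _).const_mul _).const_mul _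

theorem aemeasurable_evidenceD (hX : ∀ i, AEMeasurable (X i) P) {α : ℝ} {β : Fin d → ℝ}
    (hα : 0 < α) (hβ : ∀ j, 0 < β j) (n : ℕ) :
    AEMeasurable (fun ω => evidenceD α β n fun i => X i ω) P := by
  simp only [evidenceD_eq hα hβ]
  exact Finset.aemeasurable_fun_prod _ fun j _ =>
    ((((aemeasurable_scatter hX n j j).const_add _).pow_const _).const_mul _).const_mul _

theorem aemeasurable_evidenceC (hX : ∀ i, AEMeasurable (X i) P) {α β : ℝ}
    (hα : 0 < α) (hβ : 0 < β) (n : ℕ) :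
    AEMeasurable (fun ω => evidenceC (d := d) α β n fun i => X i ω) P := by
  simp only [evidenceC_eq hα hβ, Matrix.trace, Matrix.diag_apply]
  exact ((((Finset.aemeasurable_fun_sum _ fun j _ =>
    aemeasurable_scatter hX n j j).const_add _).pow_const _).const_mul _).const_mul _

theorem aemeasurable_empirical (hX : ∀ i, AEMeasurable (X i) P) (n : ℕ) (z : Sym2 (Fin d)) :
    AEMeasurable (fun ω => empirical n (fun i => X i ω) z) P := by
  induction z with
  | h j k => exact (aemeasurable_scatter hX n j k).div_const _

end Measurability

/-! ### Law of large numbers and mean square error of the empirical second moments. -/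

section Moments

theorem hasSecondMoment_of_law {Y : Ω → EuclideanSpace ℝ (Fin d)} (hY : HasLaw Y ν P)
    {V : Matrix (Fin d) (Fin d) ℝ} (h2 : MemLp id 2 ν)
    (hV : ∀ j k, ∫ x, x j * x k ∂ν = V j k) : HasSecondMoment P Y V := by
  refine ⟨?_, fun j k => ?_⟩
  · rw [← hY.map_eq] at h2
    exact h2.comp_of_map hY.aemeasurable
  · rw [← hV j k, ← hY.map_eq, integral_map hY.aemeasurable
      (measurable_coord_mul j k).aestronglyMeasurable]

theorem memLp_coord {Y : Ω → EuclideanSpace ℝ (Fin d)} {p : ENNReal} (hY : MemLp Y p P)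
    (j : Fin d) : MemLp (fun ω => Y ω j) p P :=
  (EuclideanSpace.proj (𝕜 := ℝ) j).comp_memLp' hY

theorem integrable_coord_mul {Y : Ω → EuclideanSpace ℝ (Fin d)} (hY : MemLp Y 2 P)
    (j k : Fin d) : Integrable (fun ω => Y ω j * Y ω k) P :=
  (memLp_coord hY j).integrable_mul (memLp_coord hY k)

theorem memLp_coord_mul {Y : Ω → EuclideanSpace ℝ (Fin d)} (hY : MemLp Y 4 P)
    (j k : Fin d) : MemLp (fun ω => Y ω j * Y ω k) 2 P := by
  -- Hölder with `1/4 + 1/4 = 1/2`: fourth moments of the observations are second moments of the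
  -- products.
  have : ENNReal.HolderTriple 4 4 2 := ⟨by
    rw [← two_mul, show (4 : ENNReal) = 2 * 2 by norm_num,
      ENNReal.mul_inv (by simp) (by simp), ← mul_assoc,
      ENNReal.mul_inv_cancel (by simp) (by simp), one_mul]⟩
  exact (memLp_coord hY k).mul' (memLp_coord hY j)

theorem IsIID.pairwise_indepFun (h : IsIID P X ν) (j k : Fin d) :
    Pairwise fun a b => IndepFun (fun ω => X a ω j * X a ω k) (fun ω => X b ω j * X b ω k) P :=
  fun _ _ hab => (h.indep.indepFun hab).comp (measurable_coord_mul j k) (measurable_coord_mul j k)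

theorem IsIID.identDistrib (h : IsIID P X ν) (j k : Fin d) (i : ℕ) :
    IdentDistrib (fun ω => X i ω j * X i ω k) (fun ω => X 0 ω j * X 0 ω k) P P :=
  IdentDistrib.comp ⟨(h.law i).aemeasurable, (h.law 0).aemeasurable,
    by rw [(h.law i).map_eq, (h.law 0).map_eq]⟩ (measurable_coord_mul j k)

/-- The law of large numbers for the second moments. -/
theorem IsIID.tendsto_empirical (h : IsIID P X ν)
    (hm : HasSecondMoment P (X 0) (symMatrix θ₀)) :
    ∀ᵐ ω ∂P, Tendsto (fun n => empirical n fun i => X i ω) atTop (𝓝 θ₀) := by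
  have key (z : Sym2 (Fin d)) : ∀ᵐ ω ∂P,
      Tendsto (fun n => empirical n (fun i => X i ω) z) atTop (𝓝 (θ₀ z)) := by
    induction z with
    | h j k =>
      have hlaw := strong_law_ae_real (fun i ω => X i ω j * X i ω k)
        (integrable_coord_mul hm.1 j k) (h.pairwise_indepFun j k) (h.identDistrib j k)
      rw [hm.2 j k] at hlaw
      exact hlaw
  filter_upwards [ae_all_iff.2 key] with ω hω
  exact tendsto_pi_nhds.2 hω

/-- The variance of a mean of `n` pairwise independent copies is `1/n` times the common variance, so
the expectation does not depend on `n`. -/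
theorem IsIID.integral_natCast_mul_sq [IsProbabilityMeasure P] (h : IsIID P X ν)
    (h4 : ∀ i, MemLp (X i) 4 P) (hm : HasSecondMoment P (X 0) (symMatrix θ₀))
    {n : ℕ} (hn : n ≠ 0) (j k : Fin d) :
    Integrable (fun ω => (n : ℝ) * (empirical n (fun i => X i ω) s(j, k) - θ₀ s(j, k)) ^ 2) P ∧
    ∫ ω, (n : ℝ) * (empirical n (fun i => X i ω) s(j, k) - θ₀ s(j, k)) ^ 2 ∂P =
      Var[fun ω => X 0 ω j * X 0 ω k; P] := by
  have hn' : (n : ℝ) ≠ 0 := by exact_mod_cast hn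
  have hL2 (i : ℕ) : MemLp (fun ω => X i ω j * X i ω k) 2 P := memLp_coord_mul (h4 i) j k
  set S : Ω → ℝ := ∑ i ∈ Finset.range n, fun ω => X i ω j * X i ω k with hS
  have hSL2 : MemLp S 2 P := memLp_finsetSum' _ fun i _ => hL2 i
  have hmean : ∫ ω, S ω ∂P = n * θ₀ s(j, k) := by
    simp only [hS, Finset.sum_apply]
    rw [integral_finsetSum _ fun i _ => (hL2 i).integrable (by norm_num)]
    have (i : ℕ) : ∫ ω, X i ω j * X i ω k ∂P = θ₀ s(j, k) := by
      rw [(h.identDistrib j k i).integral_eq, hm.2 j k]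
      rfl
    simp [this]
  have hvar : Var[S; P] = n * Var[fun ω => X 0 ω j * X 0 ω k; P] := by
    rw [hS, IndepFun.variance_sum (fun i _ => hL2 i)
      fun a _ b _ hab => h.pairwise_indepFun j k hab]
    simp [(h.identDistrib j k _).variance_eq]
  have heq (ω : Ω) : (n : ℝ) * (empirical n (fun i => X i ω) s(j, k) - θ₀ s(j, k)) ^ 2 =
      (n : ℝ)⁻¹ * (S ω - ∫ ω, S ω ∂P) ^ 2 := by
    rw [hmean, empirical_mk, hS, Finset.sum_apply]
    field_simp
  simp only [heq]
  refine ⟨((hSL2.sub (memLp_const _)).integrable_sq).const_mul _, ?_⟩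
  rw [integral_const_mul, ← variance_eq_integral hSL2.aestronglyMeasurable.aemeasurable, hvar,
    inv_mul_cancel_left₀ hn']

/-- The squared error of the empirical second moments is `o(log n / n)` in probability. -/
theorem IsIID.tendstoInMeasure_sq [IsProbabilityMeasure P] (h : IsIID P X ν)
    (h4 : ∀ i, MemLp (X i) 4 P) (hm : HasSecondMoment P (X 0) (symMatrix θ₀)) :
    TendstoInMeasure P (fun (n : ℕ) ω => (Real.log n)⁻¹ *
      ∑ z, (n : ℝ) * (empirical n (fun i => X i ω) z - θ₀ z) ^ 2) atTop fun _ => 0 := by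
  have hX (i : ℕ) : AEMeasurable (X i) P := (h.law i).aemeasurable
  obtain ⟨σ, hσ⟩ : ∃ σ : Sym2 (Fin d) → ℝ, ∀ (z : Sym2 (Fin d)) (n : ℕ), n ≠ 0 →
      Integrable (fun ω => (n : ℝ) * (empirical n (fun i => X i ω) z - θ₀ z) ^ 2) P ∧
      ∫ ω, (n : ℝ) * (empirical n (fun i => X i ω) z - θ₀ z) ^ 2 ∂P = σ z := by
    have (z : Sym2 (Fin d)) : ∃ c : ℝ, ∀ n : ℕ, n ≠ 0 →
        Integrable (fun ω => (n : ℝ) * (empirical n (fun i => X i ω) z - θ₀ z) ^ 2) P ∧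
        ∫ ω, (n : ℝ) * (empirical n (fun i => X i ω) z - θ₀ z) ^ 2 ∂P = c := by
      induction z with
      | h j k => exact ⟨_, fun n hn => h.integral_natCast_mul_sq h4 hm hn j k⟩
    choose σ hσ using this
    exact ⟨σ, hσ⟩
  -- Convergence holds even in `L¹`: the expectation of the sum is the same for all `n ≥ 1`, and it
  -- is divided by `log n`.
  refine tendstoInMeasure_of_tendsto_eLpNorm one_ne_zero (fun n => ?_)
    aestronglyMeasurable_const ?_
  · exact ((Finset.aemeasurable_fun_sum _ fun z _ => (((aemeasurable_empirical hX n z).sub_const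
      _).pow_const _).const_mul _).const_mul _).aestronglyMeasurable
  · have hlog : Tendsto (fun n : ℕ => ENNReal.ofReal ((Real.log n)⁻¹ * ∑ z, σ z)) atTop
        (𝓝 0) := by
      have h1 : Tendsto (fun n : ℕ => (Real.log n)⁻¹ * ∑ z, σ z) atTop (𝓝 0) := by
        simpa using ((Real.tendsto_log_atTop.comp
          tendsto_natCast_atTop_atTop).inv_tendsto_atTop).mul_const (∑ z, σ z)
      simpa using ENNReal.tendsto_ofReal h1
    refine hlog.congr' ?_
    filter_upwards [eventually_gt_atTop 0] with n hn
    have hint : Integrable (fun ω => (Real.log n)⁻¹ *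
        ∑ z, (n : ℝ) * (empirical n (fun i => X i ω) z - θ₀ z) ^ 2) P :=
      (integrable_finsetSum _ fun z _ => (hσ z n hn.ne').1).const_mul _
    have h0 : 0 ≤ Real.log n := Real.log_natCast_nonneg n
    have hfun : ((fun ω => (Real.log n)⁻¹ *
        ∑ z, (n : ℝ) * (empirical n (fun i => X i ω) z - θ₀ z) ^ 2) - fun _ => 0) =
        fun ω => (Real.log n)⁻¹ *
          ∑ z, (n : ℝ) * (empirical n (fun i => X i ω) z - θ₀ z) ^ 2 := by
      ext ω
      simp
    rw [hfun, eLpNorm_one_eq_lintegral_enorm, ← ofReal_integral_norm_eq_lintegral_enorm hint]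
    congr 1
    have hnorm (ω : Ω) : ‖(Real.log n)⁻¹ *
        ∑ z, (n : ℝ) * (empirical n (fun i => X i ω) z - θ₀ z) ^ 2‖ = (Real.log n)⁻¹ *
        ∑ z, (n : ℝ) * (empirical n (fun i => X i ω) z - θ₀ z) ^ 2 :=
      Real.norm_of_nonneg (mul_nonneg (inv_nonneg.2 h0)
        (Finset.sum_nonneg fun z _ => by positivity))
    simp only [hnorm]
    rw [integral_const_mul, integral_finsetSum _ fun z _ => (hσ z n hn.ne').1]
    simp only [(hσ _ n hn.ne').2]

theorem norm_sq_le_sum_sq {ι : Type*} [Fintype ι] (u : ι → ℝ) : ‖u‖ ^ 2 ≤ ∑ i, u i ^ 2 := by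
  have hs : 0 ≤ ∑ i, u i ^ 2 := Finset.sum_nonneg fun i _ => sq_nonneg _
  have h : ‖u‖ ≤ √(∑ i, u i ^ 2) := by
    refine (pi_norm_le_iff_of_nonneg (Real.sqrt_nonneg _)).2 fun i => ?_
    rw [Real.norm_eq_abs, ← Real.sqrt_sq_eq_abs]
    exact Real.sqrt_le_sqrt (Finset.single_le_sum (f := fun i => u i ^ 2)
      (fun i _ => sq_nonneg _) (Finset.mem_univ i))
  calc ‖u‖ ^ 2 ≤ √(∑ i, u i ^ 2) ^ 2 := by gcongr
    _ = _ := Real.sq_sqrt hs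

end Moments

/-! ### Limits in probability. -/

section Limits

variable {p p' : ℝ} {f f' : (Sym2 (Fin d) → ℝ) → ℝ}
  {E E' : ℕ → (ℕ → EuclideanSpace ℝ (Fin d)) → ℝ}

/-- A model whose evidence is positive, measurable in the sample, and has a Laplace expansion with
`p` parameters and criterion `f` whenever the empirical second moments converge to `θ₀`. -/
structure IsRegularModel (P : Measure Ω) (X : ℕ → Ω → EuclideanSpace ℝ (Fin d))
    (θ₀ : Sym2 (Fin d) → ℝ) (p : ℝ) (f : (Sym2 (Fin d) → ℝ) → ℝ)
    (E : ℕ → (ℕ → EuclideanSpace ℝ (Fin d)) → ℝ) : Prop where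
  pos : ∀ n x, 0 < E n x
  aemeasurable : ∀ n, AEMeasurable (fun ω => E n fun i => X i ω) P
  expansion : ∀ x, Tendsto (fun n => empirical n x) atTop (𝓝 θ₀) →
    HasLaplaceExpansion d p (fun n => E n x) fun n => f (empirical n x)
  continuousAt : ContinuousAt f θ₀

theorem isRegularModel_evidenceA (hX : ∀ i, AEMeasurable (X i) P)
    (hθ : (symMatrix θ₀).PosDef) {α : ℝ} {B : Matrix (Fin d) (Fin d) ℝ}
    (hα : ((d : ℝ) - 1) / 2 < α) (hB : B.PosDef) :
    IsRegularModel P X θ₀ (d * (d + 1) / 2) critA (evidenceA α B) where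
  pos := evidenceA_pos hα hB
  aemeasurable := aemeasurable_evidenceA hX hα hB
  expansion _ hx := hasLaplaceExpansion_evidenceA hα hB hθ hx
  continuousAt := (contDiffAt_critA (m := 0) hθ).continuousAt

theorem isRegularModel_evidenceD (hX : ∀ i, AEMeasurable (X i) P)
    (hθ : (symMatrix θ₀).PosDef) {α : ℝ} {β : Fin d → ℝ} (hα : 0 < α) (hβ : ∀ j, 0 < β j) :
    IsRegularModel P X θ₀ d critD (evidenceD α β) where
  pos := evidenceD_pos hα hβ
  aemeasurable := aemeasurable_evidenceD hX hα hβ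
  expansion _ hx := hasLaplaceExpansion_evidenceD hα hβ hθ hx
  continuousAt := (contDiffAt_critD (m := 0) hθ).continuousAt

theorem isRegularModel_evidenceC (hd : 1 ≤ d) (hX : ∀ i, AEMeasurable (X i) P)
    (hθ : (symMatrix θ₀).PosDef) {α β : ℝ} (hα : 0 < α) (hβ : 0 < β) :
    IsRegularModel P X θ₀ 1 critC (evidenceC α β) where
  pos := evidenceC_pos hα hβ
  aemeasurable := aemeasurable_evidenceC hX hα hβ
  expansion _ hx := hasLaplaceExpansion_evidenceC hd hα hβ hθ hx
  continuousAt := (contDiffAt_critC (m := 0) hd hθ).continuousAt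

/-- On the almost sure event of the law of large numbers the deterministic expansion applies; almost
sure convergence implies convergence in probability. -/
theorem IsRegularModel.tendstoInMeasure_linear [IsProbabilityMeasure P]
    (h : IsRegularModel P X θ₀ p f E) (h' : IsRegularModel P X θ₀ p' f' E')
    (hx : ∀ᵐ ω ∂P, Tendsto (fun n => empirical n fun i => X i ω) atTop (𝓝 θ₀)) :
    TendstoInMeasure P (fun (n : ℕ) ω => (n : ℝ)⁻¹ *
      Real.log (E n (fun i => X i ω) / E' n (fun i => X i ω))) atTop
      fun _ => 1 / 2 * (f' θ₀ - f θ₀) := by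
  refine tendstoInMeasure_of_tendsto_ae (fun n => ?_) ?_
  · exact (((h.aemeasurable n).div (h'.aemeasurable n)).log.const_mul _).aestronglyMeasurable
  · filter_upwards [hx] with ω hω
    exact (h.expansion _ hω).tendsto_linear (h'.expansion _ hω) (fun n => h.pos n _)
      (fun n => h'.pos n _) (h.continuousAt.tendsto.comp hω) (h'.continuousAt.tendsto.comp hω)

theorem IsRegularModel.tendstoInMeasure_log [IsProbabilityMeasure P]
    (h : IsRegularModel P X θ₀ p f E) (h' : IsRegularModel P X θ₀ p' f' E')
    (hquad : (fun θ => f' θ - f θ) =O[𝓝 θ₀] fun θ => ‖θ - θ₀‖ ^ 2)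
    (hx : ∀ᵐ ω ∂P, Tendsto (fun n => empirical n fun i => X i ω) atTop (𝓝 θ₀))
    (hsq : TendstoInMeasure P (fun (n : ℕ) ω => (Real.log n)⁻¹ *
      ∑ z, (n : ℝ) * (empirical n (fun i => X i ω) z - θ₀ z) ^ 2) atTop fun _ => 0) :
    TendstoInMeasure P (fun (n : ℕ) ω => (Real.log n)⁻¹ *
      Real.log (E n (fun i => X i ω) / E' n (fun i => X i ω))) atTop
      fun _ => -((p - p') / 2) := by
  -- The squared error is controlled only in probability, while the expansion is pathwise. By the
  -- subsequence criterion it suffices to extract from each subsequence a further one along which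
  -- the squared error is `o(log n / n)` almost surely.
  refine (exists_seq_tendstoInMeasure_atTop_iff fun n =>
    (((h.aemeasurable n).div (h'.aemeasurable n)).log.const_mul _).aestronglyMeasurable).2
    fun ns hns => ?_
  obtain ⟨ns', hns', hae⟩ := (hsq.comp hns.tendsto_atTop).exists_seq_tendsto_ae
  refine ⟨ns', hns', ?_⟩
  filter_upwards [hx, hae] with ω hω hQ
  have hcomp : Tendsto (fun i => ns (ns' i)) atTop atTop :=
    hns.tendsto_atTop.comp hns'.tendsto_atTop
  refine (h.expansion _ hω).tendsto_log (h'.expansion _ hω) (fun n => h.pos n _)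
    (fun n => h'.pos n _) hcomp ?_
  have h1 := hquad.comp_tendsto (hω.comp hcomp)
  have h2 : (fun i => f' (empirical (ns (ns' i)) fun i => X i ω) -
      f (empirical (ns (ns' i)) fun i => X i ω)) =O[atTop]
      fun i => ∑ z, (empirical (ns (ns' i)) (fun i => X i ω) z - θ₀ z) ^ 2 := by
    refine h1.trans (IsBigO.of_bound 1 (Eventually.of_forall fun i => ?_))
    rw [one_mul, Real.norm_of_nonneg (by simp only [Function.comp_apply]; positivity),
      Real.norm_of_nonneg (Finset.sum_nonneg fun z _ => sq_nonneg _)]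
    exact norm_sq_le_sum_sq _
  have h3 := (isBigO_refl (fun i => (Real.log (ns (ns' i)))⁻¹) atTop).mul
    ((isBigO_refl (fun i => (ns (ns' i) : ℝ)) atTop).mul h2)
  refine h3.trans_tendsto (hQ.congr fun i => ?_)
  rw [Finset.mul_sum]
  rfl

theorem IsIID.aemeasurable (h : IsIID P X ν) (i : ℕ) : AEMeasurable (X i) P :=
  (h.law i).aemeasurable

theorem critD_eq {V : Matrix (Fin d) (Fin d) ℝ} (hV : symMatrix θ₀ = V) :
    critD θ₀ = ∑ j, Real.log (V j j) := by
  rw [← hV]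
  rfl

theorem critC_eq {V : Matrix (Fin d) (Fin d) ℝ} (hV : symMatrix θ₀ = V) :
    critC θ₀ = d * Real.log (V.trace / d) := by
  rw [← hV]
  rfl

variable {V : Matrix (Fin d) (Fin d) ℝ} {αA : ℝ} {B : Matrix (Fin d) (Fin d) ℝ} {αD : ℝ}
  {β : Fin d → ℝ} {αC βC : ℝ}

theorem IsIID.tendstoInMeasure_linear_A_D [IsProbabilityMeasure P] (h : IsIID P X ν)
    (hV : V.PosDef) (hm : HasSecondMoment P (X 0) V) (hαA : ((d : ℝ) - 1) / 2 < αA)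
    (hB : B.PosDef) (hαD : 0 < αD) (hβ : ∀ j, 0 < β j) :
    TendstoInMeasure P (fun (n : ℕ) ω => (n : ℝ)⁻¹ *
      Real.log (evidenceA αA B n (fun i => X i ω) / evidenceD αD β n (fun i => X i ω))) atTop
      fun _ => halfLogHadamard V := by
  obtain ⟨θ₀, rfl⟩ := symMatrix_of_isHermitian hV.isHermitian
  have hlim : halfLogHadamard (symMatrix θ₀) = 1 / 2 * (critD θ₀ - critA θ₀) := by
    rw [halfLogHadamard_eq hV, critD_eq rfl, critA]
  rw [hlim]
  exact (isRegularModel_evidenceA h.aemeasurable hV hαA hB).tendstoInMeasure_linear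
    (isRegularModel_evidenceD h.aemeasurable hV hαD hβ) (h.tendsto_empirical hm)

theorem IsIID.tendstoInMeasure_linear_A_C [IsProbabilityMeasure P] (hd : 1 ≤ d)
    (h : IsIID P X ν) (hV : V.PosDef) (hm : HasSecondMoment P (X 0) V)
    (hαA : ((d : ℝ) - 1) / 2 < αA) (hB : B.PosDef) (hαC : 0 < αC) (hβC : 0 < βC) :
    TendstoInMeasure P (fun (n : ℕ) ω => (n : ℝ)⁻¹ *
      Real.log (evidenceA αA B n (fun i => X i ω) / evidenceC αC βC n (fun i => X i ω))) atTop
      fun _ => logMeanRatio V := by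
  obtain ⟨θ₀, rfl⟩ := symMatrix_of_isHermitian hV.isHermitian
  have hlim : logMeanRatio (symMatrix θ₀) = 1 / 2 * (critC θ₀ - critA θ₀) := by
    rw [logMeanRatio_eq hd hV, critC_eq rfl, critA]
  rw [hlim]
  exact (isRegularModel_evidenceA h.aemeasurable hV hαA hB).tendstoInMeasure_linear
    (isRegularModel_evidenceC hd h.aemeasurable hV hαC hβC) (h.tendsto_empirical hm)

theorem logMeanRatio_diagonal (v : Fin d → ℝ) : logMeanRatio (Matrix.diagonal v) =
    (d : ℝ) / 2 * Real.log (((∑ j, v j) / d) / (∏ j, v j) ^ (1 / (d : ℝ))) := by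
  rw [logMeanRatio, Matrix.trace_diagonal, Matrix.det_diagonal]

theorem IsIID.tendstoInMeasure_linear_D_C [IsProbabilityMeasure P] (hd : 1 ≤ d)
    (h : IsIID P X ν) {v : Fin d → ℝ} (hv : ∀ j, 0 < v j)
    (hm : HasSecondMoment P (X 0) (Matrix.diagonal v))
    (hαD : 0 < αD) (hβ : ∀ j, 0 < β j) (hαC : 0 < αC) (hβC : 0 < βC) :
    TendstoInMeasure P (fun (n : ℕ) ω => (n : ℝ)⁻¹ *
      Real.log (evidenceD αD β n (fun i => X i ω) / evidenceC αC βC n (fun i => X i ω))) atTop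
      fun _ => (d : ℝ) / 2 * Real.log (((∑ j, v j) / d) / (∏ j, v j) ^ (1 / (d : ℝ))) := by
  have hV := Matrix.PosDef.diagonal hv
  rw [← logMeanRatio_diagonal, logMeanRatio_eq hd hV]
  obtain ⟨θ₀, hθ⟩ := symMatrix_of_isHermitian hV.isHermitian
  have hcD : critD θ₀ = Real.log (Matrix.diagonal v).det := by
    rw [critD_eq hθ, Matrix.det_diagonal, Real.log_prod fun j _ => (hv j).ne']
    simp
  rw [← critC_eq hθ, ← hcD]
  rw [← hθ] at hV hm
  exact (isRegularModel_evidenceD h.aemeasurable hV hαD hβ).tendstoInMeasure_linear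
    (isRegularModel_evidenceC hd h.aemeasurable hV hαC hβC) (h.tendsto_empirical hm)

theorem logMeanRatio_diagonal_pos (hd : 1 ≤ d) {v : Fin d → ℝ} (hv : ∀ j, 0 < v j)
    (hne : ¬ ∃ c, ∀ j, v j = c) :
    0 < (d : ℝ) / 2 * Real.log (((∑ j, v j) / d) / (∏ j, v j) ^ (1 / (d : ℝ))) := by
  rw [← logMeanRatio_diagonal]
  refine logMeanRatio_pos hd (Matrix.PosDef.diagonal hv) ?_
  rintro ⟨c, hc⟩
  refine hne ⟨c, fun j => ?_⟩
  simpa using congrFun (congrFun hc j) j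

theorem IsIID.tendstoInMeasure_log_A_D [IsProbabilityMeasure P] (h : IsIID P X ν)
    {v : Fin d → ℝ} (hv : ∀ j, 0 < v j) (hm : HasSecondMoment P (X 0) (Matrix.diagonal v))
    (h4 : ∀ i, MemLp (X i) 4 P) (hαA : ((d : ℝ) - 1) / 2 < αA) (hB : B.PosDef)
    (hαD : 0 < αD) (hβ : ∀ j, 0 < β j) :
    TendstoInMeasure P (fun (n : ℕ) ω => (Real.log n)⁻¹ *
      Real.log (evidenceA αA B n (fun i => X i ω) / evidenceD αD β n (fun i => X i ω))) atTop
      fun _ => -(((d : ℝ) * ((d : ℝ) + 1) / 2 - d) / 2) := by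
  have hV := Matrix.PosDef.diagonal hv
  obtain ⟨θ₀, hθ⟩ := symMatrix_of_isHermitian hV.isHermitian
  rw [← hθ] at hV hm
  exact (isRegularModel_evidenceA h.aemeasurable hV hαA hB).tendstoInMeasure_log
    (isRegularModel_evidenceD h.aemeasurable hV hαD hβ)
    (critD_sub_critA_isBigO hV (hθ ▸ Matrix.isDiag_diagonal v))
    (h.tendsto_empirical hm) (h.tendstoInMeasure_sq h4 hm)

theorem IsIID.tendstoInMeasure_log_D_C [IsProbabilityMeasure P] (hd : 1 ≤ d) (h : IsIID P X ν)
    {v : ℝ} (hv : 0 < v) (hm : HasSecondMoment P (X 0) (Matrix.diagonal fun _ => v))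
    (h4 : ∀ i, MemLp (X i) 4 P) (hαD : 0 < αD) (hβ : ∀ j, 0 < β j) (hαC : 0 < αC)
    (hβC : 0 < βC) :
    TendstoInMeasure P (fun (n : ℕ) ω => (Real.log n)⁻¹ *
      Real.log (evidenceD αD β n (fun i => X i ω) / evidenceC αC βC n (fun i => X i ω))) atTop
      fun _ => -(((d : ℝ) - 1) / 2) := by
  have hV := Matrix.PosDef.diagonal fun _ : Fin d => hv
  obtain ⟨θ₀, hθ⟩ := symMatrix_of_isHermitian hV.isHermitian
  have hdiag (j : Fin d) : θ₀ s(j, j) = v := by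
    rw [← symMatrix_apply θ₀, hθ, Matrix.diagonal_apply_eq]
  rw [← hθ] at hV hm
  exact (isRegularModel_evidenceD h.aemeasurable hV hαD hβ).tendstoInMeasure_log
    (isRegularModel_evidenceC hd h.aemeasurable hV hαC hβC)
    (critC_sub_critD_isBigO hd hV hdiag)
    (h.tendsto_empirical hm) (h.tendstoInMeasure_sq h4 hm)

theorem IsIID.tendstoInMeasure_log_A_C [IsProbabilityMeasure P] (hd : 1 ≤ d) (h : IsIID P X ν)
    {v : ℝ} (hv : 0 < v) (hm : HasSecondMoment P (X 0) (Matrix.diagonal fun _ => v))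
    (h4 : ∀ i, MemLp (X i) 4 P) (hαA : ((d : ℝ) - 1) / 2 < αA) (hB : B.PosDef) (hαC : 0 < αC)
    (hβC : 0 < βC) :
    TendstoInMeasure P (fun (n : ℕ) ω => (Real.log n)⁻¹ *
      Real.log (evidenceA αA B n (fun i => X i ω) / evidenceC αC βC n (fun i => X i ω))) atTop
      fun _ => -(((d : ℝ) * ((d : ℝ) + 1) / 2 - 1) / 2) := by
  have hV := Matrix.PosDef.diagonal fun _ : Fin d => hv
  obtain ⟨θ₀, hθ⟩ := symMatrix_of_isHermitian hV.isHermitian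
  have hdiag (j : Fin d) : θ₀ s(j, j) = v := by
    rw [← symMatrix_apply θ₀, hθ, Matrix.diagonal_apply_eq]
  rw [← hθ] at hV hm
  -- The gap between `C` and `A` is the sum of the gaps between `C` and `D` and between `D` and `A`,
  -- each quadratically small.
  have hquad := (critC_sub_critD_isBigO hd hV hdiag).add
    (critD_sub_critA_isBigO hV (hθ ▸ Matrix.isDiag_diagonal fun _ => v))
  simp only [sub_add_sub_cancel] at hquad
  exact (isRegularModel_evidenceA h.aemeasurable hV hαA hB).tendstoInMeasure_log
    (isRegularModel_evidenceC hd h.aemeasurable hV hαC hβC) hquad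
    (h.tendsto_empirical hm) (h.tendstoInMeasure_sq h4 hm)

end Limits

/-! ### Moments of Gaussian observations. -/

section Gaussian

theorem IsIID.memLp_gaussianLaw {H : Matrix (Fin d) (Fin d) ℝ} (h : IsIID P X (gaussianLaw H))
    {p : ENNReal} (hp : p ≠ ⊤) (i : ℕ) : MemLp (X i) p P := by
  have h2 : MemLp id p (gaussianLaw H) := IsGaussian.memLp_id (multivariateGaussian _ _) p hp
  rw [← (h.law i).map_eq] at h2
  exact h2.comp_of_map (h.law i).aemeasurable

theorem integral_coord_mul_multivariateGaussian {S : Matrix (Fin d) (Fin d) ℝ}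
    (hS : S.PosSemidef) (j k : Fin d) :
    ∫ x, x j * x k ∂(multivariateGaussian 0 S) = S j k := by
  have hid : MemLp (fun x : EuclideanSpace ℝ (Fin d) => x) 2 (multivariateGaussian 0 S) :=
    IsGaussian.memLp_two_id
  have hmean : ∫ x, x j ∂(multivariateGaussian 0 S) = 0 := by
    have h := (EuclideanSpace.proj (𝕜 := ℝ) j).integral_comp_comm
      (hid.integrable (by norm_num))
    rw [integral_id_multivariateGaussian] at h
    simpa using h
  have h := covariance_eval_multivariateGaussian (μ := 0) hS j k
  rw [covariance_eq_sub (memLp_coord hid j) (memLp_coord hid k), hmean, zero_mul, sub_zero] at h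
  exact h

theorem IsIID.hasSecondMoment_gaussianLaw {H : Matrix (Fin d) (Fin d) ℝ} (hH : H.PosDef)
    (h : IsIID P X (gaussianLaw H)) (i : ℕ) : HasSecondMoment P (X i) ((2 : ℝ) • H)⁻¹ :=
  hasSecondMoment_of_law (h.law i) (IsGaussian.memLp_id (multivariateGaussian _ _) 2 (by simp))
    (integral_coord_mul_multivariateGaussian (hH.smul two_pos).inv.posSemidef)

theorem inv_two_smul_diagonal {η : Fin d → ℝ} (hη : ∀ j, 0 < η j) :
    ((2 : ℝ) • Matrix.diagonal η)⁻¹ = Matrix.diagonal fun j => (2 * η j)⁻¹ := by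
  refine Matrix.inv_eq_right_inv ?_
  rw [Matrix.smul_mul, Matrix.diagonal_mul_diagonal, ← Matrix.diagonal_smul,
    ← Matrix.diagonal_one]
  congr 1
  ext j
  have := hη j
  simp only [Pi.smul_apply, smul_eq_mul]
  field_simp

end Gaussian

end CovSelection

namespace CovSelection

/-! ### Second moments of mixtures of centred normal laws. -/

section Mixture

/-- The density of the centred normal distribution with half-precision `τ`. -/
noncomputable def normalDensity (τ y : ℝ) : ℝ := √(τ / Real.pi) * Real.exp (-(τ * y ^ 2))

theorem measurable_normalDensity : Measurable fun p : ℝ × ℝ => normalDensity p.1 p.2 := by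
  unfold normalDensity
  fun_prop

theorem normalDensity_nonneg (τ y : ℝ) : 0 ≤ normalDensity τ y := by
  unfold normalDensity
  positivity

theorem normalDensity_eq {τ : ℝ} (hτ : 0 < τ) :
    normalDensity τ = gaussianPDFReal 0 (Real.toNNReal (2 * τ)⁻¹) := by
  ext y
  rw [normalDensity, gaussianPDFReal, Real.coe_toNNReal _ (by positivity), ← Real.sqrt_inv]
  congr 2
  · field_simp
  · field_simp
    ring

theorem toNNReal_inv_ne_zero {τ : ℝ} (hτ : 0 < τ) : Real.toNNReal (2 * τ)⁻¹ ≠ 0 := by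
  rw [Ne, Real.toNNReal_eq_zero, not_le]
  positivity

theorem integral_normalDensity {τ : ℝ} (hτ : 0 < τ) : ∫ y, normalDensity τ y = 1 := by
  rw [normalDensity_eq hτ]
  exact integral_gaussianPDFReal_eq_one 0 (toNNReal_inv_ne_zero hτ)

theorem integral_mul_normalDensity {τ : ℝ} (hτ : 0 < τ) : ∫ y, y * normalDensity τ y = 0 := by
  have h := integral_gaussianReal_eq_integral_smul (μ := 0) (f := fun y : ℝ => y)
    (toNNReal_inv_ne_zero hτ)
  rw [integral_id_gaussianReal, ← normalDensity_eq hτ] at h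
  rw [h]
  simp only [smul_eq_mul, mul_comm]

theorem integral_sq_mul_normalDensity {τ : ℝ} (hτ : 0 < τ) :
    ∫ y, y * y * normalDensity τ y = (2 * τ)⁻¹ := by
  have h := integral_gaussianReal_eq_integral_smul (μ := 0) (f := fun y : ℝ => y * y)
    (toNNReal_inv_ne_zero hτ)
  have hv := variance_id_gaussianReal (μ := 0) (v := Real.toNNReal (2 * τ)⁻¹)
  rw [variance_eq_integral aemeasurable_id] at hv
  simp only [id, integral_id_gaussianReal, sub_zero, sq] at hv
  rw [hv, ← normalDensity_eq hτ, Real.coe_toNNReal _ (by positivity)] at h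
  rw [h]
  simp only [smul_eq_mul, mul_comm]

theorem integrable_normalDensity {τ : ℝ} (hτ : 0 < τ) : Integrable (normalDensity τ) := by
  rw [normalDensity_eq hτ]
  exact integrable_gaussianPDFReal _ _

theorem integrable_sq_mul_normalDensity {τ : ℝ} (hτ : 0 < τ) :
    Integrable fun y => y * y * normalDensity τ y := by
  refine Integrable.of_integral_ne_zero ?_
  rw [integral_sq_mul_normalDensity hτ]
  positivity

variable {ι : Type*} [Fintype ι] [DecidableEq ι]

/-- Putting the two coordinates inside the product makes the integrand a product of functions of one
variable, so its integral factorises. -/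
theorem coord_mul_prod_eq (τ y : ι → ℝ) (j k : ι) :
    y j * y k * ∏ i, normalDensity (τ i) (y i) =
      ∏ i, ((if i = j then y i else 1) * (if i = k then y i else 1) *
        normalDensity (τ i) (y i)) := by
  rw [Finset.prod_mul_distrib, Finset.prod_mul_distrib, Finset.prod_ite_eq' Finset.univ j,
    Finset.prod_ite_eq' Finset.univ k]
  simp

theorem integral_coord_mul_prod {τ : ι → ℝ} (hτ : ∀ i, 0 < τ i) (j k : ι) :
    ∫ y : ι → ℝ, y j * y k * ∏ i, normalDensity (τ i) (y i) =
      if j = k then (2 * τ j)⁻¹ else 0 := by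
  simp_rw [coord_mul_prod_eq]
  rw [integral_fintype_prod_volume_eq_prod (f := fun i y => (if i = j then y else 1) *
    (if i = k then y else 1) * normalDensity (τ i) y)]
  split_ifs with hjk
  · subst hjk
    rw [Finset.prod_eq_single j]
    · simpa using integral_sq_mul_normalDensity (hτ j)
    · intro i _ hij
      simpa [hij] using integral_normalDensity (hτ i)
    · simp
  · refine Finset.prod_eq_zero (Finset.mem_univ j) ?_
    simpa [hjk] using integral_mul_normalDensity (hτ j)

theorem integrable_coord_sq_mul_prod {τ : ι → ℝ} (hτ : ∀ i, 0 < τ i) (j : ι) :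
    Integrable fun y : ι → ℝ => y j * y j * ∏ i, normalDensity (τ i) (y i) := by
  simp_rw [coord_mul_prod_eq]
  refine Integrable.fintype_prod (f := fun i y => (if i = j then y else 1) *
    (if i = j then y else 1) * normalDensity (τ i) y) fun i => ?_
  by_cases hij : i = j
  · simpa [hij] using integrable_sq_mul_normalDensity (hτ j)
  · simpa [hij] using integrable_normalDensity (hτ i)

variable {T : Type*} [MeasurableSpace T] {m : Measure T} {w : T → ℝ}
  {τ : ι → T → ℝ}

/-- For `j = k` the integrand is nonnegative and the iterated integral is finite by hypothesis; in
general it is dominated through `|y_j y_k| ≤ y_j² + y_k²`. -/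
theorem integrable_prod_mixture (hw : Measurable w) (hτ : ∀ i, Measurable (τ i))
    (hpos : ∀ᵐ t ∂m, 0 ≤ w t ∧ ∀ i, 0 < τ i t)
    (hint : ∀ j, Integrable (fun t => w t * (2 * τ j t)⁻¹) m) (j k : ι) :
    Integrable (fun p : T × (ι → ℝ) =>
      p.2 j * p.2 k * (w p.1 * ∏ i, normalDensity (τ i p.1) (p.2 i))) (m.prod volume) := by
  have hmeas (j k : ι) : Measurable fun p : T × (ι → ℝ) =>
      p.2 j * p.2 k * (w p.1 * ∏ i, normalDensity (τ i p.1) (p.2 i)) := by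
    have h1 (i : ι) : Measurable fun p : T × (ι → ℝ) => normalDensity (τ i p.1) (p.2 i) :=
      measurable_normalDensity.comp (((hτ i).comp measurable_fst).prodMk
        ((measurable_pi_apply i).comp measurable_snd))
    have h2 : Measurable fun p : T × (ι → ℝ) => ∏ i, normalDensity (τ i p.1) (p.2 i) :=
      Finset.measurable_fun_prod _ fun i _ => h1 i
    fun_prop
  have hre (j : ι) (t : T) (y : ι → ℝ) : y j * y j * (w t * ∏ i, normalDensity (τ i t) (y i)) =
      w t * (y j * y j * ∏ i, normalDensity (τ i t) (y i)) := by ring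
  have hdiag (j : ι) : Integrable (fun p : T × (ι → ℝ) =>
      p.2 j * p.2 j * (w p.1 * ∏ i, normalDensity (τ i p.1) (p.2 i))) (m.prod volume) := by
    refine (integrable_prod_iff (hmeas j j).aestronglyMeasurable).2 ⟨?_, ?_⟩
    · filter_upwards [hpos] with t ht
      simp only [hre]
      exact (integrable_coord_sq_mul_prod ht.2 j).const_mul _
    · refine (hint j).congr ?_
      filter_upwards [hpos] with t ht
      have hnn (y : ι → ℝ) : 0 ≤ w t * (y j * y j * ∏ i, normalDensity (τ i t) (y i)) :=
        mul_nonneg ht.1 (mul_nonneg (mul_self_nonneg _)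
          (Finset.prod_nonneg fun i _ => normalDensity_nonneg _ _))
      simp only [hre, Real.norm_of_nonneg (hnn _)]
      rw [integral_const_mul, integral_coord_mul_prod ht.2, if_pos rfl]
  refine ((hdiag j).add (hdiag k)).mono (hmeas j k).aestronglyMeasurable
    (Eventually.of_forall fun p => ?_)
  simp only [Pi.add_apply]
  rw [← add_mul, norm_mul, norm_mul (p.2 j * p.2 j + p.2 k * p.2 k)]
  refine mul_le_mul_of_nonneg_right ?_ (norm_nonneg _)
  rw [Real.norm_eq_abs, Real.norm_eq_abs, abs_of_nonneg (a := _ + _)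
    (add_nonneg (mul_self_nonneg _) (mul_self_nonneg _)), abs_le]
  constructor <;> nlinarith [sq_nonneg (p.2 j + p.2 k), sq_nonneg (p.2 j - p.2 k)]

/-- Second moments of a mixture of centred normal distributions with independent coordinates. -/
theorem moments_mixture [SFinite m] (hw : Measurable w) (hτ : ∀ i, Measurable (τ i))
    (hpos : ∀ᵐ t ∂m, 0 ≤ w t ∧ ∀ i, 0 < τ i t)
    (hint : ∀ j, Integrable (fun t => w t * (2 * τ j t)⁻¹) m) (j k : ι) :
    Integrable (fun y : ι → ℝ =>
      y j * y k * ∫ t, w t * ∏ i, normalDensity (τ i t) (y i) ∂m) ∧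
    ∫ y : ι → ℝ, y j * y k * ∫ t, w t * ∏ i, normalDensity (τ i t) (y i) ∂m =
      if j = k then ∫ t, w t * (2 * τ j t)⁻¹ ∂m else 0 := by
  have h := integrable_prod_mixture hw hτ hpos hint j k
  have hre (y : ι → ℝ) : y j * y k * ∫ t, w t * ∏ i, normalDensity (τ i t) (y i) ∂m =
      ∫ t, y j * y k * (w t * ∏ i, normalDensity (τ i t) (y i)) ∂m :=
    (integral_const_mul _ _).symm
  simp only [hre]
  refine ⟨h.integral_prod_right, ?_⟩
  rw [← integral_integral_swap h]
  have hinner : (fun t => ∫ y : ι → ℝ, y j * y k * (w t * ∏ i, normalDensity (τ i t) (y i)))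
      =ᵐ[m] fun t => if j = k then w t * (2 * τ j t)⁻¹ else 0 := by
    filter_upwards [hpos] with t ht
    have (y : ι → ℝ) : y j * y k * (w t * ∏ i, normalDensity (τ i t) (y i)) =
      w t * (y j * y k * ∏ i, normalDensity (τ i t) (y i)) := by ring
    simp only [this]
    rw [integral_const_mul, integral_coord_mul_prod ht.2]
    simp
  rw [integral_congr_ae hinner]
  split_ifs <;> simp

end Mixture

/-! ### Inverse moment of the gamma distribution. -/

section GammaMoments

theorem integral_gammaPDFReal_Ioi {a r : ℝ} (ha : 0 < a) (hr : 0 < r) :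
    ∫ t in Set.Ioi (0 : ℝ), gammaPDFReal a r t = 1 := by
  have h := integral_likelihood_mul_gammaPDFReal ha hr le_rfl le_rfl
  have := Real.Gamma_pos_of_pos ha
  have hra : 0 < r ^ a := by positivity
  simp only [Real.rpow_zero, mul_zero, neg_zero, Real.exp_zero, one_mul, add_zero] at h
  rw [h, Real.rpow_neg hr.le]
  field_simp

/-- Dividing by `t` lowers the shape by one, so `Γ(a - 1)/Γ(a) = 1/(a - 1)` appears; this is where
shape above `1` is needed. -/
theorem integral_gammaPDFReal_mul_inv {a r : ℝ} (ha : 1 < a) (hr : 0 < r) :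
    ∫ t in Set.Ioi (0 : ℝ), gammaPDFReal a r t * (2 * t)⁻¹ = r / (2 * a - 2) := by
  have ha' : 0 < a - 1 := by linarith
  have hΓ := Real.Gamma_pos_of_pos ha'
  have hΓ' : Real.Gamma a = (a - 1) * Real.Gamma (a - 1) := by
    rw [← Real.Gamma_add_one ha'.ne', sub_add_cancel]
  have h := integral_Ioi_rpow_mul_exp_neg ha' hr
  have hcongr : ∀ t ∈ Set.Ioi (0 : ℝ), gammaPDFReal a r t * (2 * t)⁻¹ =
      r ^ a / (2 * Real.Gamma a) * (t ^ (a - 1 - 1) * Real.exp (-(r * t))) := by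
    intro t ht
    have ht' : (0 : ℝ) < t := ht
    rw [gammaPDFReal, if_pos ht'.le, Real.rpow_sub_one ht'.ne' (a - 1)]
    field_simp
  rw [setIntegral_congr_fun measurableSet_Ioi hcongr, integral_const_mul, h, hΓ',
    Real.rpow_neg hr.le, Real.rpow_sub_one hr.ne']
  have hra : 0 < r ^ a := by positivity
  have : 2 * a - 2 = 2 * (a - 1) := by ring
  rw [this]
  field_simp

theorem integrableOn_gammaPDFReal_mul_inv {a r : ℝ} (ha : 1 < a) (hr : 0 < r) :
    IntegrableOn (fun t => gammaPDFReal a r t * (2 * t)⁻¹) (Set.Ioi 0) := by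
  refine Integrable.of_integral_ne_zero ?_
  rw [integral_gammaPDFReal_mul_inv ha hr]
  have : 0 < 2 * a - 2 := by linarith
  positivity

theorem integrableOn_gammaPDFReal {a r : ℝ} (ha : 0 < a) (hr : 0 < r) :
    IntegrableOn (gammaPDFReal a r) (Set.Ioi 0) := by
  refine Integrable.of_integral_ne_zero ?_
  rw [integral_gammaPDFReal_Ioi ha hr]
  exact one_ne_zero

end GammaMoments

/-! ### From a density on `Fin d → ℝ` to moments of a law on Euclidean space. -/

section Density

variable {d : ℕ}

/-- Second moments of a law on `ℝ^d` with a given density. -/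
theorem moments_withDensity {ρ : EuclideanSpace ℝ (Fin d) → ℝ} (hρ : AEMeasurable ρ)
    (hρ0 : ∀ x, 0 ≤ ρ x) {V : Matrix (Fin d) (Fin d) ℝ}
    (hint : ∀ j k, Integrable fun y : Fin d → ℝ => y j * y k * ρ (WithLp.toLp 2 y))
    (hval : ∀ j k, ∫ y : Fin d → ℝ, y j * y k * ρ (WithLp.toLp 2 y) = V j k) :
    MemLp id 2 (volume.withDensity fun x => ENNReal.ofReal (ρ x)) ∧
      ∀ j k, ∫ x, x j * x k ∂(volume.withDensity fun x => ENNReal.ofReal (ρ x)) = V j k := by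
  have hmp := PiLp.volume_preserving_toLp (Fin d)
  have hemb : MeasurableEmbedding (WithLp.toLp 2 : (Fin d → ℝ) → EuclideanSpace ℝ (Fin d)) :=
    (MeasurableEquiv.toLp 2 (Fin d → ℝ)).measurableEmbedding
  have hint' (j k : Fin d) : Integrable (fun x : EuclideanSpace ℝ (Fin d) => x j * x k)
      (volume.withDensity fun x => ENNReal.ofReal (ρ x)) := by
    rw [integrable_withDensity_iff_integrable_smul₀' hρ.ennreal_ofReal (by simp)]
    simp only [ENNReal.toReal_ofReal (hρ0 _), smul_eq_mul, mul_comm (ρ _)]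
    exact (hmp.integrable_comp_emb hemb).1 (hint j k)
  refine ⟨?_, fun j k => ?_⟩
  · rw [memLp_two_iff_integrable_sq_norm aestronglyMeasurable_id]
    have hnorm : (fun x : EuclideanSpace ℝ (Fin d) => ‖id x‖ ^ 2) =
        fun x => ∑ j, x j * x j := by
      ext x
      rw [id, EuclideanSpace.real_norm_sq_eq]
      simp only [sq]
    rw [hnorm]
    exact integrable_finsetSum _ fun j _ => hint' j j
  · rw [integral_withDensity_eq_integral_toReal_smul₀ hρ.ennreal_ofReal (by simp), ← hval j k,
      ← hmp.integral_comp hemb]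
    simp only [ENNReal.toReal_ofReal (hρ0 _), smul_eq_mul, mul_comm]

end Density

end CovSelection

namespace CovSelection

variable {d : ℕ}

/-! ### The marginal law under model `D`. -/

section MarginalD

theorem evidenceD_one_eq_mixture (α : ℝ) (β y : Fin d → ℝ) :
    evidenceD α β 1 (fun _ => WithLp.toLp 2 y) =
      ∫ η in Set.univ.pi fun _ : Fin d => Set.Ioi (0 : ℝ),
        (∏ j, gammaPDFReal α (β j) (η j)) * ∏ j, normalDensity (η j) (y j) := by
  have hset : {η : Fin d → ℝ | ∀ j, 0 < η j} = Set.univ.pi fun _ => Set.Ioi 0 := by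
    ext
    simp
  rw [evidenceD, hset]
  refine setIntegral_congr_fun (MeasurableSet.univ_pi fun _ => measurableSet_Ioi) fun η hη => ?_
  have hη' : ∀ j, 0 < η j := by simpa using hη
  have h1 : ∏ j, normalDensity (η j) (y j) =
      likelihood (Matrix.diagonal η) 1 fun _ => WithLp.toLp 2 y := by
    simp only [likelihood, normalDensity, Finset.prod_mul_distrib, ← Real.exp_sum,
      Matrix.det_diagonal]
    congr 1
    · have (j : Fin d) : √(η j / Real.pi) = η j ^ (1 / 2 : ℝ) / Real.pi ^ (1 / 2 : ℝ) := by
        rw [Real.sqrt_eq_rpow, Real.div_rpow (hη' j).le Real.pi_pos.le]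
      simp only [this, Finset.prod_div_distrib, Nat.cast_one, one_mul]
      rw [Real.finsetProd_rpow _ _ fun j _ => (hη' j).le, Finset.prod_const, Finset.card_univ,
        Fintype.card_fin, ← Real.rpow_natCast, ← Real.rpow_mul Real.pi_pos.le]
      congr 2
      ring
    · simp [Matrix.trace, Matrix.diagonal_mul, scatter, sq]
  rw [h1, mul_comm]

theorem prod_gammaPDFReal_mul_inv_eq (α : ℝ) (β η : Fin d → ℝ) (j : Fin d) :
    (∏ i, gammaPDFReal α (β i) (η i)) * (2 * η j)⁻¹ =
      ∏ i, gammaPDFReal α (β i) (η i) * (if i = j then (2 * η i)⁻¹ else 1) := by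
  rw [Finset.prod_mul_distrib, Finset.prod_ite_eq' Finset.univ j]
  simp

theorem integrable_prod_gammaPDFReal_mul_inv {α : ℝ} {β : Fin d → ℝ} (hα : 1 < α)
    (hβ : ∀ j, 0 < β j) (j : Fin d) :
    Integrable (fun η : Fin d → ℝ => (∏ i, gammaPDFReal α (β i) (η i)) * (2 * η j)⁻¹)
      (volume.restrict (Set.univ.pi fun _ => Set.Ioi 0)) := by
  simp_rw [prod_gammaPDFReal_mul_inv_eq]
  rw [volume_pi, Measure.restrict_pi_pi]
  refine Integrable.fintype_prod (f := fun i t => gammaPDFReal α (β i) t *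
    (if i = j then (2 * t)⁻¹ else 1)) fun i => ?_
  by_cases hij : i = j
  · simpa [IntegrableOn, hij] using integrableOn_gammaPDFReal_mul_inv hα (hβ j)
  · simpa [IntegrableOn, hij] using integrableOn_gammaPDFReal (by linarith) (hβ i)

theorem integral_prod_gammaPDFReal_mul_inv {α : ℝ} {β : Fin d → ℝ} (hα : 1 < α)
    (hβ : ∀ j, 0 < β j) (j : Fin d) :
    ∫ η in Set.univ.pi fun _ : Fin d => Set.Ioi (0 : ℝ),
      (∏ i, gammaPDFReal α (β i) (η i)) * (2 * η j)⁻¹ = β j / (2 * α - 2) := by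
  simp_rw [prod_gammaPDFReal_mul_inv_eq]
  rw [volume_pi, Measure.restrict_pi_pi, integral_fintype_prod_eq_prod
    (f := fun i t => gammaPDFReal α (β i) t * (if i = j then (2 * t)⁻¹ else 1)),
    Finset.prod_eq_single j]
  · simpa using integral_gammaPDFReal_mul_inv hα (hβ j)
  · intro i _ hij
    simpa [hij] using integral_gammaPDFReal_Ioi (by linarith) (hβ i)
  · simp

theorem moments_marginalLawD {α : ℝ} {β : Fin d → ℝ} (hα : 1 < α) (hβ : ∀ j, 0 < β j) :
    MemLp id 2 (marginalLawD α β) ∧ ∀ j k, ∫ x, x j * x k ∂(marginalLawD α β) =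
      Matrix.diagonal (fun j => β j / (2 * α - 2)) j k := by
  have hα0 : 0 < α := by linarith
  have hw : Measurable fun η : Fin d → ℝ => ∏ j, gammaPDFReal α (β j) (η j) :=
    Finset.measurable_fun_prod _ fun j _ =>
      (measurable_gammaPDFReal α (β j)).comp (measurable_pi_apply j)
  have hpos : ∀ᵐ η : Fin d → ℝ ∂(volume.restrict (Set.univ.pi fun _ => Set.Ioi 0)),
      0 ≤ ∏ j, gammaPDFReal α (β j) (η j) ∧ ∀ j, 0 < η j := by
    refine ae_restrict_of_forall_mem (MeasurableSet.univ_pi fun _ => measurableSet_Ioi)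
      fun η hη => ⟨Finset.prod_nonneg fun j _ => gammaPDFReal_nonneg hα0 (hβ j) _, ?_⟩
    simpa using hη
  have hmix (j k : Fin d) := moments_mixture hw measurable_pi_apply hpos
    (integrable_prod_gammaPDFReal_mul_inv hα hβ) j k
  refine moments_withDensity
    (aemeasurable_evidenceD (X := fun _ x => x) (fun _ => aemeasurable_id) hα0 hβ 1)
    (fun x => (evidenceD_pos hα0 hβ 1 _).le) (fun j k => ?_) fun j k => ?_
  · simp only [evidenceD_one_eq_mixture]
    exact (hmix j k).1
  · simp only [evidenceD_one_eq_mixture]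
    rw [(hmix j k).2, integral_prod_gammaPDFReal_mul_inv hα hβ, Matrix.diagonal_apply]

end MarginalD

/-! ### The marginal law under model `A`. -/

section MarginalA

/-- Shifting `α` by `1/2` shifts the product of gamma functions by one index, so all but the first
and the last factor cancel. -/
theorem multivariateGamma_add_half (d : ℕ) (α : ℝ) :
    multivariateGamma d (α + 1 / 2) * Real.Gamma (α + 1 / 2 - d / 2) =
      Real.Gamma (α + 1 / 2) * multivariateGamma d α := by
  induction d with
  | zero => simp [multivariateGamma]
  | succ d ih =>
    have h : α + 1 / 2 - ((d + 1 : ℕ) : ℝ) / 2 = α - d / 2 := by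
      push_cast
      ring
    rw [multivariateGamma_succ, multivariateGamma_succ, h]
    linear_combination (Real.pi ^ ((d : ℝ) / 2) * Real.Gamma (α - d / 2)) * ih

theorem prod_normalDensity {t : ℝ} (ht : 0 < t) (y : Fin d → ℝ) :
    ∏ j, normalDensity t (y j) = (Real.pi ^ ((d : ℝ) / 2))⁻¹ *
      (t ^ ((d : ℝ) / 2) * Real.exp (-(t * (y ⬝ᵥ y)))) := by
  have h : √(t / Real.pi) ^ d = t ^ ((d : ℝ) / 2) / Real.pi ^ ((d : ℝ) / 2) := by
    rw [Real.sqrt_eq_rpow, ← Real.rpow_natCast, ← Real.rpow_mul (by positivity),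
      ← Real.div_rpow ht.le Real.pi_pos.le]
    congr 1
    ring
  simp only [normalDensity, Finset.prod_mul_distrib, ← Real.exp_sum, Finset.prod_const,
    Finset.card_univ, Fintype.card_fin, h, Finset.sum_neg_distrib, ← Finset.mul_sum, dotProduct,
    sq]
  ring

/-- In the coordinates `x = R y` the rank-one update depends on `y` only through `|y|²`, so the
marginal density becomes spherically symmetric. -/
theorem det_add_vecMulVec (R : Matrix (Fin d) (Fin d) ℝ) (y : Fin d → ℝ) :
    (R * Rᵀ + scatter 1 fun _ => WithLp.toLp 2 (R *ᵥ y)).det = R.det ^ 2 * (1 + y ⬝ᵥ y) := by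
  have h : R * Rᵀ + scatter 1 (fun _ => WithLp.toLp 2 (R *ᵥ y)) =
      R * (1 + Matrix.replicateCol Unit y * Matrix.replicateRow Unit y) * Rᵀ := by
    rw [Matrix.mul_add, Matrix.add_mul, Matrix.mul_one]
    congr 1
    have h1 : R * (Matrix.replicateCol Unit y * Matrix.replicateRow Unit y) * Rᵀ =
        (R * Matrix.replicateCol Unit y) * (R * Matrix.replicateCol Unit y)ᵀ := by
      rw [Matrix.transpose_mul, Matrix.transpose_replicateCol]
      simp only [Matrix.mul_assoc]
    rw [h1]
    ext j k
    simp [scatter, Matrix.mul_apply, Matrix.mulVec, dotProduct, mul_comm]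
  rw [h, Matrix.det_mul, Matrix.det_mul, Matrix.det_transpose,
    Matrix.det_one_add_replicateCol_mul_replicateRow]
  ring

/-- After a linear change of variables, the marginal density of one observation under the general
model is a scale mixture of standard normal densities. -/
theorem evidenceA_one_eq_mixture {α : ℝ} (hα : ((d : ℝ) - 1) / 2 < α)
    {R : Matrix (Fin d) (Fin d) ℝ} (hB : (R * Rᵀ).PosDef) (y : Fin d → ℝ) :
    evidenceA α (R * Rᵀ) 1 (fun _ => WithLp.toLp 2 (R *ᵥ y)) = |R.det⁻¹| *
      ∫ t in Set.Ioi (0 : ℝ), gammaPDFReal (α + 1 / 2 - d / 2) 1 t *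
        ∏ j, normalDensity t (y j) := by
  -- The shape of the mixing law is chosen so that adding `d/2` from the normal densities gives `α +
  -- 1/2`, the power of `1 + |y|²` in the closed form.
  have ha : 0 < α + 1 / 2 - d / 2 := by linarith
  have hdet : (R * Rᵀ).det = R.det ^ 2 := by rw [Matrix.det_mul, Matrix.det_transpose, sq]
  have hR : R.det ≠ 0 := by
    intro h
    have := hB.det_pos
    simp [hdet, h] at this
  have hyy : 0 ≤ y ⬝ᵥ y := Finset.sum_nonneg fun i _ => mul_self_nonneg _
  have hcongr : ∀ t ∈ Set.Ioi (0 : ℝ), gammaPDFReal (α + 1 / 2 - d / 2) 1 t *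
      ∏ j, normalDensity t (y j) = (Real.pi ^ ((d : ℝ) / 2))⁻¹ * (t ^ ((d : ℝ) / 2) *
        Real.exp (-(t * (y ⬝ᵥ y))) * gammaPDFReal (α + 1 / 2 - d / 2) 1 t) := by
    intro t ht
    rw [prod_normalDensity ht]
    ring
  have hΓ := multivariateGamma_add_half d α
  have hΓ1 := Real.Gamma_pos_of_pos ha
  have hΓ2 := multivariateGamma_pos hα
  have hpow : (R.det ^ 2) ^ α * (R.det ^ 2) ^ (-(α + 1 / 2)) = |R.det⁻¹| := by
    rw [← Real.rpow_add (by positivity), show α + -(α + 1 / 2) = -(1 / 2 : ℝ) by ring,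
      Real.rpow_neg (by positivity), ← Real.sqrt_eq_rpow, Real.sqrt_sq_eq_abs, abs_inv]
  rw [setIntegral_congr_fun measurableSet_Ioi hcongr, integral_const_mul,
    integral_likelihood_mul_gammaPDFReal ha one_pos (by positivity) hyy, evidenceA_eq hα hB,
    det_add_vecMulVec, hdet, Real.one_rpow, ← hpow]
  simp only [Nat.cast_one, one_mul, sub_add_cancel]
  rw [Real.mul_rpow (by positivity) (by positivity)]
  generalize multivariateGamma d (α + 1 / 2) = G at hΓ ⊢
  generalize Real.Gamma (α + 1 / 2 - d / 2) = γ at hΓ hΓ1 ⊢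
  generalize Real.Gamma (α + 1 / 2) = γ' at hΓ ⊢
  generalize multivariateGamma d α = G' at hΓ hΓ2 ⊢
  generalize -(α + 1 / 2) = e
  field_simp
  linear_combination hΓ

theorem moments_marginalLawA {α : ℝ} {B : Matrix (Fin d) (Fin d) ℝ}
    (hα : ((d : ℝ) + 1) / 2 < α) (hB : B.PosDef) :
    MemLp id 2 (marginalLawA α B) ∧ ∀ j k, ∫ x, x j * x k ∂(marginalLawA α B) =
      ((2 * α - ((d : ℝ) + 1))⁻¹ • B) j k := by
  have hα' : ((d : ℝ) - 1) / 2 < α := by linarith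
  have ha : 1 < α + 1 / 2 - d / 2 := by linarith
  obtain ⟨R, rfl⟩ := exists_eq_mul_transpose hB
  have hR : R.det ≠ 0 := by
    intro h
    have := hB.det_pos
    simp [h] at this
  set κ := (2 * α - ((d : ℝ) + 1))⁻¹ with hκ
  set g : (Fin d → ℝ) → ℝ := fun y => ∫ t in Set.Ioi (0 : ℝ),
    gammaPDFReal (α + 1 / 2 - d / 2) 1 t * ∏ j, normalDensity t (y j) with hg
  have hmix (p q : Fin d) : Integrable (fun y : Fin d → ℝ => y p * y q * g y) ∧
      ∫ y : Fin d → ℝ, y p * y q * g y = if p = q then κ else 0 := by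
    have h := moments_mixture (ι := Fin d) (m := volume.restrict (Set.Ioi (0 : ℝ)))
      (w := gammaPDFReal (α + 1 / 2 - d / 2) 1) (τ := fun _ t => t)
      (measurable_gammaPDFReal _ _) (fun _ => measurable_id)
      (ae_restrict_of_forall_mem measurableSet_Ioi fun t ht =>
        ⟨gammaPDFReal_nonneg (by linarith) one_pos t, fun _ => ht⟩)
      (fun _ => integrableOn_gammaPDFReal_mul_inv ha one_pos) p q
    rw [integral_gammaPDFReal_mul_inv ha one_pos] at h
    -- The mixture has second moment `κ I`, so `x = R y` has `κ R Rᵀ = κ B`.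
    have hk : 1 / (2 * (α + 1 / 2 - d / 2) - 2) = κ := by
      rw [hκ, one_div]
      congr 1
      ring
    rwa [hk] at h
  have hemb : MeasurableEmbedding (Matrix.toLin' R) :=
    (LinearMap.continuous_of_finiteDimensional _).measurableEmbedding
      (Matrix.mulVec_injective_of_isUnit ((Matrix.isUnit_iff_isUnit_det R).2 hR.isUnit))
  have hmap := Real.map_matrix_volume_pi_eq_smul_volume_pi hR
  have hc : 0 < |R.det⁻¹| := abs_pos.2 (inv_ne_zero hR)
  have hexp (j k : Fin d) (y : Fin d → ℝ) : Matrix.toLin' R y j * Matrix.toLin' R y k *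
      evidenceA α (R * Rᵀ) 1 (fun _ => WithLp.toLp 2 (Matrix.toLin' R y)) =
      ∑ p, ∑ q, |R.det⁻¹| * (R j p * R k q) * (y p * y q * g y) := by
    rw [Matrix.toLin'_apply, evidenceA_one_eq_mixture hα' hB]
    simp only [Matrix.mulVec, dotProduct]
    rw [Finset.sum_mul_sum, Finset.sum_mul]
    refine Finset.sum_congr rfl fun p _ => ?_
    rw [Finset.sum_mul]
    refine Finset.sum_congr rfl fun q _ => ?_
    rw [hg]
    ring
  refine moments_withDensity
    (aemeasurable_evidenceA (X := fun _ x => x) (fun _ => aemeasurable_id) hα' hB 1)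
    (fun x => (evidenceA_pos hα' hB 1 _).le) (fun j k => ?_) fun j k => ?_
  · have h : Integrable (fun y : Fin d → ℝ => y j * y k *
        evidenceA α (R * Rᵀ) 1 fun _ => WithLp.toLp 2 y)
        (Measure.map (Matrix.toLin' R) volume) := by
      rw [hemb.integrable_map_iff]
      refine (integrable_finsetSum Finset.univ fun p _ => integrable_finsetSum Finset.univ
        fun q _ => (hmix p q).1.const_mul (|R.det⁻¹| * (R j p * R k q))).congr
        (Eventually.of_forall fun y => ?_)
      exact (hexp j k y).symm
    -- The Jacobian only rescales Lebesgue measure by a positive finite constant.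
    rw [hmap, integrable_smul_measure (ENNReal.ofReal_pos.2 hc).ne' ENNReal.ofReal_ne_top] at h
    exact h
  · have h := hemb.integral_map (μ := volume) (fun y : Fin d → ℝ => y j * y k *
      evidenceA α (R * Rᵀ) 1 fun _ => WithLp.toLp 2 y)
    rw [hmap, integral_smul_measure, ENNReal.toReal_ofReal hc.le, smul_eq_mul] at h
    simp only [hexp] at h
    rw [integral_finsetSum _ fun p _ => integrable_finsetSum _ fun q _ =>
      (hmix p q).1.const_mul _] at h
    simp only [integral_finsetSum _ fun q _ => (hmix _ q).1.const_mul _, integral_const_mul,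
      (hmix _ _).2, mul_ite, mul_zero, Finset.sum_ite_eq, Finset.mem_univ, if_true] at h
    refine mul_left_cancel₀ hc.ne' (h.trans ?_)
    simp only [Matrix.smul_apply, Matrix.mul_apply, Matrix.transpose_apply, smul_eq_mul,
      Finset.mul_sum]
    exact Finset.sum_congr rfl fun p _ => by ring

end MarginalA

end CovSelection

/-! ### Transfer of the degenerate cases from covariance to half-precision, and the main theorem. -/

namespace CovSelection

lemma isDiag_of_isDiag_inv_two_smul {d : ℕ} {H : Matrix (Fin d) (Fin d) ℝ} (hH : H.PosDef)
    (h : ((2 : ℝ) • H)⁻¹.IsDiag) : H.IsDiag := by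
  have hu : IsUnit ((2 : ℝ) • H).det := (hH.smul two_pos).det_pos.ne'.isUnit
  have hinv : ((2 : ℝ) • H).IsDiag := by
    rw [← Matrix.nonsing_inv_nonsing_inv _ hu, ← h.diagonal_diag, Matrix.inv_diagonal]
    exact Matrix.isDiag_diagonal _
  intro i j hij
  simpa using hinv hij

lemma eq_smul_one_of_inv_two_smul_eq {d : ℕ} {H : Matrix (Fin d) (Fin d) ℝ} (hH : H.PosDef)
    {c : ℝ} (h : ((2 : ℝ) • H)⁻¹ = c • 1) : H = (c⁻¹ / 2) • 1 := by
  have hu : IsUnit ((2 : ℝ) • H).det := (hH.smul two_pos).det_pos.ne'.isUnit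
  have h1 : c • ((2 : ℝ) • H) = 1 := by
    rw [← Matrix.nonsing_inv_mul _ hu, h, Matrix.smul_mul, Matrix.one_mul]
  rcases eq_or_ne c 0 with rfl | hc
  -- If `c = 0` the identity matrix is zero, and then so is every matrix.
  · have h0 : (1 : Matrix (Fin d) (Fin d) ℝ) = 0 := by rw [← h1, zero_smul]
    rw [← Matrix.mul_one H, h0]; simp
  · rw [← h1, smul_smul, smul_smul]
    field_simp
    simp

end CovSelection

theorem mainTheorem4 {d : ℕ} (hd : 1 ≤ d)
    -- hyperparameters of the priors of the models A, D and C
    (αA : ℝ) (B : Matrix (Fin d) (Fin d) ℝ) (hαA : ((d : ℝ) + 1) / 2 < αA) (hB : B.PosDef)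
    (αD : ℝ) (β : Fin d → ℝ) (hαD : 1 < αD) (hβ : ∀ j, 0 < β j)
    (αC βC : ℝ) (hαC : 1 < αC) (hβC : 0 < βC)
    -- the observations
    {Ω : Type*} [MeasurableSpace Ω] (P : Measure Ω) [IsProbabilityMeasure P]
    (X : ℕ → Ω → EuclideanSpace ℝ (Fin d)) :
    -- C is true
    (∀ η : ℝ, 0 < η →
      CovSelection.IsIID P X (CovSelection.gaussianLaw (η • (1 : Matrix (Fin d) (Fin d) ℝ))) →
      TendstoInMeasure P
        (fun (n : ℕ) ω => (Real.log n)⁻¹ *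
          Real.log (CovSelection.evidenceA αA B n (fun i => X i ω) /
            CovSelection.evidenceC αC βC n (fun i => X i ω)))
        atTop (fun _ => -(((d : ℝ) * ((d : ℝ) + 1) / 2 - 1) / 2)) ∧
      TendstoInMeasure P
        (fun (n : ℕ) ω => (Real.log n)⁻¹ *
          Real.log (CovSelection.evidenceD αD β n (fun i => X i ω) /
            CovSelection.evidenceC αC βC n (fun i => X i ω)))
        atTop (fun _ => -(((d : ℝ) - 1) / 2))) ∧
    -- D is true
    (∀ η : Fin d → ℝ, (∀ j, 0 < η j) →
      CovSelection.IsIID P X (CovSelection.gaussianLaw (Matrix.diagonal η)) →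
      TendstoInMeasure P
        (fun (n : ℕ) ω => (Real.log n)⁻¹ *
          Real.log (CovSelection.evidenceA αA B n (fun i => X i ω) /
            CovSelection.evidenceD αD β n (fun i => X i ω)))
        atTop (fun _ => -(((d : ℝ) * ((d : ℝ) + 1) / 2 - d) / 2)) ∧
      ∃ v : Fin d → ℝ, (∀ j, v j = (2 * η j)⁻¹) ∧
        (∀ i, CovSelection.HasSecondMoment P (X i) (Matrix.diagonal v)) ∧
        TendstoInMeasure P
          (fun (n : ℕ) ω => (n : ℝ)⁻¹ *
            Real.log (CovSelection.evidenceD αD β n (fun i => X i ω) /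
              CovSelection.evidenceC αC βC n (fun i => X i ω)))
          atTop (fun _ => (d : ℝ) / 2 *
            Real.log (((∑ j, v j) / d) / (∏ j, v j) ^ (1 / (d : ℝ)))) ∧
        ((¬ ∃ c, ∀ j, η j = c) →
          0 < (d : ℝ) / 2 * Real.log (((∑ j, v j) / d) / (∏ j, v j) ^ (1 / (d : ℝ))))) ∧
    -- A is true
    (∀ H : Matrix (Fin d) (Fin d) ℝ, H.PosDef →
      CovSelection.IsIID P X (CovSelection.gaussianLaw H) →
      ∃ V : Matrix (Fin d) (Fin d) ℝ, V = ((2 : ℝ) • H)⁻¹ ∧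
        (∀ i, CovSelection.HasSecondMoment P (X i) V) ∧
        TendstoInMeasure P
          (fun (n : ℕ) ω => (n : ℝ)⁻¹ *
            Real.log (CovSelection.evidenceA αA B n (fun i => X i ω) /
              CovSelection.evidenceD αD β n (fun i => X i ω)))
          atTop (fun _ => CovSelection.halfLogHadamard V) ∧
        TendstoInMeasure P
          (fun (n : ℕ) ω => (n : ℝ)⁻¹ *
            Real.log (CovSelection.evidenceA αA B n (fun i => X i ω) /
              CovSelection.evidenceC αC βC n (fun i => X i ω)))
          atTop (fun _ => CovSelection.logMeanRatio V) ∧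
        (¬ H.IsDiag → 0 < CovSelection.halfLogHadamard V) ∧
        ((¬ ∃ c : ℝ, H = c • (1 : Matrix (Fin d) (Fin d) ℝ)) →
          0 < CovSelection.logMeanRatio V)) ∧
    -- the observations are independent draws from the marginal law of model D
    (CovSelection.IsIID P X (CovSelection.marginalLawD αD β) →
      ∃ v : Fin d → ℝ, (∀ j, v j = β j / (2 * αD - 2)) ∧
        (∀ i, CovSelection.HasSecondMoment P (X i) (Matrix.diagonal v)) ∧
        TendstoInMeasure P
          (fun (n : ℕ) ω => (n : ℝ)⁻¹ *
            Real.log (CovSelection.evidenceD αD β n (fun i => X i ω) /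
              CovSelection.evidenceC αC βC n (fun i => X i ω)))
          atTop (fun _ => (d : ℝ) / 2 *
            Real.log (((∑ j, v j) / d) / (∏ j, v j) ^ (1 / (d : ℝ)))) ∧
        ((¬ ∃ c, ∀ j, β j = c) →
          0 < (d : ℝ) / 2 * Real.log (((∑ j, v j) / d) / (∏ j, v j) ^ (1 / (d : ℝ))))) ∧
    -- the observations are independent draws from the marginal law of model A
    (CovSelection.IsIID P X (CovSelection.marginalLawA αA B) →
      ∃ V : Matrix (Fin d) (Fin d) ℝ, V = (2 * αA - ((d : ℝ) + 1))⁻¹ • B ∧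
        (∀ i, CovSelection.HasSecondMoment P (X i) V) ∧
        TendstoInMeasure P
          (fun (n : ℕ) ω => (n : ℝ)⁻¹ *
            Real.log (CovSelection.evidenceA αA B n (fun i => X i ω) /
              CovSelection.evidenceD αD β n (fun i => X i ω)))
          atTop (fun _ => CovSelection.halfLogHadamard V) ∧
        TendstoInMeasure P
          (fun (n : ℕ) ω => (n : ℝ)⁻¹ *
            Real.log (CovSelection.evidenceA αA B n (fun i => X i ω) /
              CovSelection.evidenceC αC βC n (fun i => X i ω)))
          atTop (fun _ => CovSelection.logMeanRatio V) ∧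
        (¬ B.IsDiag → 0 < CovSelection.halfLogHadamard V) ∧
        ((¬ ∃ c : ℝ, B = c • (1 : Matrix (Fin d) (Fin d) ℝ)) →
          0 < CovSelection.logMeanRatio V)) := by
  open CovSelection in
  have hαA' : ((d : ℝ) - 1) / 2 < αA := by linarith
  have hαD' : 0 < αD := by linarith
  have hαC' : 0 < αC := by linarith
  refine ⟨fun η hη h => ?_, fun η hη h => ?_, fun H hH h => ?_, fun h => ?_, fun h => ?_⟩
  · rw [Matrix.smul_one_eq_diagonal] at h
    have hm := h.hasSecondMoment_gaussianLaw (Matrix.PosDef.diagonal fun _ => hη) 0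
    rw [inv_two_smul_diagonal fun _ => hη] at hm
    have h4 := fun i => h.memLp_gaussianLaw (p := 4) (by norm_num) i
    have hv : 0 < (2 * η)⁻¹ := by positivity
    exact ⟨h.tendstoInMeasure_log_A_C hd hv hm h4 hαA' hB hαC' hβC,
      h.tendstoInMeasure_log_D_C hd hv hm h4 hαD' hβ hαC' hβC⟩
  · have hm := fun i => h.hasSecondMoment_gaussianLaw (Matrix.PosDef.diagonal hη) i
    rw [inv_two_smul_diagonal hη] at hm
    have h4 := fun i => h.memLp_gaussianLaw (p := 4) (by norm_num) i
    have hv : ∀ j, 0 < (2 * η j)⁻¹ := fun j => by have := hη j; positivity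
    refine ⟨h.tendstoInMeasure_log_A_D hv (hm 0) h4 hαA' hB hαD' hβ,
      _, fun j => rfl, hm, h.tendstoInMeasure_linear_D_C hd hv (hm 0) hαD' hβ hαC' hβC,
      fun hne => logMeanRatio_diagonal_pos hd hv ?_⟩
    rintro ⟨c, hc⟩
    -- Solving `(2 η_j)⁻¹ = c` for `η_j`.
    exact hne ⟨c⁻¹ / 2, fun j => by rw [← hc j, inv_inv]; ring⟩
  · have hV := (hH.smul (two_pos (α := ℝ))).inv
    have hm := fun i => h.hasSecondMoment_gaussianLaw hH i
    exact ⟨_, rfl, hm, h.tendstoInMeasure_linear_A_D hV (hm 0) hαA' hB hαD' hβ,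
      h.tendstoInMeasure_linear_A_C hd hV (hm 0) hαA' hB hαC' hβC,
      fun hne => halfLogHadamard_pos hV fun hdiag => hne (isDiag_of_isDiag_inv_two_smul hH hdiag),
      fun hne => logMeanRatio_pos hd hV fun ⟨_, hc⟩ =>
        hne ⟨_, eq_smul_one_of_inv_two_smul_eq hH hc⟩⟩
  · obtain ⟨h2, hV⟩ := moments_marginalLawD hαD hβ
    have hm := fun i => hasSecondMoment_of_law (h.law i) h2 hV
    have hκ : 0 < 2 * αD - 2 := by linarith
    have hv : ∀ j, 0 < β j / (2 * αD - 2) := fun j => div_pos (hβ j) hκ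
    refine ⟨_, fun j => rfl, hm, h.tendstoInMeasure_linear_D_C hd hv (hm 0) hαD' hβ hαC' hβC,
      fun hne => logMeanRatio_diagonal_pos hd hv ?_⟩
    rintro ⟨c, hc⟩
    exact hne ⟨c * (2 * αD - 2), fun j => by rw [← hc j, div_mul_cancel₀ _ hκ.ne']⟩
  · obtain ⟨h2, hVm⟩ := moments_marginalLawA hαA hB
    have hm := fun i => hasSecondMoment_of_law (h.law i) h2 hVm
    have hκ : 0 < (2 * αA - ((d : ℝ) + 1))⁻¹ := inv_pos.2 (by linarith)
    have hV := hB.smul hκ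
    refine ⟨_, rfl, hm, h.tendstoInMeasure_linear_A_D hV (hm 0) hαA' hB hαD' hβ,
      h.tendstoInMeasure_linear_A_C hd hV (hm 0) hαA' hB hαC' hβC,
      fun hne => halfLogHadamard_pos hV fun hdiag => hne fun i j hij => ?_,
      fun hne => logMeanRatio_pos hd hV fun ⟨c, hc⟩ => hne ⟨(2 * αA - ((d : ℝ) + 1)) * c, ?_⟩⟩
    · exact (mul_eq_zero.1 (hdiag hij)).resolve_left hκ.ne'
    · rw [mul_smul, ← hc, smul_smul, mul_inv_cancel₀ (inv_pos.1 hκ).ne', one_smul]
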